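/- Let $p$ be a prime and $k$ a field of characteristic $p$. Let $\Lambda_\infty$ be the category with objects $[n]$, $n\ge 1$, whose morphisms $[n]\to[m]$ are the order-preserving maps $f:\mathbb Z\to\mathbb Z$ with $f(a+n)=f(a)+m$, and let $\sigma$ act on them by $f\mapsto f+m$. For $q\ge 1$ let $\Lambda_q$ be the category with the same objects and $\Lambda_q([n],[m])=\Lambda_\infty([n],[m])/\sigma^q$; thus $\Lambda=\Lambda_1$ is Connes' cyclic category. Let $\pi:\Lambda_p\to\Lambda$ be the projection (the identity on objects) and let $j_q:\Delta^{o}\to\Lambda_q$ be the embedding whose image consists of the classes of the maps $f$ with $f(0)=0$. For a small category $\Gamma$ let $\operatorname{Fun}(\Gamma,k)$ be the category of functors from $\Gamma$ to $k$-vector spaces, let $H_\bullet(\Gamma,-)$ be the derived functors of $\operatorname{colim}:\operatorname{Fun}(\Gamma,k)\to k\text{-Vect}$, and let $H^\bullet(\Gamma,k)=\operatorname{Ext}^\bullet_{\operatorname{Fun}(\Gamma,k)}(k,k)$; a class $x\in H^m(\Gamma,k)$ acts on $H_\bullet(\Gamma,E)$ through $E\otimes x\in\operatorname{Ext}^m(E,E)$,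 lowering the degree by $m$. For $E\in\operatorname{Fun}(\Lambda_q,k)$ put $HC_\bullet(E)=H_\bullet(\Lambda_q,E)$ and $HH_\bullet(E)=H_\bullet(\Delta^{o},j_q^*E)$. Let $u\in H^2(\Lambda_q,k)$ be the periodicity class, that is, the Yoneda class of the exact sequence $0\to k\to C_1\to C_0\to k\to 0$ whose value at $[n]$ is the augmented cellular chain complex of the circle with $qn$ marked points $\mathbb Z/qn$, extended on the left by the inclusion of the fundamental cycle. It gives the periodicity map $u:HC_\bullet(E)\to HC_{\bullet-2}(E)$, and $HP_\bullet(E)$ is the derived inverse limit of the cyclic homology complexes along $u$, i.e. the homology of the homotopy fibre of $\mathrm{id}-tu$ on $\prod_{i\ge 0}HC(E)[-2i]$, where $HC(E)$ denotes the complex computing $HC_\bullet(E)$ and $t$ shifts the factors. Then for every cyclic vector space $E\in\operatorname{Fun}(\Lambda,k)$ there are isomorphisms of graded $k$-vector spaces $$HC_\bullet(\pi^*E)\cong HH_\bullet(E)[u^{-1}],\qquad HP_\bullet(\pi^*E)\cong HH_\bullet(E)((u)),$$ that is, $HC_n(\pi^*E)\cong\bigoplus_{l\ge 0}HH_{n-2l}(E)$,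 and $HP_n(\pi^*E)$ is isomorphic to the space of formal Laurent series $\sum_l a_lu^l$ with $a_l\in HH_{n+2l}(E)$ and $a_l=0$ for $l\ll 0$. They can be chosen such that the periodicity map on $HC_\bullet(\pi^*E)$ corresponds to multiplication by $u$ on $HH_\bullet(E)[u^{-1}]$ (with $u\cdot u^{0}=0$), and such that, for every $m\ge 0$, the projection $HP_n(\pi^*E)\to HC_{n+2m}(\pi^*E)$ corresponds to multiplication by $u^{-m}$ followed by dropping the positive powers of $u$. Moreover, the restriction map $\pi^*:H^2(\Lambda,k)\to H^2(\Lambda_p,k)$ is zero. -/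

import Mathlib

open CategoryTheory Limits MonoidalCategory Abelian
universe u
noncomputable section
namespace CyclicHomology

/-! ### Homology and cohomology of small categories -/

section Homology
variable {Γ : Type} [SmallCategory Γ] {k : Type u} [Field k]

/-- `Fun(Γ, k)`: functors from a small category `Γ` to `k`-vector spaces. -/
abbrev FunCat (Γ : Type) [SmallCategory Γ] (k : Type u) [Field k] := Γ ⥤ ModuleCat.{u} k

/-- `Fun(Γ, k)` has enough projectives: sums of left Kan extensions from the objects of `Γ`. -/
instance : EnoughProjectives (FunCat Γ k) where
  presentation E := by
    let L (a : Γ) := (evaluationLeftAdjoint (ModuleCat.{u} k) a).obj (Projective.over (E.obj a))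
    have hL (a : Γ) : Projective (L a) :=
      (evaluationAdjunctionRight (ModuleCat.{u} k) a).map_projective _ inferInstance
    let φ (a : Γ) : L a ⟶ E :=
      ((evaluationAdjunctionRight (ModuleCat.{u} k) a).homEquiv _ _).symm
        (Projective.π (E.obj a))
    refine ⟨{ p := ∐ L, f := Sigma.desc φ, epi := ⟨?_⟩, projective := ⟨?_⟩ }⟩
    · intro X Y f e _
      exact ⟨Sigma.desc fun a => Projective.factorThru (Sigma.ι L a ≫ f) e, by
        apply Sigma.hom_ext
        intro a
        simp⟩
    intro Z g h w
    ext a : 2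
    rw [← cancel_epi (Projective.π (E.obj a))]
    have key : φ a ≫ g = φ a ≫ h := by
      simpa using congrArg (fun t => Sigma.ι L a ≫ t) w
    have := congrArg ((evaluationAdjunctionRight (ModuleCat.{u} k) a).homEquiv _ _) key
    simpa [φ, Adjunction.homEquiv_naturality_right] using this

instance : HasExt.{u} (FunCat Γ k) := hasExt_of_enoughProjectives _

variable (Γ k) in
/-- The constant functor `k ∈ Fun(Γ, k)`. -/
def constFun : FunCat Γ k := (Functor.const Γ).obj (ModuleCat.of k k)

/-- The derived functor `L τ_! E` of the colimit functor `τ_! = colim : Fun(Γ, k) ⥤ k-Vect`, as a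
complex: apply `colim` to a projective resolution of `E`. The grading is cohomological, so the term
of homological degree `n` sits in degree `-n`. -/
def chains (E : FunCat Γ k) : CochainComplex (ModuleCat.{u} k) ℤ :=
  (colim.mapHomologicalComplex (ComplexShape.up ℤ)).obj (projectiveResolution E).cochainComplex

/-- The homology `H_n(Γ, E)` of the small category `Γ` with coefficients in `E`. -/
def homologyOf (E : FunCat Γ k) (n : ℤ) : ModuleCat.{u} k := (chains E).homology (-n)

variable (Γ k) in
/-- The cohomology `H^n(Γ, k) = Ext^n(k, k)`, the `Ext` being taken in `Fun(Γ, k)`. -/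
abbrev Coh (n : ℕ) := Ext (constFun Γ k) (constFun Γ k) n

instance (E : FunCat Γ k) : (tensorLeft E).Additive where
  map_add {X Y f g} := by
    ext a : 2
    exact MonoidalPreadditive.whiskerLeft_add ..

instance (E : FunCat Γ k) : PreservesFiniteColimits (tensorLeft E) :=
  preservesFiniteColimits_of_evaluation _ fun a =>
    inferInstanceAs (PreservesFiniteColimits
      ((evaluation Γ (ModuleCat.{u} k)).obj a ⋙ tensorLeft (E.obj a)))
instance (E : FunCat Γ k) : PreservesFiniteLimits (tensorLeft E) :=
  preservesFiniteLimits_of_evaluation _ fun a =>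
    inferInstanceAs (PreservesFiniteLimits
      ((evaluation Γ (ModuleCat.{u} k)).obj a ⋙ tensorLeft (E.obj a)))

theorem exact_of_pointwise (S : ShortComplex (FunCat Γ k))
    (h : ∀ a, (S.map ((evaluation Γ (ModuleCat.{u} k)).obj a)).Exact) : S.Exact := by
  rw [ShortComplex.exact_iff_isZero_homology, Functor.isZero_iff]
  intro a
  have := h a
  rw [ShortComplex.exact_iff_isZero_homology] at this
  exact this.of_iso (S.mapHomologyIso ((evaluation Γ (ModuleCat.{u} k)).obj a)).symm


/-- The isomorphism `E ⊗ k ≅ E` for the pointwise tensor product on `Fun(Γ, k)`. -/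
def unitorIso (E : FunCat Γ k) : (tensorLeft E).obj (constFun Γ k) ≅ E := ρ_ E

/-- The class `E ⊗ x ∈ Ext^m(E, E)` for `x ∈ H^m(Γ, k) = Ext^m(k, k)`. -/
def tensorClass (E : FunCat Γ k) {m : ℕ} (x : Coh Γ k m) : Ext E E m :=
  (Ext.mk₀ (unitorIso E).inv).comp
    ((x.mapExactFunctor (tensorLeft E)).comp (Ext.mk₀ (unitorIso E).hom) (add_zero m)) (zero_add m)

open CochainComplex Localization in
/-- `Ext^m(E, E')` as homotopy classes of degree `m` maps between projective resolutions. -/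
def extEquiv (E E' : FunCat Γ k) (m : ℕ) : Ext E E' m ≃
    HomComplex.CohomologyClass (projectiveResolution E).cochainComplex
      (projectiveResolution E').cochainComplex m :=
  ((SmallShiftedHom.precompEquiv.{u} (projectiveResolution E).π'
    (by rw [HomologicalComplex.mem_quasiIso_iff]; infer_instance)).trans
   (SmallShiftedHom.postcompEquiv.{u} (projectiveResolution E').π'
    (by rw [HomologicalComplex.mem_quasiIso_iff]; infer_instance)).symm).trans
      HomComplex.CohomologyClass.equivOfIsKProjective.{u}.symm

/-- A chain map between the projective resolutions that represents an `Ext`-class; it is unique up to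
homotopy. -/
def extRep {E E' : FunCat Γ k} {m : ℕ} (x : Ext E E' m) :
    (projectiveResolution E).cochainComplex ⟶ (projectiveResolution E').cochainComplex⟦(m : ℤ)⟧ :=
  CochainComplex.HomComplex.Cocycle.equivHomShift.symm (extEquiv E E' m x).mk_surjective.choose

/-- The map `L τ_! E ⟶ L τ_! E'[m]` induced by a class in `Ext^m(E, E')`. -/
def chainsMap {E E' : FunCat Γ k} {m : ℕ} (x : Ext E E' m) : chains E ⟶ (chains E')⟦(m : ℤ)⟧ :=
  (colim.mapHomologicalComplex (ComplexShape.up ℤ)).map (extRep x) ≫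
    ((colim.mapHomologicalComplex (ComplexShape.up ℤ)).commShiftIso (m : ℤ)).hom.app _

/-- The action of `x ∈ H^m(Γ, k)` on `L τ_! E`. -/
def capMap (E : FunCat Γ k) {m : ℕ} (x : Coh Γ k m) : chains E ⟶ (chains E)⟦(m : ℤ)⟧ :=
  chainsMap (tensorClass E x)

/-- The action `H_n(Γ, E) ⟶ H_{n-m}(Γ, E)` of `x ∈ H^m(Γ, k)`. -/
def cap (E : FunCat Γ k) {m : ℕ} (x : Coh Γ k m) (n : ℤ) :
   homologyOf E n ⟶ homologyOf E (n - m) :=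
  HomologicalComplex.homologyMap (capMap E x) (-n) ≫
    (CochainComplex.ShiftSequence.shiftIso (ModuleCat.{u} k) (m : ℤ) (-n) (-(n - m)) (by ring)).hom.app _

variable {Γ₂ : Type} [SmallCategory Γ₂]
/-- The restriction functor `F^* : Fun(Γ, k) ⥤ Fun(Γ₂, k)` along `F : Γ₂ ⥤ Γ`. -/
abbrev pull (F : Γ₂ ⥤ Γ) : FunCat Γ k ⥤ FunCat Γ₂ k := (Functor.whiskeringLeft _ _ _).obj F
instance (F : Γ₂ ⥤ Γ) : (pull (k := k) F).Additive := ⟨by cat_disch⟩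
instance (F : Γ₂ ⥤ Γ) : PreservesFiniteLimits (pull (k := k) F) := ⟨fun _ ↦ inferInstance⟩
instance (F : Γ₂ ⥤ Γ) : PreservesFiniteColimits (pull (k := k) F) := ⟨fun _ ↦ inferInstance⟩

variable (k) in
/-- The restriction map `F^* : H^n(Γ, k) → H^n(Γ₂, k)`. -/
def cohPull (F : Γ₂ ⥤ Γ) (n : ℕ) : Coh Γ k n →+ Coh Γ₂ k n :=
  (pull F).mapExtAddHom (constFun Γ k) (constFun Γ k) n
end Homology
/-! ### Derived inverse limits -/

section Telescope
variable {k : Type u} [Field k]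
/-- The inverse system `⋯ ⟶ K[-4] ⟶ K[-2] ⟶ K` of a degree `2` endomorphism `U : K ⟶ K[2]`. -/
def towerMap {K : CochainComplex (ModuleCat.{u} k) ℤ} (U : K ⟶ K⟦(2 : ℤ)⟧) (i : ℕ) :
    K⟦(-2 * ((i + 1 : ℕ) : ℤ))⟧ ⟶ K⟦(-2 * (i : ℤ))⟧ :=
  U⟦(-2 * ((i + 1 : ℕ) : ℤ))⟧' ≫
    (shiftFunctorAdd' (CochainComplex (ModuleCat.{u} k) ℤ) 2 (-2 * ((i + 1 : ℕ) : ℤ)) (-2 * (i : ℤ))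
      (by push_cast; ring)).inv.app K

/-- The product `K[[t]] = ∏_{i ≥ 0} K[-2i]`. -/
def towerProd (K : CochainComplex (ModuleCat.{u} k) ℤ) :
    CochainComplex (ModuleCat.{u} k) ℤ := ∏ᶜ fun i : ℕ => K⟦(-2 * (i : ℤ))⟧

/-- The map `id - tU` on `K[[t]]`. -/
def idSubShift {K : CochainComplex (ModuleCat.{u} k) ℤ} (U : K ⟶ K⟦(2 : ℤ)⟧) :
    towerProd K ⟶ towerProd K :=
  𝟙 _ - Pi.lift fun i => Pi.π _ (i + 1) ≫ towerMap U i

/-- The derived inverse limit of the system `⋯ ⟶ K[-4] ⟶ K[-2] ⟶ K`: the cone of `id - tU`, shifted so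
that it is the homotopy fibre. -/
def telescope {K : CochainComplex (ModuleCat.{u} k) ℤ} (U : K ⟶ K⟦(2 : ℤ)⟧) :
    CochainComplex (ModuleCat.{u} k) ℤ := (CochainComplex.mappingCone (idSubShift U))⟦(-1 : ℤ)⟧

/-- The projection of the derived inverse limit to the `i`-th term `K[-2i]` of the system. -/
def telescopeProj {K : CochainComplex (ModuleCat.{u} k) ℤ} (U : K ⟶ K⟦(2 : ℤ)⟧) (i : ℕ) :
    telescope U ⟶ K⟦(-2 * (i : ℤ))⟧ :=
  (CochainComplex.mappingCone.triangle (idSubShift U)).mor₃⟦(-1 : ℤ)⟧' ≫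
   (shiftShiftNeg (towerProd K) (1 : ℤ)).hom ≫ Pi.π _ i
end Telescope

/-- Morphisms `[n] ⟶ [m]` of `Λ_∞`: order-preserving maps `f : ℤ → ℤ` that commute with the
endomorphisms `σ`, which are `a ↦ a + n` on `[n]` and `a ↦ a + m` on `[m]`. -/
@[ext]
structure LiftHom (n m : ℕ+) where
  toFun : ℤ → ℤ
  monotone' : Monotone toFun
  map_add' : ∀ a, toFun (a + n) = toFun a + m

namespace LiftHom
instance (n m : ℕ+) : CoeFun (LiftHom n m) (fun _ => ℤ → ℤ) := ⟨toFun⟩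

def id (n : ℕ+) : LiftHom n n := ⟨fun a => a, monotone_id, fun _ => rfl⟩

def comp {n m l : ℕ+} (f : LiftHom n m) (g : LiftHom m l) : LiftHom n l :=
  ⟨fun a => g (f a), g.monotone'.comp f.monotone', fun a => by
    rw [f.map_add', g.map_add']⟩

theorem map_add_mul {n m : ℕ+} (f : LiftHom n m) (a c : ℤ) :
    f (a + c * n) = f a + c * m := by
  induction c using Int.induction_on with
  | zero => simp
  | succ i ih =>
    rw [show a + ((i : ℤ) + 1) * n = (a + i * n) + n by ring, f.map_add', ih]; ring
  | pred i ih =>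
    have := f.map_add' (a + (-(i : ℤ) - 1) * n)
    rw [show a + (-(i : ℤ) - 1) * n + n = a + -(i : ℤ) * n by ring, ih] at this
    linarith

/-- Two maps `[n] ⟶ [m]` of `Λ_∞` are identified in `Λ_p` if they differ by a power of `σ ^ p`. -/
def setoid (p : ℕ) (n m : ℕ+) : Setoid (LiftHom n m) where
  r f g := ∃ c : ℤ, ∀ a, g a = f a + c * p * m
  iseqv :=
    { refl := fun f => ⟨0, by simp⟩
      symm := fun {f g} ⟨c, h⟩ => ⟨-c, fun a => by rw [h]; ring⟩
      trans := fun {f g i} ⟨c, h⟩ ⟨d, h'⟩ => ⟨c + d, fun a => by rw [h', h]; ring⟩ }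

end LiftHom

/-- Objects `[n]`, `n ≥ 1`, of the `p`-cyclic category `Λ_p`; `Lambda 1` is Connes' cyclic category `Λ`. -/
structure Lambda (p : ℕ) where
  card : ℕ+

namespace Lambda

/-- The `p`-cyclic category, with `Λ_p([n], [m]) = Λ_∞([n], [m]) / σ ^ p`. -/
instance category (p : ℕ) : SmallCategory (Lambda p) where
  Hom X Y := Quotient (LiftHom.setoid p X.card Y.card)
  id X := Quotient.mk _ (LiftHom.id X.card)
  comp {X Y Z} := Quotient.map₂ LiftHom.comp (by
    rintro f f' ⟨c, hc⟩ g g' ⟨d, hd⟩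
    refine ⟨c + d, fun a => ?_⟩
    have := g.map_add_mul (f a) (c * p)
    simp only [LiftHom.comp, hc, hd]
    rw [this]; ring)
  id_comp := by rintro X Y ⟨f⟩; rfl
  comp_id := by rintro X Y ⟨f⟩; rfl
  assoc := by rintro X Y Z W ⟨f⟩ ⟨g⟩ ⟨h⟩; rfl

variable {p : ℕ}
/-- The class in `Λ_p` of a map of `Λ_∞`. -/
def homMk {X Y : Lambda p} (f : LiftHom X.card Y.card) : X ⟶ Y :=
  Quotient.mk (LiftHom.setoid p X.card Y.card) f

variable (p) in
/-- The projection `π : Λ_p ⥤ Λ`. -/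
def proj : Lambda p ⥤ Lambda 1 where
  obj X := ⟨X.card⟩
  map {X Y} := Quotient.map' (s₁ := LiftHom.setoid p X.card Y.card)
    (s₂ := LiftHom.setoid 1 X.card Y.card) (fun f => f)
    (by rintro f g ⟨c, h⟩; exact ⟨c * p, fun a => by rw [h]; simp⟩)
  map_id _ := rfl
  map_comp := by rintro X Y Z ⟨f⟩ ⟨g⟩; rfl

/-- The number of elements of a finite nonempty linearly ordered set. -/
def simplexCard (S : SimplexCategory) : ℕ+ := ⟨S.len + 1, Nat.succ_pos _⟩

/-- The periodic extension `ℤ → ℤ` of an order-preserving map `{0, …, s-1} → {0, …, t-1}`: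
`q s + r ↦ q t + φ(r)` for `0 ≤ r < s`. -/
def periodicExt {S T : SimplexCategory} (φ : S ⟶ T) (b : ℤ) : ℤ :=
  b / (S.len + 1) * (T.len + 1) + (φ.toOrderHom (Fin.ofNat (S.len + 1) (b % (S.len + 1)).toNat) : ℕ)

theorem periodicExt_apply {S T : SimplexCategory} (φ : S ⟶ T) (q : ℤ) (r : Fin (S.len + 1)) :
    periodicExt φ (q * (S.len + 1) + r) = q * (T.len + 1) + (φ.toOrderHom r : ℕ) := by
  have hr : ((r : ℕ) : ℤ) < S.len + 1 := by exact_mod_cast r.2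
  have h1 : (q * ((S.len : ℤ) + 1) + (r : ℕ)) / (S.len + 1) = q := by
    rw [add_comm, Int.add_mul_ediv_right _ _ (by positivity), Int.ediv_eq_zero_of_lt (by positivity) hr,
      zero_add]
  have h2 : (q * ((S.len : ℤ) + 1) + (r : ℕ)) % (S.len + 1) = (r : ℕ) := by
    rw [add_comm, Int.add_mul_emod_self_right, Int.emod_eq_of_lt (by positivity) hr]
  have h3 : Fin.ofNat (S.len + 1) (r : ℕ) = r := by
    ext; simp [Fin.ofNat, Nat.mod_eq_of_lt r.2]
  rw [periodicExt, h1, h2, Int.toNat_natCast, h3]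

theorem exists_rep (S : SimplexCategory) (b : ℤ) :
    ∃ (q : ℤ) (r : Fin (S.len + 1)), b = q * (S.len + 1) + (r : ℕ) := by
  have hpos : (0 : ℤ) < S.len + 1 := by positivity
  refine ⟨b / (S.len + 1), ⟨(b % (S.len + 1)).toNat, ?_⟩, ?_⟩
  · have := Int.emod_lt_of_pos b hpos
    have := Int.emod_nonneg b hpos.ne'
    omega
  · have := Int.emod_nonneg b hpos.ne'
    have := Int.mul_ediv_add_emod b (S.len + 1)
    simp only [Int.toNat_of_nonneg ‹0 ≤ b % _›]
    linarith

theorem periodicExt_mono {S T : SimplexCategory} (φ : S ⟶ T) : Monotone (periodicExt φ) := by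
  intro b b' h
  obtain ⟨q, r, rfl⟩ := exists_rep S b
  obtain ⟨q', r', rfl⟩ := exists_rep S b'
  rw [periodicExt_apply, periodicExt_apply]
  have hr : ((r : ℕ) : ℤ) < S.len + 1 := by exact_mod_cast r.2
  have hr' : ((r' : ℕ) : ℤ) < S.len + 1 := by exact_mod_cast r'.2
  have hS : (0 : ℤ) < S.len + 1 := by positivity
  have hT : (0 : ℤ) < T.len + 1 := by positivity
  have hφ : ((φ.toOrderHom r : ℕ) : ℤ) < T.len + 1 := by exact_mod_cast (φ.toOrderHom r).2
  have hq : q ≤ q' := by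
    by_contra hlt
    push Not at hlt
    have : (q' + 1) * ((S.len : ℤ) + 1) ≤ q * (S.len + 1) :=
      mul_le_mul_of_nonneg_right (by omega) hS.le
    linarith [Int.natCast_nonneg (r : ℕ)]
  rcases hq.eq_or_lt with rfl | hlt
  · have hrr : r ≤ r' := by
      rw [Fin.le_def]; omega
    have : (φ.toOrderHom r : ℕ) ≤ φ.toOrderHom r' := φ.toOrderHom.monotone hrr
    have : ((φ.toOrderHom r : ℕ) : ℤ) ≤ (φ.toOrderHom r' : ℕ) := by exact_mod_cast this
    linarith
  · have : (q + 1) * ((T.len : ℤ) + 1) ≤ q' * (T.len + 1) :=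
      mul_le_mul_of_nonneg_right (by omega) hT.le
    linarith [Int.natCast_nonneg (φ.toOrderHom r' : ℕ)]

theorem periodicExt_add {S T : SimplexCategory} (φ : S ⟶ T) (b c : ℤ) :
    periodicExt φ (b + c * (S.len + 1)) = periodicExt φ b + c * (T.len + 1) := by
  obtain ⟨q, r, rfl⟩ := exists_rep S b
  rw [show q * ((S.len : ℤ) + 1) + (r : ℕ) + c * (S.len + 1) = (q + c) * (S.len + 1) + (r : ℕ) by ring,
    periodicExt_apply, periodicExt_apply]
  ring

theorem periodicExt_id (S : SimplexCategory) (b : ℤ) : periodicExt (𝟙 S) b = b := by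
  obtain ⟨q, r, rfl⟩ := exists_rep S b
  rw [periodicExt_apply]
  simp

theorem periodicExt_comp {S T R : SimplexCategory} (φ : S ⟶ T) (ψ : T ⟶ R) (b : ℤ) :
    periodicExt (φ ≫ ψ) b = periodicExt ψ (periodicExt φ b) := by
  obtain ⟨q, r, rfl⟩ := exists_rep S b
  rw [periodicExt_apply, periodicExt_apply, periodicExt_apply]
  simp

/-- The left adjoint `a ↦ min {b | a ≤ φ(b)}` of the periodic extension of `φ`. -/
def dualFun {S T : SimplexCategory} (φ : S ⟶ T) (a : ℤ) : ℤ := sInf {b : ℤ | a ≤ periodicExt φ b}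

theorem dualFun_gc {S T : SimplexCategory} (φ : S ⟶ T) :
    GaloisConnection (dualFun φ) (periodicExt φ) := by
  intro a b
  have hT : (0 : ℤ) < T.len + 1 := by positivity
  have hne : {b : ℤ | a ≤ periodicExt φ b}.Nonempty := by
    refine ⟨0 + |a| * (S.len + 1), ?_⟩
    rw [Set.mem_ofPred_eq, periodicExt_add]
    have h0 : 0 ≤ periodicExt φ 0 := by
      have := periodicExt_apply φ 0 0
      simp only [zero_mul, Fin.val_zero, Nat.cast_zero, zero_add] at this
      rw [this]; positivity
    nlinarith [le_abs_self a, abs_nonneg a]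
  have hbdd : BddBelow {b : ℤ | a ≤ periodicExt φ b} := by
    refine ⟨(-|a| - 1) * (S.len + 1), fun b hb => ?_⟩
    by_contra hlt
    push Not at hlt
    have h1 := periodicExt_mono φ hlt.le
    have h2 := periodicExt_add φ 0 (-|a| - 1)
    rw [zero_add] at h2
    have h0 : periodicExt φ 0 < T.len + 1 := by
      have := periodicExt_apply φ 0 0
      simp only [zero_mul, Fin.val_zero, Nat.cast_zero, zero_add] at this
      rw [this]; exact_mod_cast (φ.toOrderHom 0).2
    have hb' : a ≤ periodicExt φ b := hb
    have : periodicExt φ b ≤ -|a| * (T.len + 1) + (periodicExt φ 0 - (T.len + 1)) := by linarith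
    nlinarith [neg_abs_le a, abs_nonneg a]
  constructor
  · intro h
    exact le_trans (Int.csInf_mem hne hbdd) (periodicExt_mono φ h)
  · intro h
    exact csInf_le hbdd h

/-- The map of `Λ_∞` dual to a map `φ` of `Δ`. In this way maps `S ⟶ T` in `Δ` correspond to the maps
`[T] ⟶ [S]` in `Λ_∞` that send `0 ∈ ℤ` to `0 ∈ ℤ`. -/
def dualHom {S T : SimplexCategory} (φ : S ⟶ T) : LiftHom (simplexCard T) (simplexCard S) where
  toFun := dualFun φ
  monotone' := (dualFun_gc φ).monotone_l
  map_add' a := by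
    refine eq_of_forall_ge_iff fun b => ?_
    have h := periodicExt_add φ b (-1)
    have e : b - ((simplexCard S : ℕ+) : ℤ) = b + -1 * (S.len + 1) := by simp [simplexCard]; ring
    have e' : (((simplexCard T : ℕ+) : ℕ) : ℤ) = T.len + 1 := by simp [simplexCard]
    rw [dualFun_gc φ, ← le_sub_iff_add_le (a := dualFun φ a), dualFun_gc φ, e, h, e']
    constructor <;> intro <;> linarith

theorem dualHom_id (S : SimplexCategory) : dualHom (𝟙 S) = LiftHom.id (simplexCard S) := by
  ext a
  refine eq_of_forall_ge_iff fun b => ?_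
  change dualFun (𝟙 S) a ≤ b ↔ a ≤ b
  rw [dualFun_gc, periodicExt_id]

theorem dualHom_comp {S T R : SimplexCategory} (φ : S ⟶ T) (ψ : T ⟶ R) :
    dualHom (φ ≫ ψ) = (dualHom ψ).comp (dualHom φ) := by
  ext a
  refine eq_of_forall_ge_iff fun b => ?_
  change dualFun (φ ≫ ψ) a ≤ b ↔ dualFun φ (dualFun ψ a) ≤ b
  rw [dualFun_gc, dualFun_gc, dualFun_gc, periodicExt_comp]

variable (p) in
/-- The embedding `j_p : Δᵒᵖ ⥤ Λ_p`; a linearly ordered set with `n` elements goes to `[n]`. -/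
def j : SimplexCategoryᵒᵖ ⥤ Lambda p where
  obj S := ⟨simplexCard S.unop⟩
  map f := homMk (dualHom f.unop)
  map_id S := by
    change homMk (dualHom (𝟙 S.unop)) = _
    rw [dualHom_id]; rfl
  map_comp f g := by
    change homMk (dualHom (g.unop ≫ f.unop)) = _
    rw [dualHom_comp]; rfl

end Lambda
/-! ### The periodicity class -/

section Circle
variable (k : Type u) [Field k]

/-- On the circle `[n]` of `Λ_p`, with marked points `ℤ/N`, `N = p n`, and edges `x ⟶ x + 1`, the chain
`∑ e_y` of edges that make up the path from `a` to `b`, for integers `a ≤ b`. -/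
def path (N : ℕ) (a b : ℤ) : ZMod N →₀ k :=
  ∑ y ∈ Finset.Ico a b, Finsupp.single (y : ZMod N) 1

variable {k}

theorem path_add (N : ℕ) {a b c : ℤ} (h : a ≤ b) (h' : b ≤ c) :
    path k N a b + path k N b c = path k N a c := by
  rw [path, path, path, ← Finset.Ico_union_Ico_eq_Ico h h',
    Finset.sum_union (Finset.Ico_disjoint_Ico_consecutive a b c)]

theorem path_succ (N : ℕ) (a : ℤ) : path k N a (a + 1) = Finsupp.single (a : ZMod N) 1 := by
  have : Finset.Ico a (a + 1) = {a} := by ext; simp; omega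
  simp [path, this]

theorem path_shift (N : ℕ) (a b c : ℤ) :
    path k N (a + c * N) (b + c * N) = path k N a b := by
  rw [path, ← Finset.map_add_right_Ico, Finset.sum_map]
  simp [path]

theorem path_period (N : ℕ) (a : ℤ) : path k N a (a + N) = path k N 0 N := by
  have step : ∀ a : ℤ, path k N (a + 1) (a + 1 + N) = path k N a (a + N) := by
    intro a
    have h := path_shift (k := k) N a (a + 1) 1
    rcases Nat.eq_zero_or_pos N with rfl | hN
    · simp [path]
    · rw [← path_add N (a := a) (b := a + 1) (c := a + N) (by omega) (by omega),
        ← path_add N (a := a + 1) (b := a + N) (c := a + 1 + N) (by omega) (by omega), ← h]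
      rw [add_comm]; simp [add_right_comm]
  induction a using Int.induction_on with
  | zero => simp
  | succ i ih => rw [step, ih]
  | pred i ih => rw [← ih, ← step]; simp

/-- The action of a map of `Λ_∞` on marked points, `v_a ↦ v_{f(a)}`. -/
def pointMap (p : ℕ) {n m : ℕ+} (f : LiftHom n m) :
    (ZMod (p * n) →₀ k) →ₗ[k] (ZMod (p * m) →₀ k) :=
  Finsupp.linearCombination k fun x : ZMod (p * n) =>
    Finsupp.single ((f (x.cast : ℤ) : ℤ) : ZMod (p * m)) (1 : k)

/-- The action of a map of `Λ_∞` on edges: the edge from `a` to `a + 1` goes to the path from `f(a)` to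
`f(a + 1)`. -/
def edgeMap (p : ℕ) {n m : ℕ+} (f : LiftHom n m) :
    (ZMod (p * n) →₀ k) →ₗ[k] (ZMod (p * m) →₀ k) :=
  Finsupp.linearCombination k fun x : ZMod (p * n) =>
    path k (p * m) (f (x.cast : ℤ)) (f ((x.cast : ℤ) + 1))

theorem exists_cast_eq (N : ℕ) (a : ℤ) : ∃ c : ℤ, (((a : ZMod N).cast : ℤ)) = a + c * N := by
  have h : (((((a : ZMod N).cast : ℤ)) : ℤ) : ZMod N) = (a : ZMod N) := by simp
  rw [ZMod.intCast_eq_intCast_iff_dvd_sub] at h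
  obtain ⟨c, hc⟩ := h
  exact ⟨-c, by linarith⟩

theorem lift_add_mul (p : ℕ) {n m : ℕ+} (f : LiftHom n m) (a c : ℤ) :
    f (a + c * (p * n : ℕ)) = f a + c * (p * m : ℕ) := by
  have := f.map_add_mul a (c * p)
  push_cast
  rw [← mul_assoc, this, mul_assoc]

theorem pointMap_single (p : ℕ) {n m : ℕ+} (f : LiftHom n m) (a : ℤ) :
    pointMap (k := k) p f (Finsupp.single (a : ZMod (p * n)) 1) =
      Finsupp.single ((f a : ℤ) : ZMod (p * m)) 1 := by
  obtain ⟨c, hc⟩ := exists_cast_eq (p * n) a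
  rw [pointMap, Finsupp.linearCombination_single, one_smul, hc, lift_add_mul]
  congr 1
  rw [Int.cast_add, Int.cast_mul, Int.cast_natCast, ZMod.natCast_self, mul_zero, add_zero]

theorem edgeMap_single (p : ℕ) {n m : ℕ+} (f : LiftHom n m) (a : ℤ) :
    edgeMap (k := k) p f (Finsupp.single (a : ZMod (p * n)) 1) =
      path k (p * m) (f a) (f (a + 1)) := by
  obtain ⟨c, hc⟩ := exists_cast_eq (p * n) a
  rw [edgeMap, Finsupp.linearCombination_single, one_smul, hc, add_right_comm, lift_add_mul,
    lift_add_mul, path_shift]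

theorem edgeMap_path (p : ℕ) {n m : ℕ+} (f : LiftHom n m) {a b : ℤ} (h : a ≤ b) :
    edgeMap (k := k) p f (path k (p * n) a b) = path k (p * m) (f a) (f b) := by
  induction b, h using Int.leInduction with
  | base => simp [path]
  | succ b hb ih =>
    rw [← path_add _ hb (by omega), map_add, ih, path_succ, edgeMap_single,
      path_add _ (f.monotone' hb) (f.monotone' (by omega))]

theorem pointMap_congr (p : ℕ) {n m : ℕ+} (f g : LiftHom n m)
    (h : LiftHom.setoid p n m f g) : pointMap (k := k) p f = pointMap p g := by
  obtain ⟨c, hc⟩ := h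
  have hc' (a : ℤ) : g a = f a + c * (p * m : ℕ) := by rw [hc]; push_cast; ring
  unfold pointMap
  congr 1
  funext x
  rw [hc', Int.cast_add, Int.cast_mul, Int.cast_natCast, ZMod.natCast_self, mul_zero, add_zero]

theorem edgeMap_congr (p : ℕ) {n m : ℕ+} (f g : LiftHom n m)
    (h : LiftHom.setoid p n m f g) : edgeMap (k := k) p f = edgeMap p g := by
  obtain ⟨c, hc⟩ := h
  have hc' (a : ℤ) : g a = f a + c * (p * m : ℕ) := by rw [hc]; push_cast; ring
  unfold edgeMap
  congr 1
  funext x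
  rw [hc', hc', path_shift]

theorem finsupp_ext (N : ℕ) {M : Type*} [AddCommMonoid M] [Module k M]
    {f g : (ZMod N →₀ k) →ₗ[k] M}
    (h : ∀ a : ℤ, f (Finsupp.single (a : ZMod N) 1) = g (Finsupp.single (a : ZMod N) 1)) :
    f = g := by
  refine Finsupp.lhom_ext' fun x => LinearMap.ext_ring ?_
  obtain ⟨a, rfl⟩ := ZMod.intCast_surjective x
  simpa using h a

variable (k) (p : ℕ)

/-- The functor `j_{p!} k`: it sends `[n]` to the span of `Λ_p([1], [n]) = ℤ/pn`, the marked points. -/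
def pointFun : FunCat (Lambda p) k where
  obj X := ModuleCat.of k (ZMod (p * X.card) →₀ k)
  map {X Y} := Quotient.lift (s := LiftHom.setoid p X.card Y.card)
    (fun f => ModuleCat.ofHom (pointMap p f))
    (fun f g h => by rw [pointMap_congr p f g h])
  map_id X := by
    refine ModuleCat.hom_ext (finsupp_ext _ fun a => ?_)
    exact pointMap_single p (LiftHom.id X.card) a
  map_comp := by
    rintro X Y Z ⟨f⟩ ⟨g⟩
    refine ModuleCat.hom_ext (finsupp_ext _ fun a => ?_)
    change pointMap p (f.comp g) _ = pointMap p g (pointMap p f _)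
    rw [pointMap_single, pointMap_single, pointMap_single]; rfl

/-- The functor `j^o_{p*} k`: it sends `[n]` to the space of functions on `Λ_p([n], [1])`. The basis
element `e_x`, `x ∈ ℤ/pn`, is the delta function of the class of the map `[n] ⟶ [1]` of `Λ_∞` that
jumps from `0` to `1` between `x` and `x + 1`. -/
def edgeFun : FunCat (Lambda p) k where
  obj X := ModuleCat.of k (ZMod (p * X.card) →₀ k)
  map {X Y} := Quotient.lift (s := LiftHom.setoid p X.card Y.card)
    (fun f => ModuleCat.ofHom (edgeMap p f))
    (fun f g h => by rw [edgeMap_congr p f g h])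
  map_id X := by
    refine ModuleCat.hom_ext (finsupp_ext _ fun a => ?_)
    refine (edgeMap_single p (LiftHom.id X.card) a).trans ?_
    exact path_succ _ a
  map_comp := by
    rintro X Y Z ⟨f⟩ ⟨g⟩
    refine ModuleCat.hom_ext (finsupp_ext _ fun a => ?_)
    change edgeMap p (f.comp g) _ = edgeMap p g (edgeMap p f _)
    rw [edgeMap_single, edgeMap_single, edgeMap_path _ _ (f.monotone' (by omega))]; rfl

/-- The map `e_x ↦ v_{x+1} - v_x`, that is `σ - id`. -/
def bdry (N : ℕ) : (ZMod N →₀ k) →ₗ[k] (ZMod N →₀ k) :=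
  Finsupp.linearCombination k fun x : ZMod N =>
    Finsupp.single (x + 1) (1 : k) - Finsupp.single x 1

/-- The map `k → k[ℤ/N]` with value `∑_x e_x` at `1`. -/
def fund (N : ℕ) : k →ₗ[k] (ZMod N →₀ k) := LinearMap.toSpanSingleton k _ (path k N 0 N)

theorem fund_apply (N : ℕ) (c : k) : fund k N c = c • path k N 0 N := rfl

/-- The sum of coefficients `k[ℤ/N] → k`. -/
def augm (N : ℕ) : (ZMod N →₀ k) →ₗ[k] k := Finsupp.linearCombination k fun _ => (1 : k)

variable {k} in
theorem bdry_path (N : ℕ) {a b : ℤ} (h : a ≤ b) :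
    bdry k N (path k N a b) = Finsupp.single (b : ZMod N) 1 - Finsupp.single (a : ZMod N) 1 := by
  induction b, h using Int.leInduction with
  | base => simp [path]
  | succ b hb ih =>
    rw [← path_add _ hb (by omega), map_add, ih, path_succ, bdry, Finsupp.linearCombination_single]
    simp

/-- The connecting map `B : j^o_{p*} k ⟶ j_{p!} k`. -/
def boundaryMap : edgeFun k p ⟶ pointFun k p where
  app X := ModuleCat.ofHom (bdry k (p * X.card))
  naturality := by
    rintro X Y ⟨f⟩
    refine ModuleCat.hom_ext (finsupp_ext _ fun a => ?_)
    change bdry k _ (edgeMap p f _) = pointMap p f (bdry k _ _)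
    rw [edgeMap_single, bdry_path _ (f.monotone' (by omega)), ← path_succ (p * X.card) a,
      bdry_path _ (by omega), map_sub, pointMap_single, pointMap_single]

/-- The adjunction map `j_{p!} k ⟶ k`. -/
def augmentation : pointFun k p ⟶ constFun (Lambda p) k where
  app X := ModuleCat.ofHom (augm k (p * X.card))
  naturality := by
    rintro X Y ⟨f⟩
    refine ModuleCat.hom_ext (finsupp_ext _ fun a => ?_)
    change augm k _ (pointMap p f _) = augm k _ _
    rw [pointMap_single]; simp [augm]

/-- The adjunction map `k ⟶ j^o_{p*} k`. -/
def fundamentalCycle : constFun (Lambda p) k ⟶ edgeFun k p where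
  app X := ModuleCat.ofHom (fund k (p * X.card))
  naturality := by
    rintro X Y ⟨f⟩
    refine ModuleCat.hom_ext (LinearMap.ext_ring ?_)
    change fund k (p * Y.card) 1 = edgeMap p f (fund k (p * X.card) 1)
    have := lift_add_mul p f 0 1
    rw [one_mul, one_mul, zero_add] at this
    rw [fund_apply, fund_apply, one_smul, one_smul, edgeMap_path p f (by positivity), this,
      path_period]

variable {k}

theorem bdry_apply (N : ℕ) (φ : ZMod N →₀ k) (x : ZMod N) : bdry k N φ x = φ (x - 1) - φ x := by
  have : Finsupp.lapply x ∘ₗ bdry k N = Finsupp.lapply (x - 1) - Finsupp.lapply x := by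
    refine Finsupp.lhom_ext' fun y => LinearMap.ext_ring ?_
    simp [bdry, Finsupp.single_apply, eq_sub_iff_add_eq]
  exact LinearMap.congr_fun this φ

theorem path_period_apply (N : ℕ) [NeZero N] (x : ZMod N) : path k N 0 N x = 1 := by
  have hN : 0 < N := Nat.pos_of_ne_zero (NeZero.ne N)
  rw [path, Finsupp.finsetSum_apply, Finset.sum_eq_single (x.val : ℤ)]
  · simp
  · intro b hb hne
    rw [Finset.mem_Ico] at hb
    refine Finsupp.single_eq_of_ne fun h => hne ?_
    lift b to ℕ using hb.1
    rw [h, Int.cast_natCast, ZMod.val_natCast_of_lt (by omega)]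
  · intro h
    exact absurd (Finset.mem_Ico.2 ⟨by positivity, by exact_mod_cast x.val_lt⟩) h

theorem const_of_bdry_eq_zero (N : ℕ) (φ : ZMod N →₀ k) (h : bdry k N φ = 0) (x : ZMod N) :
    φ x = φ 0 := by
  have step (x : ZMod N) : φ (x - 1) = φ x := by
    have := bdry_apply N φ x
    rw [h, Finsupp.zero_apply] at this
    exact (sub_eq_zero.1 this.symm)
  obtain ⟨a, rfl⟩ := ZMod.intCast_surjective x
  induction a using Int.induction_on with
  | zero => simp
  | succ i ih => rw [← ih, ← step]; simp
  | pred i ih => rw [← ih, Int.cast_sub, Int.cast_one, step]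

theorem fund_injective (N : ℕ) [NeZero N] : Function.Injective (fund k N) := by
  intro a b h
  simpa [fund_apply, path_period_apply] using DFunLike.congr_fun h 0

theorem augm_single (N : ℕ) (x : ZMod N) (c : k) : augm k N (Finsupp.single x c) = c := by
  simp [augm]

theorem exact_fund_bdry (N : ℕ) [NeZero N] :
    Function.Exact (fund k N) (bdry k N) := by
  intro φ
  constructor
  · intro h
    refine ⟨φ 0, ?_⟩
    ext x
    rw [const_of_bdry_eq_zero N φ h x]
    simp [fund_apply, path_period_apply]
  · rintro ⟨c, rfl⟩
    rw [fund_apply, map_smul, bdry_path N (by positivity)]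
    simp

theorem exact_bdry_augm (N : ℕ) [NeZero N] : Function.Exact (bdry k N) (augm k N) := by
  have hz : augm k N ∘ₗ bdry k N = 0 := by
    refine Finsupp.lhom_ext' fun y => LinearMap.ext_ring ?_
    simp [bdry, augm]
  intro φ
  constructor
  · intro h
    have key (ψ : ZMod N →₀ k) :
        ψ - augm k N ψ • Finsupp.single 0 1 ∈ LinearMap.range (bdry k N) := by
      induction ψ using Finsupp.induction_linear with
      | zero => simp
      | add f g hf hg =>
        convert Submodule.add_mem _ hf hg using 1
        rw [map_add, add_smul]; abel
      | single x c =>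
        refine ⟨c • path k N 0 x.val, ?_⟩
        rw [map_smul, bdry_path N (by positivity)]
        simp [augm, smul_sub]
    simpa [h] using key φ
  · rintro ⟨ψ, rfl⟩
    exact LinearMap.congr_fun hz ψ

variable (k)

/-- The sequence `0 ⟶ Z ⟶ j_{p!} k ⟶ k ⟶ 0`. -/
def rightSeq : ShortComplex (FunCat (Lambda p) k) :=
  ShortComplex.mk (kernel.ι (augmentation k p)) (augmentation k p) (kernel.condition _)

instance : Epi (augmentation k p) := by
  have (X : Lambda p) : Epi ((augmentation k p).app X) := by
    rw [ModuleCat.epi_iff_surjective]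
    intro c
    exact ⟨Finsupp.single 0 c, augm_single (k := k) (p * X.card) 0 c⟩
  exact NatTrans.epi_of_epi_app _

theorem rightSeq_shortExact : (rightSeq k p).ShortExact where
  exact := ShortComplex.exact_of_f_is_kernel _ (kernelIsKernel _)
  mono_f := by dsimp [rightSeq]; infer_instance
  epi_g := by dsimp [rightSeq]; infer_instance

variable [NeZero p]

/-- The complex `k ⟶ j^o_{p*} k ⟶ j_{p!} k`. -/
def fundComplex : ShortComplex (FunCat (Lambda p) k) :=
  ShortComplex.mk (fundamentalCycle k p) (boundaryMap k p) (by
    ext X : 2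
    exact ModuleCat.hom_ext (LinearMap.ext fun x =>
      (exact_fund_bdry (k := k) (p * X.card)).apply_apply_eq_zero x))

/-- The complex `j^o_{p*} k ⟶ j_{p!} k ⟶ k`. -/
def augComplex : ShortComplex (FunCat (Lambda p) k) :=
  ShortComplex.mk (boundaryMap k p) (augmentation k p) (by
    ext X : 2
    exact ModuleCat.hom_ext (LinearMap.ext fun x =>
      (exact_bdry_augm (k := k) (p * X.card)).apply_apply_eq_zero x))

theorem fundComplex_exact : (fundComplex k p).Exact :=
  exact_of_pointwise _ fun X => (ShortComplex.ShortExact.moduleCat_exact_iff_function_exact _).2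
    (exact_fund_bdry (k := k) (p * X.card))

theorem augComplex_exact : (augComplex k p).Exact :=
  exact_of_pointwise _ fun X => (ShortComplex.ShortExact.moduleCat_exact_iff_function_exact _).2
    (exact_bdry_augm (k := k) (p * X.card))

instance : Mono (fundamentalCycle k p) := by
  have (X : Lambda p) : Mono ((fundamentalCycle k p).app X) := by
    rw [ModuleCat.mono_iff_injective]
    exact fund_injective (k := k) (p * X.card)
  exact NatTrans.mono_of_mono_app _

/-- The sequence `0 ⟶ k ⟶ j^o_{p*} k ⟶ Z ⟶ 0`, with `Z` the kernel of `j_{p!} k ⟶ k`. -/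
def leftSeq : ShortComplex (FunCat (Lambda p) k) :=
  ShortComplex.mk (fundamentalCycle k p)
    (kernel.lift (augmentation k p) (boundaryMap k p) (augComplex k p).zero)
    (by
      rw [← cancel_mono (kernel.ι (augmentation k p)), Category.assoc, zero_comp]
      exact (congrArg _ (kernel.lift_ι _ _ _)).trans (fundComplex k p).zero)

theorem leftSeq_shortExact : (leftSeq k p).ShortExact where
  exact := by
    let φ : leftSeq k p ⟶ fundComplex k p :=
      { τ₁ := 𝟙 _, τ₂ := 𝟙 _, τ₃ := kernel.ι (augmentation k p)
        comm₁₂ := by simp [leftSeq, fundComplex]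
        comm₂₃ := (Category.id_comp _).trans (kernel.lift_ι _ _ (augComplex k p).zero).symm }
    have : Epi φ.τ₁ := inferInstanceAs (Epi (𝟙 _))
    have : IsIso φ.τ₂ := inferInstanceAs (IsIso (𝟙 _))
    have : Mono φ.τ₃ := inferInstanceAs (Mono (kernel.ι (augmentation k p)))
    exact (ShortComplex.exact_iff_of_epi_of_isIso_of_mono φ).2 (fundComplex_exact k p)
  mono_f := by dsimp [leftSeq]; infer_instance
  epi_g := (ShortComplex.exact_iff_epi_kernel_lift (augComplex k p)).1 (augComplex_exact k p)

/-- The periodicity class `u ∈ H^2(Λ_p, k) = Ext^2(k, k)`, the Yoneda class of the exact sequence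
`0 ⟶ k ⟶ j^o_{p*} k ⟶ j_{p!} k ⟶ k ⟶ 0`. -/
def periodicityClass : Coh (Lambda p) k 2 :=
  (rightSeq_shortExact k p).extClass.comp (leftSeq_shortExact k p).extClass rfl

end Circle

/-! ### Cyclic, Hochschild and periodic cyclic homology -/

section Main
variable {k : Type u} [Field k] {p : ℕ}

/-- Cyclic homology `HC_n(E) = H_n(Λ_p, E)` of a `p`-cyclic vector space. -/
def HC (E : FunCat (Lambda p) k) (n : ℤ) : ModuleCat.{u} k := homologyOf E n

/-- Hochschild homology `HH_n(E) = H_n(Δᵒᵖ, j_p^* E)` of a `p`-cyclic vector space. -/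
def HH (E : FunCat (Lambda p) k) (n : ℤ) : ModuleCat.{u} k :=
  homologyOf (Lambda.j p ⋙ E) n

/-- The periodicity map `u : HC_n(E) ⟶ HC_{n-2}(E)`. -/
def periodicity [NeZero p] (E : FunCat (Lambda p) k) (n : ℤ) : HC E n ⟶ HC E (n - 2) :=
  cap E (periodicityClass k p) n

/-- Periodic cyclic homology `HP_n(E)`: the derived inverse limit of the cyclic homology complex with
respect to the periodicity map. -/
def HP [NeZero p] (E : FunCat (Lambda p) k) (n : ℤ) : ModuleCat.{u} k :=
  (telescope (capMap E (periodicityClass k p))).homology (-n)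

/-- The projection `HP_n(E) ⟶ HC_{n+2i}(E)` to the `i`-th term of the inverse system. -/
def HPtoHC [NeZero p] (E : FunCat (Lambda p) k) (n : ℤ) (i : ℕ) : HP E n ⟶ HC E (n + 2 * i) :=
  HomologicalComplex.homologyMap (telescopeProj (capMap E (periodicityClass k p)) i) (-n) ≫
    (CochainComplex.ShiftSequence.shiftIso (ModuleCat.{u} k) (-2 * (i : ℤ)) (-n) (-(n + 2 * i))
      (by ring)).hom.app _

/-- The degree `n` part of `M[u⁻¹]`, polynomials with coefficients in the graded space `M` in a variable
`u⁻¹` of degree `2`; the component at `(i, l)` is the coefficient in `M_i` of `u^{-l}`, `i + 2l = n`. -/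
abbrev PolyInv (M : ℤ → ModuleCat.{u} k) (n : ℤ) : Type u :=
  DirectSum {s : ℤ × ℕ // s.1 + 2 * (s.2 : ℤ) = n} fun s => M s.1.1

/-- The degree `n` part of `M((u))`, Laurent series with coefficients in the graded space `M` in a
variable `u` of degree `-2`; the component at `(i, l)` is the coefficient in `M_i` of `u^l`,
`i - 2l = n`. -/
def Laurent (M : ℤ → ModuleCat.{u} k) (n : ℤ) :
    Submodule k (∀ s : {s : ℤ × ℤ // s.1 - 2 * s.2 = n}, M s.1.1) where
  carrier := {a | ∃ N : ℤ, ∀ s, s.1.2 < N → a s = 0}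
  zero_mem' := ⟨0, fun _ _ => rfl⟩
  add_mem' := by
    rintro a b ⟨N, h⟩ ⟨N', h'⟩
    exact ⟨min N N', fun s hs => by
      rw [Pi.add_apply, h s (by omega), h' s (by omega), add_zero]⟩
  smul_mem' := by
    rintro c a ⟨N, h⟩
    exact ⟨N, fun s hs => by rw [Pi.smul_apply, h s hs, smul_zero]⟩

end Main

end CyclicHomology

end

open CyclicHomology

/-!
Over a field `Ext^n(E, k)` is the dual of `H_n(Γ, E)`, compatibly with the action of `Ext`-classes
on both sides, so the long exact sequences can be studied in `Ext(-, k)`.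

Tensoring `0 → k → j_* k → j_! k → k → 0` with `A ∈ Fun(Λ_q, k)` splices `A ⊗ u` from two short
exact sequences. Here `A ⊗ j_! k ≅ j_! j^* A` has homology `HH(A)`. The restriction of `j_* k` to
`Δᵒᵖ` is, up to a constant factor, the functor of functions `S ↦ k^S`; a function extends by zero to
`S` with a new least element, so décalage kills `Ext(-, k)` of any tensor product with it, and hence
all `Ext(A ⊗ j_* k, k)`. The result is the Gysin sequence `HH_n(A) → HC_n(A) → HC_{n-2}(A)`.

For `A = π^* E` the sequence of `Λ_q` maps to the pull-back of the sequence of `Λ`. The circle with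
`qn` marked points winds `q` times around the circle with `n` points, so this map is `q = 0` on the
left term `k`, while every class in `Ext(π^* E ⊗ j_! k, k)` comes from `Λ`. Therefore the connecting
map of the Gysin sequence vanishes: `HH_n(E)` is the kernel of a surjective `u` on `HC_n(π^* E)`. As
`HC` vanishes in negative degrees, a retraction onto this kernel identifies `HC(π^* E)` with
`HH(E)[u⁻¹]`. Surjectivity of `u` also kills `lim¹`, so `HP(π^* E)` is the inverse limit along `u`,
that is `HH(E)((u))`.
-/

noncomputable section

namespace CyclicHomology

section ExtFunctoriality

universe w w' w'' v v' v'' u' u''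
variable {C : Type u} [Category.{v} C] [Abelian C] [HasExt.{w} C]
  {D : Type u'} [Category.{v'} D] [Abelian D] [HasExt.{w'} D]
  {D' : Type u''} [Category.{v''} D'] [Abelian D'] [HasExt.{w''} D']

theorem exists_eq_extClass_comp [EnoughProjectives C] {X Y : C} {n : ℕ} (x : Ext X Y (n + 1)) :
    ∃ (S : ShortComplex C) (hS : S.ShortExact) (e : S.X₃ = X) (y : Ext S.X₁ Y n),
      x = (Ext.mk₀ (eqToHom e.symm)).comp (hS.extClass.comp y (add_comm 1 n)) (zero_add _) := by
  let P : ProjectivePresentation X := Classical.arbitrary _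
  let S := ShortComplex.mk _ _ (kernel.condition P.f)
  have hS : S.ShortExact := { exact := ShortComplex.exact_kernel P.f }
  have : Projective S.X₂ := P.projective
  have := Ext.subsingleton_of_projective S.X₂ Y n
  obtain ⟨y, hy⟩ := Ext.contravariant_sequence_exact₃ hS Y x (Subsingleton.elim _ _) (add_comm 1 n)
  exact ⟨S, hS, rfl, y, by simp [hy]⟩

theorem ext_induction [EnoughProjectives C] {Y : C} {motive : ∀ (X : C) (n : ℕ), Ext X Y n → Prop}
    (zero : ∀ (X : C) (f : X ⟶ Y), motive X 0 (Ext.mk₀ f))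
    (succ : ∀ (S : ShortComplex C) (hS : S.ShortExact) (n : ℕ) (y : Ext S.X₁ Y n),
      motive S.X₁ n y → motive S.X₃ (n + 1) (hS.extClass.comp y (add_comm 1 n)))
    {X : C} {n : ℕ} (x : Ext X Y n) : motive X n x := by
  induction n generalizing X with
  | zero =>
    obtain ⟨f, rfl⟩ := (Ext.mk₀_bijective X Y).2 x
    exact zero X f
  | succ n ih =>
    obtain ⟨S, hS, rfl, y, rfl⟩ := exists_eq_extClass_comp x
    simpa using succ S hS n y (ih y)

theorem mapExactFunctor_comp_mk₀_app [EnoughProjectives C] {F G : C ⥤ D}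
    [F.Additive] [PreservesFiniteLimits F] [PreservesFiniteColimits F]
    [G.Additive] [PreservesFiniteLimits G] [PreservesFiniteColimits G] (α : F ⟶ G)
    {X Y : C} {n : ℕ} (x : Ext X Y n) :
    (x.mapExactFunctor F).comp (Ext.mk₀ (α.app Y)) (add_zero n) =
      (Ext.mk₀ (α.app X)).comp (x.mapExactFunctor G) (zero_add n) := by
  induction x using ext_induction with
  | zero X f => simp [Ext.mapExactFunctor_mk₀]
  | succ S hS n y ih =>
    have naturality_extClass :
        (hS.extClass.mapExactFunctor F).comp (Ext.mk₀ (α.app S.X₁)) (add_zero 1) =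
          (Ext.mk₀ (α.app S.X₃)).comp (hS.extClass.mapExactFunctor G) (zero_add 1) := by
      rw [Ext.mapExactFunctor_extClass, Ext.mapExactFunctor_extClass]
      exact ShortComplex.ShortExact.extClass_naturality (hS.map_of_exact F) (hS.map_of_exact G)
        (S.mapNatTrans α)
    rw [Ext.mapExactFunctor_comp, Ext.mapExactFunctor_comp, Ext.comp_assoc_of_third_deg_zero, ih,
      ← Ext.comp_assoc_of_second_deg_zero, naturality_extClass]
    exact Ext.comp_assoc _ _ _ _ _ (by omega)

theorem mapExactFunctor_id [EnoughProjectives C] {X Y : C} {n : ℕ} (x : Ext X Y n) :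
    x.mapExactFunctor (𝟭 C) = x := by
  induction x using ext_induction with
  | zero X f => exact Ext.mapExactFunctor_mk₀ _ _
  | succ S hS n y ih =>
    rw [Ext.mapExactFunctor_comp, ih, Ext.mapExactFunctor_extClass]
    rfl

theorem mapExactFunctor_functorComp [EnoughProjectives C] (F : C ⥤ D) (G : D ⥤ D')
    [F.Additive] [PreservesFiniteLimits F] [PreservesFiniteColimits F]
    [G.Additive] [PreservesFiniteLimits G] [PreservesFiniteColimits G]
    [(F ⋙ G).Additive] [PreservesFiniteLimits (F ⋙ G)] [PreservesFiniteColimits (F ⋙ G)]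
    {X Y : C} {n : ℕ} (x : Ext X Y n) :
    x.mapExactFunctor (F ⋙ G) = (x.mapExactFunctor F).mapExactFunctor G := by
  induction x using ext_induction with
  | zero X f => simp only [Ext.mapExactFunctor_mk₀]; rfl
  | succ S hS n y ih =>
    have extClass_functorComp : hS.extClass.mapExactFunctor (F ⋙ G) =
        (hS.extClass.mapExactFunctor F).mapExactFunctor G := by
      rw [Ext.mapExactFunctor_extClass, Ext.mapExactFunctor_extClass]
      exact (Ext.mapExactFunctor_extClass G (hS.map_of_exact F)).symm
    rw [Ext.mapExactFunctor_comp, ih, extClass_functorComp, Ext.mapExactFunctor_comp,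
      Ext.mapExactFunctor_comp]

/-- The bijection `Ext^n(L X, Y) ≃ Ext^n(X, R Y)` of an adjoint pair of exact functors. -/
def extAdjEquiv [EnoughProjectives C] [EnoughProjectives D] {L : C ⥤ D} {R : D ⥤ C} (adj : L ⊣ R)
    [L.Additive] [PreservesFiniteLimits L] [PreservesFiniteColimits L]
    [R.Additive] [PreservesFiniteLimits R] [PreservesFiniteColimits R] (X : C) (Y : D) (n : ℕ) :
    Ext (L.obj X) Y n ≃ Ext X (R.obj Y) n where
  toFun y := (Ext.mk₀ (adj.unit.app X)).comp (y.mapExactFunctor R) (zero_add n)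
  invFun x := (x.mapExactFunctor L).comp (Ext.mk₀ (adj.counit.app Y)) (add_zero n)
  left_inv y := by
    have h := mapExactFunctor_comp_mk₀_app adj.counit y
    rw [mapExactFunctor_id, mapExactFunctor_functorComp] at h
    dsimp only
    rw [Ext.mapExactFunctor_comp, Ext.mapExactFunctor_mk₀]
    refine (Ext.comp_assoc_of_third_deg_zero _ _ _ _).trans ?_
    refine (congrArg (Ext.comp (Ext.mk₀ (L.map (adj.unit.app X))) · (zero_add n)) h).trans ?_
    refine (Ext.mk₀_comp_mk₀_assoc _ _ _).trans ?_
    simp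
  right_inv x := by
    have h := mapExactFunctor_comp_mk₀_app adj.unit x
    rw [mapExactFunctor_id, mapExactFunctor_functorComp] at h
    dsimp only
    rw [Ext.mapExactFunctor_comp, Ext.mapExactFunctor_mk₀]
    refine (Ext.comp_assoc_of_third_deg_zero _ _ _ _).symm.trans ?_
    refine (congrArg (Ext.comp · _ _) h.symm).trans ?_
    refine (Ext.comp_assoc_of_third_deg_zero _ _ _ _).trans ?_
    rw [Ext.mk₀_comp_mk₀]
    simp

end ExtFunctoriality

section FormsOnHomology

universe v
variable {C : Type u} [Category.{v} C] [Abelian C]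

/-- The restriction of `w : K^a ⟶ V` to cocycles descends to `ℓ : H^a(K) ⟶ V`. -/
def Induces (K : CochainComplex C ℤ) (a : ℤ) {V : C} (ℓ : K.homology a ⟶ V) (w : K.X a ⟶ V) :
    Prop :=
  K.homologyπ a ≫ ℓ = K.iCycles a ≫ w

theorem Induces.sub {K : CochainComplex C ℤ} {a : ℤ} {V : C} {ℓ ℓ' : K.homology a ⟶ V}
    {w w' : K.X a ⟶ V} (h : Induces K a ℓ w) (h' : Induces K a ℓ' w') :
    Induces K a (ℓ - ℓ') (w - w') := by
  simp only [Induces, Preadditive.comp_sub] at *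
  rw [h, h']

theorem exists_induces (K : CochainComplex C ℤ) (a b : ℤ) (hb : b + 1 = a) {V : C}
    (w : K.X a ⟶ V) (hw : K.d b a ≫ w = 0) : ∃ ℓ, Induces K a ℓ w :=
  ⟨K.homologyι a ≫ K.descOpcycles w b (by simp; omega) hw, by simp [Induces]⟩

theorem exists_induces_of_injective (K : CochainComplex C ℤ) (a b : ℤ) {V : C}
    [Injective V] (ℓ : K.homology a ⟶ V) : ∃ w, K.d b a ≫ w = 0 ∧ Induces K a ℓ w := by
  refine ⟨K.pOpcycles a ≫ Injective.factorThru ℓ (K.homologyι a), by simp, ?_⟩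
  rw [Induces, ← K.homology_π_ι_assoc, Injective.comp_factorThru]

theorem Induces.eq_zero_iff {K : CochainComplex C ℤ} {a b : ℤ} (hb : a + 1 = b) {V : C}
    [Injective V] {ℓ : K.homology a ⟶ V} {w : K.X a ⟶ V} (h : Induces K a ℓ w) :
    ℓ = 0 ↔ ∃ g : K.X b ⟶ V, K.d a b ≫ g = w := by
  rw [← cancel_epi (K.homologyπ a), h, comp_zero]
  constructor
  · intro h0
    let S := ShortComplex.mk (K.iCycles a) (K.d a b) (by simp)
    have hS : S.Exact := S.exact_of_f_is_kernel (K.cyclesIsKernel a b (by simp [hb]))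
    exact ⟨hS.descToInjective w h0, hS.comp_descToInjective w h0⟩
  · rintro ⟨g, rfl⟩
    simp

theorem Induces.shift {L : CochainComplex C ℤ} {m a : ℤ} {V : C}
    {ℓ : L.homology (a + m) ⟶ V} {w : L.X (a + m) ⟶ V} (h : Induces L (a + m) ℓ w) :
    Induces (L⟦m⟧) a
      ((CochainComplex.ShiftSequence.shiftIso C m a (a + m) (add_comm m a)).hom.app L ≫ ℓ) w := by
  let φ := (CochainComplex.shiftShortComplexFunctorIso C m a (a + m) (add_comm m a)).hom.app L
  let φH : (L⟦m⟧).homology a ⟶ L.homology (a + m) := ShortComplex.homologyMap φ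
  let φZ : (L⟦m⟧).cycles a ⟶ L.cycles (a + m) := ShortComplex.cyclesMap φ
  have hφ : φ.τ₂ = 𝟙 _ := by
    simp only [Functor.comp_obj, CochainComplex.shiftShortComplexFunctorIso_hom_app_τ₂,
      HomologicalComplex.XIsoOfEq_rfl, Iso.refl_hom, φ]
    rfl
  unfold Induces
  rw [CochainComplex.ShiftSequence.shiftIso_hom_app]
  calc
    _ = ((L⟦m⟧).homologyπ a ≫ φH) ≫ ℓ := (Category.assoc _ _ _).symm
    _ = (φZ ≫ L.homologyπ (a + m)) ≫ ℓ :=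
      congrArg (· ≫ ℓ) (ShortComplex.homologyπ_naturality φ)
    _ = φZ ≫ L.iCycles (a + m) ≫ w :=
      (Category.assoc _ _ _).trans (congrArg (_ ≫ ·) h)
    _ = ((L⟦m⟧).iCycles a ≫ 𝟙 _) ≫ w := by
      refine (Category.assoc _ _ _).symm.trans (congrArg (· ≫ w) ?_)
      exact (ShortComplex.cyclesMap_i φ).trans (congrArg ((L⟦m⟧).iCycles a ≫ ·) hφ)
    _ = (L⟦m⟧).iCycles a ≫ w := by rw [Category.comp_id]

theorem Induces.comp {K L : CochainComplex C ℤ} {a : ℤ} (φ : K ⟶ L) {V : C}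
    {ℓ : L.homology a ⟶ V} {w : L.X a ⟶ V} (h : Induces L a ℓ w) :
    Induces K a (HomologicalComplex.homologyMap φ a ≫ ℓ) (φ.f a ≫ w) := by
  rw [Induces, HomologicalComplex.homologyπ_naturality_assoc, h,
    HomologicalComplex.cyclesMap_i_assoc]

end FormsOnHomology

section ExtOf
open CochainComplex Localization
variable {Γ : Type} [SmallCategory Γ] {k : Type u} [Field k]

/-- The class in `Ext^n(E, Y)` of a cocycle on the projective resolution of `E`. -/
def extOf (E : FunCat Γ k) {Y : FunCat Γ k} (n : ℕ) (a : ℤ) (ha : a + n = 0)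
    (z : (projectiveResolution E).cochainComplex.X a ⟶ Y)
    (hz : (projectiveResolution E).cochainComplex.d (a - 1) a ≫ z = 0) : Ext E Y n :=
  (projectiveResolution E).extEquivCohomologyClass.symm
    (.mk (HomComplex.Cocycle.toSingleMk z ha (a - 1) (by omega) hz))

theorem exists_eq_extOf {E Y : FunCat Γ k} {n : ℕ} (a : ℤ) (ha : a + n = 0) (y : Ext E Y n) :
    ∃ z hz, y = extOf E n a ha z hz := by
  obtain ⟨x, rfl⟩ := (projectiveResolution E).extEquivCohomologyClass.symm.surjective y
  obtain ⟨x, rfl⟩ := x.mk_surjective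
  obtain ⟨f, hf, rfl⟩ := HomComplex.Cocycle.toSingleMk_surjective x a ha (a - 1) (by omega)
  exact ⟨f, hf, rfl⟩

theorem extOf_eq_zero_iff {E Y : FunCat Γ k} {n : ℕ} {a : ℤ} (ha : a + n = 0)
    (z : (projectiveResolution E).cochainComplex.X a ⟶ Y)
    (hz : (projectiveResolution E).cochainComplex.d (a - 1) a ≫ z = 0) :
    extOf E n a ha z hz = 0 ↔
      ∃ g, (projectiveResolution E).cochainComplex.d a (a + 1) ≫ g = z := by
  rw [extOf, ← (projectiveResolution E).extEquivCohomologyClass.apply_eq_iff_eq,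
    ProjectiveResolution.extEquivCohomologyClass_zero, Equiv.apply_symm_apply,
    HomComplex.CohomologyClass.mk_eq_zero_iff,
    HomComplex.Cocycle.toSingleMk_mem_coboundaries_iff _ _ _ _ _ (a + 1) rfl]

theorem extOf_sub {E Y : FunCat Γ k} {n : ℕ} {a : ℤ} (ha : a + n = 0)
    (z z' : (projectiveResolution E).cochainComplex.X a ⟶ Y)
    (hz : (projectiveResolution E).cochainComplex.d (a - 1) a ≫ z = 0)
    (hz' : (projectiveResolution E).cochainComplex.d (a - 1) a ≫ z' = 0) :
    extOf E n a ha z hz - extOf E n a ha z' hz' =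
      extOf E n a ha (z - z') (by rw [Preadditive.comp_sub, hz, hz', sub_zero]) := by
  rw [extOf, extOf, extOf, HomComplex.Cocycle.toSingleMk_sub _ _ _ _ _ hz hz',
    HomComplex.CohomologyClass.mk_sub, ProjectiveResolution.extEquivCohomologyClass_symm_sub]

theorem smallShiftedHom_mk_comp_mk {C : Type*} [Category C] [Abelian C] {K L M : CochainComplex C ℤ}
    [HasSmallLocalizedShiftedHom.{u} (HomologicalComplex.quasiIso C (ComplexShape.up ℤ)) ℤ K L]
    [HasSmallLocalizedShiftedHom.{u} (HomologicalComplex.quasiIso C (ComplexShape.up ℤ)) ℤ L M]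
    [HasSmallLocalizedShiftedHom.{u} (HomologicalComplex.quasiIso C (ComplexShape.up ℤ)) ℤ K M]
    [HasSmallLocalizedShiftedHom.{u} (HomologicalComplex.quasiIso C (ComplexShape.up ℤ)) ℤ M M]
    {a b c : ℤ} (f : ShiftedHom K L a) (g : ShiftedHom L M b) (h : b + a = c) :
    (SmallShiftedHom.mk (HomologicalComplex.quasiIso C (ComplexShape.up ℤ)) f).comp
      (SmallShiftedHom.mk (HomologicalComplex.quasiIso C (ComplexShape.up ℤ)) g) h =
      SmallShiftedHom.mk _ (f.comp g h) := by
  have := HasDerivedCategory.standard C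
  apply (SmallShiftedHom.equiv _ DerivedCategory.Q).injective
  simp only [SmallShiftedHom.equiv_comp, SmallShiftedHom.equiv_mk, ShiftedHom.map_comp]

theorem quasiIso_augmentation (E : FunCat Γ k) :
    HomologicalComplex.quasiIso _ (ComplexShape.up ℤ) (projectiveResolution E).π' := by
  rw [HomologicalComplex.mem_quasiIso_iff]
  infer_instance

theorem extRep_spec {E E' : FunCat Γ k} {m : ℕ} (x : Ext E E' m) :
    x = (SmallShiftedHom.mk₀Inv (0 : ℤ) rfl _ (quasiIso_augmentation E)).comp
      ((SmallShiftedHom.mk _ (extRep x)).comp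
        (SmallShiftedHom.mk₀ _ (0 : ℤ) rfl (projectiveResolution E').π') (zero_add _))
        (add_zero _) := by
  refine ((extEquiv E E' m).symm_apply_apply x).symm.trans ?_
  rw [← (extEquiv E E' m x).mk_surjective.choose_spec]
  rfl

theorem extEquivCohomologyClass_symm_mk {E Y : FunCat Γ k} {n : ℕ}
    (c : HomComplex.Cocycle (projectiveResolution E).cochainComplex
      ((singleFunctor _ 0).obj Y) n) :
    (projectiveResolution E).extEquivCohomologyClass.symm (.mk c) =
      (SmallShiftedHom.mk₀Inv (0 : ℤ) rfl _ (quasiIso_augmentation E)).comp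
        (SmallShiftedHom.mk _ (HomComplex.Cocycle.equivHomShift.symm c)) (add_zero _) :=
  rfl

theorem comp_extEquivCohomologyClass_symm {E E' Y : FunCat Γ k} {m n N : ℕ} (x : Ext E E' m)
    (h : m + n = N) (c : HomComplex.Cocycle (projectiveResolution E').cochainComplex
      ((singleFunctor _ 0).obj Y) n) :
    x.comp ((projectiveResolution E').extEquivCohomologyClass.symm (.mk c)) h =
      (projectiveResolution E).extEquivCohomologyClass.symm
        (.mk (HomComplex.Cocycle.equivHomShift (ShiftedHom.comp (extRep x)
          (HomComplex.Cocycle.equivHomShift.symm c) (c := (N : ℤ)) (by omega)))) := by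
  rw [extEquivCohomologyClass_symm_mk, extEquivCohomologyClass_symm_mk,
    AddEquiv.symm_apply_apply, ← smallShiftedHom_mk_comp_mk]
  conv_lhs => rw [extRep_spec x]
  refine (SmallShiftedHom.comp_assoc _ _ _ _ (add_zero _) (a₂₃ := (N : ℤ))
    (by omega) (by omega)).trans ?_
  congr 1
  refine (SmallShiftedHom.comp_assoc _ _ _ _ (zero_add _) (a₂₃ := (n : ℤ))
    (by omega) (by omega)).trans ?_
  congr 1
  refine (SmallShiftedHom.comp_assoc _ _ _ _ (a₁₂ := (0 : ℤ))
    (by omega) (add_zero _) (by omega)).symm.trans ?_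
  rw [SmallShiftedHom.mk₀_comp_mk₀Inv]
  exact SmallShiftedHom.mk₀_id_comp _ _ _

theorem xIsoOfEq_cycle {C : Type*} [Category C] [Abelian C] (K : CochainComplex C ℤ) {p q r : ℤ}
    (h : q = p) (h' : q = r) (h'' : r = p) :
    (K.XIsoOfEq h).inv ≫ (K.XIsoOfEq h').hom ≫ (K.XIsoOfEq h'').hom = 𝟙 _ := by
  subst h h'
  simp

theorem comp_cancel_of_eq_id {C : Type*} [Category C] {A B Y S₀ S₁ S₂ : C} (f : A ⟶ B)
    (z : B ⟶ Y) (s : Y ⟶ S₀) (i : S₀ ⟶ S₁) (i' : S₁ ⟶ S₂) (i'' : S₂ ⟶ S₀) (t : S₀ ⟶ Y)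
    (h : i ≫ i' ≫ i'' = 𝟙 _) :
    ((f ≫ ((z ≫ s) ≫ i) ≫ i') ≫ i'') ≫ t = ((f ≫ z) ≫ s) ≫ t := by
  simp only [Category.assoc, reassoc_of% h]

theorem equivHomShift_comp_toSingleMk {C : Type*} [Category C] [Abelian C]
    {K L : CochainComplex C ℤ} {Y : C} {m n N a b : ℤ} (φ : K ⟶ L⟦m⟧) (h : n + m = N)
    (ha : a + m + n = 0) (z : L.X (a + m) ⟶ Y) (hb : b + 1 = a) (hz : L.d (b + m) (a + m) ≫ z = 0)
    (hz' : K.d b a ≫ φ.f a ≫ z = 0) :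
    HomComplex.Cocycle.equivHomShift (ShiftedHom.comp φ
      (HomComplex.Cocycle.equivHomShift.symm
        (HomComplex.Cocycle.toSingleMk (q := 0) z ha (b + m) (by omega) hz)) h) =
      HomComplex.Cocycle.toSingleMk (q := 0) (n := N) (φ.f a ≫ z) (by omega) b hb hz' := by
  ext : 1
  apply (HomComplex.Cochain.toSingleEquiv (p := a) (by omega)).injective
  simp only [HomComplex.Cochain.toSingleEquiv, HomComplex.Cocycle.equivHomShift_apply,
    HomComplex.Cocycle.equivHomShift_symm_apply, HomComplex.Cocycle.toSingleMk_coe]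
  simp only [ShiftedHom.comp, HomComplex.Cocycle.rightUnshift_coe, HomComplex.Cocycle.ofHom_coe,
    HomComplex.Cochain.ofHom_comp, AddEquiv.coe_mk, Equiv.coe_fn_mk,
    HomComplex.Cochain.rightUnshift_v _ _ _ _ _ _ _ (add_zero a), shiftFunctor_obj_X',
    HomComplex.Cochain.comp_zero_cochain_v, HomComplex.Cochain.ofHom_v, shiftFunctor_map_f',
    HomComplex.Cocycle.homOf_f, HomComplex.Cocycle.rightShift_coe,
    HomComplex.Cocycle.toSingleMk_coe, shiftFunctorObjXIso, HomComplex.Cochain.toSingleMk_v]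
  rw [HomComplex.Cochain.rightShift_v _ _ _ _ _ _ _ 0 ha, HomComplex.Cochain.toSingleMk_v,
    shiftFunctorAdd'_inv_app_f']
  exact comp_cancel_of_eq_id _ _ _ _ _ _ _ (xIsoOfEq_cycle _ _ _ _)

theorem d_extRep_f_comp {E E' Y : FunCat Γ k} {m : ℕ} (x : Ext E E' m) {a : ℤ}
    (z : (projectiveResolution E').cochainComplex.X (a + m) ⟶ Y)
    (hz : (projectiveResolution E').cochainComplex.d (a - 1 + m) (a + m) ≫ z = 0) :
    (projectiveResolution E).cochainComplex.d (a - 1) a ≫ (extRep x).f a ≫ z = 0 := by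
  have hz' : ((projectiveResolution E').cochainComplex⟦(m : ℤ)⟧).d (a - 1) a ≫ z = 0 := by
    change ((m : ℤ).negOnePow •
      (projectiveResolution E').cochainComplex.d (a - 1 + m) (a + m)) ≫ z = 0
    rw [Linear.units_smul_comp, hz, smul_zero]
  refine (Category.assoc _ _ _).symm.trans
    ((congrArg (· ≫ z) ((extRep x).comm (a - 1) a).symm).trans ?_)
  exact (Category.assoc _ _ _).trans ((congrArg (_ ≫ ·) hz').trans comp_zero)

theorem comp_extOf {E E' Y : FunCat Γ k} {m n N : ℕ} (x : Ext E E' m) (h : m + n = N) {a : ℤ}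
    (ha : a + m + n = 0) (z : (projectiveResolution E').cochainComplex.X (a + m) ⟶ Y)
    (hz : (projectiveResolution E').cochainComplex.d (a - 1 + m) (a + m) ≫ z = 0) :
    x.comp (extOf E' n (a + m) ha z (by rwa [add_sub_right_comm])) h =
      extOf E N a (by omega) ((extRep x).f a ≫ z) (d_extRep_f_comp x z hz) := by
  rw [extOf, comp_extEquivCohomologyClass_symm, extOf]
  congr 2
  rw [← equivHomShift_comp_toSingleMk (extRep x) (by omega) ha z (by omega) hz]
  rfl

end ExtOf

section Duality
variable {Γ : Type} [SmallCategory Γ] {k : Type u} [Field k]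

/-- The map `H^a(chains E) ⟶ H^{a+m}(chains E')` induced by a class in `Ext^m(E, E')`. -/
def extAct {E E' : FunCat Γ k} {m : ℕ} (x : Ext E E' m) (a a' : ℤ) (h : m + a = a') :
    (chains E).homology a ⟶ (chains E').homology a' :=
  HomologicalComplex.homologyMap (chainsMap x) a ≫
    (CochainComplex.ShiftSequence.shiftIso (ModuleCat.{u} k) (m : ℤ) a a' h).hom.app _

/-- Maps from the resolution of `E` to the constant functor are linear forms on `chains E`. -/
def chainsForm {E : FunCat Γ k} {a : ℤ} :
    ((projectiveResolution E).cochainComplex.X a ⟶ constFun Γ k) ≃+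
      ((chains E).X a ⟶ ModuleCat.of k k) :=
  (colimConstAdj.homAddEquiv ((projectiveResolution E).cochainComplex.X a)
    (ModuleCat.of k k)).symm

theorem chainsForm_d {E : FunCat Γ k} {a b : ℤ}
    (z : (projectiveResolution E).cochainComplex.X b ⟶ constFun Γ k) :
    chainsForm ((projectiveResolution E).cochainComplex.d a b ≫ z) =
      (chains E).d a b ≫ chainsForm z :=
  colimConstAdj.homEquiv_naturality_left_symm _ z

theorem chainsForm_extRep {E E' : FunCat Γ k} {m : ℕ} (x : Ext E E' m) {a : ℤ}
    (z : (projectiveResolution E').cochainComplex.X (a + m) ⟶ constFun Γ k) :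
    chainsForm ((extRep x).f a ≫ z) = (chainsMap x).f a ≫ chainsForm z := by
  refine (colimConstAdj.homEquiv_naturality_left_symm ((extRep x).f a) z).trans ?_
  refine eq_whisker (?_ : colim.map ((extRep x).f a) = (chainsMap x).f a) _
  exact (Category.comp_id _).symm

instance : Injective (ModuleCat.of k k) :=
  have := Module.injective_of_isSemisimpleRing k k
  Module.injective_object_of_injective_module k k

/-- The linear form `ℓ` on `H^a(chains E)` and the class `y ∈ Ext^N(E, k)` are represented by a
common cocycle on the projective resolution of `E`. -/
def IsDual {E : FunCat Γ k} {a : ℤ} {N : ℕ} (ha : a + N = 0)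
    (ℓ : (chains E).homology a ⟶ ModuleCat.of k k) (y : Ext E (constFun Γ k) N) : Prop :=
  ∃ z hz, y = extOf E N a ha z hz ∧ Induces (chains E) a ℓ (chainsForm z)

theorem exists_isDual_left {E : FunCat Γ k} {a : ℤ} {N : ℕ} (ha : a + N = 0)
    (ℓ : (chains E).homology a ⟶ ModuleCat.of k k) : ∃ y, IsDual ha ℓ y := by
  obtain ⟨w, hw, h⟩ := exists_induces_of_injective (chains E) a (a - 1) ℓ
  obtain ⟨z, rfl⟩ := chainsForm.surjective w
  rw [← chainsForm_d, map_eq_zero_iff _ chainsForm.injective] at hw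
  exact ⟨_, z, hw, rfl, h⟩

theorem exists_isDual_right {E : FunCat Γ k} {a : ℤ} {N : ℕ} (ha : a + N = 0)
    (y : Ext E (constFun Γ k) N) : ∃ ℓ : (chains E).homology a ⟶ _, IsDual ha ℓ y := by
  obtain ⟨z, hz, rfl⟩ := exists_eq_extOf a ha y
  obtain ⟨ℓ, h⟩ := exists_induces (chains E) a (a - 1) (by omega) (chainsForm z)
    (by rw [← chainsForm_d, hz, map_zero])
  exact ⟨ℓ, z, hz, rfl, h⟩

theorem IsDual.eq_zero_iff {E : FunCat Γ k} {a : ℤ} {N : ℕ} {ha : a + N = 0}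
    {ℓ : (chains E).homology a ⟶ ModuleCat.of k k} {y : Ext E (constFun Γ k) N}
    (h : IsDual ha ℓ y) : ℓ = 0 ↔ y = 0 := by
  obtain ⟨z, hz, rfl, h⟩ := h
  rw [h.eq_zero_iff rfl, extOf_eq_zero_iff, chainsForm.surjective.exists]
  simp only [← chainsForm_d, EmbeddingLike.apply_eq_iff_eq]

theorem IsDual.sub {E : FunCat Γ k} {a : ℤ} {N : ℕ} {ha : a + N = 0}
    {ℓ ℓ' : (chains E).homology a ⟶ ModuleCat.of k k} {y y' : Ext E (constFun Γ k) N}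
    (h : IsDual ha ℓ y) (h' : IsDual ha ℓ' y') : IsDual ha (ℓ - ℓ') (y - y') := by
  obtain ⟨z, hz, rfl, h⟩ := h
  obtain ⟨z', hz', rfl, h'⟩ := h'
  refine ⟨z - z', _, extOf_sub _ _ _ _ _, ?_⟩
  rw [map_sub]
  exact h.sub h'

theorem IsDual.left_unique {E : FunCat Γ k} {a : ℤ} {N : ℕ} {ha : a + N = 0}
    {ℓ ℓ' : (chains E).homology a ⟶ ModuleCat.of k k} {y : Ext E (constFun Γ k) N}
    (h : IsDual ha ℓ y) (h' : IsDual ha ℓ' y) : ℓ = ℓ' :=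
  sub_eq_zero.1 ((h.sub h').eq_zero_iff.2 (sub_self y))

theorem IsDual.right_unique {E : FunCat Γ k} {a : ℤ} {N : ℕ} {ha : a + N = 0}
    {ℓ : (chains E).homology a ⟶ ModuleCat.of k k} {y y' : Ext E (constFun Γ k) N}
    (h : IsDual ha ℓ y) (h' : IsDual ha ℓ y') : y = y' :=
  sub_eq_zero.1 ((h.sub h').eq_zero_iff.1 (sub_self ℓ))

theorem IsDual.extAct {E E' : FunCat Γ k} {m N N' : ℕ} (x : Ext E E' m) {a a' : ℤ}
    (h : m + a = a') {ha' : a' + N' = 0} {ha : a + N = 0} (hN : m + N' = N)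
    {ℓ : (chains E').homology a' ⟶ ModuleCat.of k k} {y : Ext E' (constFun Γ k) N'}
    (hd : IsDual ha' ℓ y) : IsDual ha (extAct x a a' h ≫ ℓ) (x.comp y hN) := by
  obtain rfl : a' = a + m := by omega
  obtain ⟨z, hz, rfl, hd⟩ := hd
  refine ⟨_, _, comp_extOf x hN ha' z (by rwa [sub_add_eq_add_sub]), ?_⟩
  rw [chainsForm_extRep]
  exact (congrArg (Induces (chains E) a · _) (Category.assoc _ _ _)).mpr
    (hd.shift.comp (chainsMap x))

/-- Universal coefficients over a field: `Ext^N(E, k)` is the dual of `H_N(Γ, E)`. -/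
def dualEquiv (E : FunCat Γ k) {a : ℤ} {N : ℕ} (ha : a + N = 0) :
    Ext E (constFun Γ k) N ≃+ ((chains E).homology a ⟶ ModuleCat.of k k) :=
  have h (y : Ext E (constFun Γ k) N) := (exists_isDual_right ha y).choose_spec
  AddEquiv.ofBijective
    (AddMonoidHom.ofMapSub (fun y => (exists_isDual_right ha y).choose) fun y y' =>
      (h (y - y')).left_unique ((h y).sub (h y')))
    ⟨fun y y' e => (h y).right_unique ((congrArg (IsDual ha · y') e).mpr (h y')), fun ℓ =>
      have ⟨y, hy⟩ := exists_isDual_left ha ℓ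
      ⟨y, (h y).left_unique hy⟩⟩

theorem isDual_dualEquiv {E : FunCat Γ k} {a : ℤ} {N : ℕ} (ha : a + N = 0)
    (y : Ext E (constFun Γ k) N) : IsDual ha (dualEquiv E ha y) y :=
  (exists_isDual_right ha y).choose_spec

theorem dualEquiv_comp {E E' : FunCat Γ k} {m N N' : ℕ} (x : Ext E E' m) {a a' : ℤ}
    (h : m + a = a') (ha' : a' + N' = 0) (ha : a + N = 0) (hN : m + N' = N)
    (y : Ext E' (constFun Γ k) N') :
    dualEquiv E ha (x.comp y hN) = extAct x a a' h ≫ dualEquiv E' ha' y :=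
  (isDual_dualEquiv ha _).left_unique ((isDual_dualEquiv ha' y).extAct x h hN)

theorem subsingleton_chains_homology (E : FunCat Γ k) {a : ℤ} (ha : 0 < a) :
    Subsingleton ((chains E).homology a) := by
  have h : IsZero ((projectiveResolution E).cochainComplex.X a) :=
    CochainComplex.isZero_of_isStrictlyLE _ 0 _ ha
  have h' : IsZero ((chains E).X a) := colim.map_isZero h
  rw [← ModuleCat.isZero_iff_subsingleton]
  exact ShortComplex.isZero_homology_of_isZero_X₂ _ h'

theorem extAct_surjective {E E' : FunCat Γ k} {m N N' : ℕ} (x : Ext E E' m) {a a' : ℤ}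
    (h : m + a = a') (ha' : a' + N' = 0) (ha : a + N = 0) (hN : m + N' = N)
    (hx : ∀ y : Ext E' (constFun Γ k) N', x.comp y hN = 0 → y = 0) :
    Function.Surjective (extAct x a a' h) := by
  change Function.Surjective (extAct x a a' h).hom
  rw [← LinearMap.dualMap_injective_iff, injective_iff_map_eq_zero]
  intro ℓ hℓ
  obtain ⟨y, hy⟩ := (dualEquiv E' ha').surjective (ModuleCat.ofHom ℓ)
  have hxy : x.comp y hN = 0 := by
    rw [← (dualEquiv E ha).map_eq_zero_iff, dualEquiv_comp x h ha' ha hN, hy]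
    exact ModuleCat.hom_ext hℓ
  rw [hx y hxy, map_zero] at hy
  exact congrArg ModuleCat.Hom.hom hy.symm

theorem extAct_injective {E E' : FunCat Γ k} {m N N' : ℕ} (x : Ext E E' m) {a a' : ℤ}
    (h : m + a = a') (ha' : a' + N' = 0) (ha : a + N = 0) (hN : m + N' = N)
    (hx : ∀ z : Ext E (constFun Γ k) N, ∃ y : Ext E' (constFun Γ k) N', x.comp y hN = z) :
    Function.Injective (extAct x a a' h) := by
  change Function.Injective (extAct x a a' h).hom
  rw [← LinearMap.dualMap_surjective_iff]
  intro ℓ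
  obtain ⟨z, hz⟩ := (dualEquiv E ha).surjective (ModuleCat.ofHom ℓ)
  obtain ⟨y, rfl⟩ := hx z
  rw [dualEquiv_comp x h ha' ha hN] at hz
  exact ⟨(dualEquiv E' ha' y).hom, congrArg ModuleCat.Hom.hom hz⟩

theorem extAct_exact {E E' E'' : FunCat Γ k} {m m' N N' N'' : ℕ} (x : Ext E E' m)
    (x' : Ext E' E'' m') {a a' a'' : ℤ} (h : m + a = a') (h' : m' + a' = a'')
    (ha'' : a'' + N'' = 0) (ha' : a' + N' = 0) (ha : a + N = 0) (hN : m + N' = N)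
    (hN' : m' + N'' = N') (hzero : x.comp x' rfl = 0)
    (hx : ∀ y : Ext E' (constFun Γ k) N', x.comp y hN = 0 → ∃ z, x'.comp z hN' = y) :
    Function.Exact (extAct x a a' h) (extAct x' a' a'' h') := by
  intro v
  constructor
  · intro hv
    by_contra hmem
    obtain ⟨ℓ, hℓ, hr⟩ := Submodule.exists_le_ker_of_notMem
      (p := LinearMap.range (extAct x a a' h).hom) (v := v) (by simpa using hmem)
    obtain ⟨y, hy⟩ := (dualEquiv E' ha').surjective (ModuleCat.ofHom ℓ)
    have hxy : x.comp y hN = 0 := by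
      rw [← (dualEquiv E ha).map_eq_zero_iff, dualEquiv_comp x h ha' ha hN, hy]
      exact ModuleCat.hom_ext (LinearMap.ext fun w => hr ⟨w, rfl⟩)
    obtain ⟨z, rfl⟩ := hx y hxy
    rw [dualEquiv_comp x' h' ha'' ha' hN'] at hy
    have hℓv : dualEquiv E'' ha'' z (extAct x' a' a'' h' v) = ℓ v := congrArg (fun t => t.hom v) hy
    rw [hv, map_zero] at hℓv
    exact hℓ hℓv.symm
  · rintro ⟨w, rfl⟩
    rw [← Module.forall_dual_apply_eq_zero_iff k]
    intro ℓ
    obtain ⟨y, hy⟩ := (dualEquiv E'' ha'').surjective (ModuleCat.ofHom ℓ)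
    have hxy : dualEquiv E ha (x.comp (x'.comp y hN') hN) = 0 := by
      rw [← Ext.comp_assoc x x' y rfl hN' (by omega), hzero, Ext.zero_comp, map_zero]
    rw [dualEquiv_comp x h ha' ha hN, dualEquiv_comp x' h' ha'' ha' hN', hy] at hxy
    exact congrArg (fun t => t.hom w) hxy

end Duality

section ConstInjective
variable {Γ : Type} [SmallCategory Γ] {k : Type u} [Field k]

theorem injective_constFun {t : Γ} (ht : IsTerminal t) : Injective (constFun Γ k) := by
  have : (colim : FunCat Γ k ⥤ ModuleCat.{u} k).PreservesMonomorphisms := ⟨fun {X Y} f _ => by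
    have := isIso_ι_of_isTerminal ht X
    have := isIso_ι_of_isTerminal ht Y
    have h : colim.map f = inv (colimit.ι X t) ≫ f.app t ≫ colimit.ι Y t := by
      rw [IsIso.eq_inv_comp]
      exact colimit.ι_map f t
    rw [h]
    infer_instance⟩
  exact Injective.injective_of_adjoint colimConstAdj (ModuleCat.of k k)

theorem app_eq_of_isTerminal {t : Γ} (ht : IsTerminal t) {X : FunCat Γ k}
    (g : X ⟶ constFun Γ k) (a : Γ) : g.app a = X.map (ht.from a) ≫ g.app t :=
  ((g.naturality (ht.from a)).trans (Category.comp_id _)).symm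

end ConstInjective

/-! ### Décalage -/

/-- An object `{0 < ⋯ < len}` of the category of nonempty finite ordinals and order-preserving maps
that preserve the least element. -/
structure MinSimplex where
  len : ℕ

namespace MinSimplex

instance : SmallCategory MinSimplex where
  Hom X Y := {φ : Fin (X.len + 1) →o Fin (Y.len + 1) // φ 0 = 0}
  id X := ⟨OrderHom.id, rfl⟩
  comp f g := ⟨g.1.comp f.1, by simp [f.2, g.2]⟩

/-- The forgetful functor to `Δ`. -/
def forget : MinSimplex ⥤ SimplexCategory where
  obj X := SimplexCategory.mk X.len
  map f := SimplexCategory.mkHom f.1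

/-- Extension of an order-preserving map by a new least element. -/
def consHom {m n : ℕ} (φ : Fin m →o Fin (n + 1)) : Fin (m + 1) →o Fin (n + 1) where
  toFun := Fin.cases 0 φ
  monotone' := by
    intro i j
    induction i using Fin.cases with
    | zero => intro _; exact Fin.zero_le _
    | succ i =>
      induction j using Fin.cases with
      | zero => intro h; simp at h
      | succ j => intro h; exact φ.monotone (Fin.succ_le_succ_iff.1 h)

/-- The functor that adds a new least element. -/
def cons : SimplexCategory ⥤ MinSimplex where
  obj S := ⟨S.len + 1⟩
  map {S T} φ := ⟨consHom ((Fin.succOrderEmb (T.len + 1)).toOrderHom.comp φ.toOrderHom), rfl⟩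
  map_id S := by
    refine Subtype.ext (OrderHom.ext _ _ (funext fun i => ?_))
    induction i using Fin.cases <;> rfl
  map_comp f g := by
    refine Subtype.ext (OrderHom.ext _ _ (funext fun i => ?_))
    induction i using Fin.cases <;> rfl

/-- Adding a least element is left adjoint to the forgetful functor. -/
def consAdj : cons ⊣ forget :=
  Adjunction.mkOfHomEquiv
    { homEquiv := fun S T =>
        { toFun := fun f => SimplexCategory.mkHom
            (f.1.comp (Fin.succOrderEmb (S.len + 1)).toOrderHom)
          invFun := fun φ => ⟨consHom φ.toOrderHom, rfl⟩
          left_inv := fun f => by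
            refine Subtype.ext (OrderHom.ext _ _ (funext fun i => ?_))
            induction i using Fin.cases with
            | zero => exact f.2.symm
            | succ i => rfl
          right_inv := fun φ =>
            SimplexCategory.Hom.ext _ _ (OrderHom.ext _ _ (funext fun i => rfl)) }
      homEquiv_naturality_left_symm := fun f g => by
        refine Subtype.ext (OrderHom.ext _ _ (funext fun i => ?_))
        induction i using Fin.cases <;> rfl
      homEquiv_naturality_right := fun f g => rfl }

/-- The one-point ordinal is initial. -/
def isInitial : IsInitial (MinSimplex.mk 0) :=
  IsInitial.ofUniqueHom (fun Y => ⟨⟨fun _ => 0, fun _ _ _ => le_rfl⟩, rfl⟩) (fun Y f => by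
    refine Subtype.ext (OrderHom.ext _ _ (funext fun i => ?_))
    obtain rfl : i = 0 := Subsingleton.elim (α := Fin 1) _ _
    exact f.2)

end MinSimplex

section Decalage
open MinSimplex
variable {k : Type u} [Field k]

/-- The adjunction between the restriction functors along `cons` and `forget`. -/
def pullConsAdj : pull (k := k) cons.op ⊣ pull (k := k) forget.op :=
  consAdj.op.whiskerLeft (ModuleCat.{u} k)

theorem pull_cons_hom_app (G : FunCat MinSimplexᵒᵖ k)
    (h : (pull cons.op).obj G ⟶ constFun SimplexCategoryᵒᵖ k) (S : SimplexCategoryᵒᵖ) :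
    ∃ g : G.obj (Opposite.op ⟨0⟩) ⟶ ModuleCat.of k k,
      h.app S = G.map (MinSimplex.isInitial.to (cons.obj S.unop)).op ≫ g := by
  let h' := pullConsAdj.homEquiv _ _ h
  refine ⟨h'.app _, ?_⟩
  have hh' : h = (pull cons.op).map h' ≫ pullConsAdj.counit.app _ :=
    ((pullConsAdj.homEquiv _ _).symm_apply_apply h).symm.trans
      (pullConsAdj.homEquiv_counit (g := h'))
  rw [hh']
  exact (Category.comp_id _).trans
    (app_eq_of_isTerminal (terminalOpOfInitial MinSimplex.isInitial) h' (cons.op.obj S))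

theorem ext_pull_cons_eq_zero (G : FunCat MinSimplexᵒᵖ k) {n : ℕ}
    (y : Ext ((pull cons.op).obj G) (constFun SimplexCategoryᵒᵖ k) (n + 1)) : y = 0 := by
  have hI : Injective ((pull forget.op).obj (constFun SimplexCategoryᵒᵖ k)) :=
    injective_constFun (terminalOpOfInitial MinSimplex.isInitial)
  have := Ext.subsingleton_of_injective G ((pull forget.op).obj (constFun SimplexCategoryᵒᵖ k)) n
  exact (extAdjEquiv pullConsAdj G (constFun SimplexCategoryᵒᵖ k) (n + 1)).injective
    (Subsingleton.elim _ _)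

-- In degree `0`, `Hom(cons^* G, k)` is the dual of the value of `G` at the initial object.
theorem mk₀_comp_ext_pull_cons_eq_zero {F : FunCat SimplexCategoryᵒᵖ k} (G : FunCat MinSimplexᵒᵖ k)
    (i : F ⟶ (pull cons.op).obj G)
    (hi : ∀ S, i.app S ≫ G.map (MinSimplex.isInitial.to (cons.obj S.unop)).op = 0) {n : ℕ}
    (y : Ext ((pull cons.op).obj G) (constFun SimplexCategoryᵒᵖ k) n) :
    (Ext.mk₀ i).comp y (zero_add n) = 0 := by
  cases n with
  | zero =>
    obtain ⟨h, rfl⟩ := (Ext.mk₀_bijective _ _).2 y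
    rw [Ext.mk₀_comp_mk₀, Ext.mk₀_eq_zero_iff]
    refine NatTrans.ext (funext fun S => ?_)
    obtain ⟨g, hg⟩ := pull_cons_hom_app G h S
    refine (congrArg (i.app S ≫ ·) hg).trans ?_
    exact (Category.assoc _ _ _).symm.trans ((eq_whisker (hi S) g).trans zero_comp)
  | succ n => rw [ext_pull_cons_eq_zero G y, Ext.comp_zero]

variable (k) in
/-- The functor `S ↦ k^S` of functions. -/
def fnFun : FunCat SimplexCategoryᵒᵖ k where
  obj S := ModuleCat.of k (Fin (S.unop.len + 1) → k)
  map φ := ModuleCat.ofHom (LinearMap.funLeft k k φ.unop.toOrderHom)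

/-- Functions on `S` extend by zero to the ordinal with one more least element. -/
def fnExtend : fnFun k ⟶ cons.op ⋙ forget.op ⋙ fnFun k where
  app S := ModuleCat.ofHom
    { toFun := fun g => Fin.cases 0 g
      map_add' := fun g g' => funext fun i => by
        induction i using Fin.cases with
        | zero => exact (add_zero (0 : k)).symm
        | succ i => rfl
      map_smul' := fun c g => funext fun i => by
        induction i using Fin.cases with
        | zero => exact (mul_zero c).symm
        | succ i => rfl }
  naturality S T φ := by
    refine ModuleCat.hom_ext (LinearMap.ext fun g => funext fun i => ?_)
    induction i using Fin.cases <;> rfl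

/-- The natural map from the décalage of `F` to `F`. -/
def decalageMap (F : FunCat SimplexCategoryᵒᵖ k) : cons.op ⋙ forget.op ⋙ F ⟶ F :=
  Functor.whiskerRight (NatTrans.op consAdj.unit) F

theorem fnExtend_decalageMap : fnExtend ≫ decalageMap (fnFun k) = 𝟙 _ := by
  refine NatTrans.ext (funext fun S => ModuleCat.hom_ext (LinearMap.ext
    fun (g : Fin (S.unop.len + 1) → k) => funext fun (i : Fin (S.unop.len + 1)) => ?_))
  have h : (consAdj.unit.app S.unop).toOrderHom i = i.succ := rfl
  exact congrArg (Fin.cases (motive := fun _ => k) 0 g) h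

instance (F : FunCat SimplexCategoryᵒᵖ k) : Epi (decalageMap F) := by
  have (S : SimplexCategoryᵒᵖ) : Epi ((decalageMap F).app S) := by
    have h : consAdj.unit.app (forget.obj ⟨S.unop.len⟩) ≫
      forget.map (consAdj.counit.app ⟨S.unop.len⟩) = 𝟙 _ :=
        consAdj.right_triangle_components _
    have h' := congrArg (fun t => F.map t.op) h
    rw [op_comp, F.map_comp] at h'
    refine @epi_of_epi _ _ _ _ _ (F.map (forget.map (consAdj.counit.app ⟨S.unop.len⟩)).op) _ ?_
    refine (congrArg Epi (h'.trans (F.map_id _))).mpr ?_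
    infer_instance
  exact NatTrans.epi_of_epi_app _

theorem ext_fnFun_tensor_decalage_eq_zero (F : FunCat SimplexCategoryᵒᵖ k) {n : ℕ}
    (y : Ext (fnFun k ⊗ (cons.op ⋙ forget.op ⋙ F)) (constFun SimplexCategoryᵒᵖ k) n) : y = 0 := by
  let i : fnFun k ⊗ (cons.op ⋙ forget.op ⋙ F) ⟶ cons.op ⋙ forget.op ⋙ (fnFun k ⊗ F) :=
    fnExtend ▷ (cons.op ⋙ forget.op ⋙ F)
  let r : cons.op ⋙ forget.op ⋙ (fnFun k ⊗ F) ⟶ fnFun k ⊗ (cons.op ⋙ forget.op ⋙ F) :=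
    decalageMap (fnFun k) ▷ (cons.op ⋙ forget.op ⋙ F)
  have hir : i ≫ r = 𝟙 _ := by
    refine (comp_whiskerRight _ _ _).symm.trans ?_
    rw [fnExtend_decalageMap, id_whiskerRight]
  have hi (S) : i.app S ≫ (forget.op ⋙ (fnFun k ⊗ F)).map
      (MinSimplex.isInitial.to (cons.obj S.unop)).op = 0 := by
    refine ModuleCat.hom_ext (TensorProduct.ext' fun (x : Fin (S.unop.len + 1) → k) y => ?_)
    exact (rfl : _ = (0 : Fin 1 → k) ⊗ₜ[k]
      F.map (forget.map (MinSimplex.isInitial.to (cons.obj S.unop))).op y).trans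
        (TensorProduct.zero_tmul _ _)
  calc
    y = (Ext.mk₀ i).comp ((Ext.mk₀ r).comp y (zero_add n)) (zero_add n) := by
      rw [Ext.mk₀_comp_mk₀_assoc, hir, Ext.mk₀_id_comp]
    _ = 0 := mk₀_comp_ext_pull_cons_eq_zero (forget.op ⋙ (fnFun k ⊗ F)) i hi _

-- Dimension shifting along the epimorphism from the décalage of `F` to `F`.
theorem ext_fnFun_tensor_eq_zero (F : FunCat SimplexCategoryᵒᵖ k) {n : ℕ}
    (y : Ext (fnFun k ⊗ F) (constFun SimplexCategoryᵒᵖ k) n) : y = 0 := by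
  induction n generalizing F with
  | zero =>
    obtain ⟨h, rfl⟩ := (Ext.mk₀_bijective _ _).2 y
    have hdec := ext_fnFun_tensor_decalage_eq_zero F
      (Ext.mk₀ ((tensorLeft (fnFun k)).map (decalageMap F) ≫ h))
    rw [Ext.mk₀_eq_zero_iff] at hdec
    have hh : h = 0 := (cancel_epi ((tensorLeft (fnFun k)).map (decalageMap F))).1
      (hdec.trans comp_zero.symm)
    rw [hh, Ext.mk₀_zero]
  | succ n ih =>
    let S := ShortComplex.mk _ _ (kernel.condition (decalageMap F))
    have hS : S.ShortExact := { exact := ShortComplex.exact_kernel _ }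
    have hS' := hS.map_of_exact (tensorLeft (fnFun k))
    obtain ⟨x, hx⟩ := Ext.contravariant_sequence_exact₃ hS' (constFun SimplexCategoryᵒᵖ k) y
      (ext_fnFun_tensor_decalage_eq_zero F _) (add_comm 1 n)
    have hx0 : x = 0 := ih (kernel (decalageMap F)) x
    rw [← hx, hx0]
    exact Ext.comp_zero _ _ _ _ _

end Decalage

/-! ### The functor `j_!` -/

section Elements
variable {Γ : Type} [SmallCategory Γ] {k : Type u} [Field k] {Φ : Γ ⥤ Type}

/-- The value of a functor on the category of elements, as a family indexed by the fibre. -/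
abbrev fibre (F : FunCat Φ.Elements k) (X : Γ) : Φ.obj X → ModuleCat.{u} k :=
  fun a => F.obj (Φ.elementsMk X a)

/-- The map of fibres induced by a map of the base. -/
abbrev fibreHom {X Y : Γ} (f : X ⟶ Y) (a : Φ.obj X) :
    Φ.elementsMk X a ⟶ Φ.elementsMk Y (Φ.map f a) := ⟨f, rfl⟩

theorem map_ι_fibre (F : FunCat Φ.Elements k) {x y : Φ.Elements} (g : x ⟶ y) :
    F.map g ≫ Sigma.ι (fibre F y.1) y.2 =
      F.map (fibreHom g.1 x.2) ≫ Sigma.ι (fibre F y.1) (Φ.map g.1 x.2) := by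
  have of_lift (Y : Γ) (b : Φ.obj Y) (f : x.1 ⟶ Y) (h : Φ.map f x.2 = b) :
      F.map (show x ⟶ Φ.elementsMk Y b from ⟨f, h⟩) ≫ Sigma.ι (fibre F Y) b =
        F.map (fibreHom f x.2) ≫ Sigma.ι (fibre F Y) (Φ.map f x.2) := by
    subst h
    rfl
  exact of_lift y.1 y.2 g.1 g.2

variable (k Φ) in
/-- The sum over the fibres, the left adjoint of restriction to the category of elements. -/
def elementsSum : FunCat Φ.Elements k ⥤ FunCat Γ k where
  obj F :=
    { obj := fun X => ∐ fibre F X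
      map := fun {X Y} f => Sigma.desc fun a =>
        F.map (fibreHom f a) ≫ Sigma.ι (fibre F Y) (Φ.map f a)
      map_id := fun X => Sigma.hom_ext _ _ fun a => by
        rw [Sigma.ι_desc, Category.comp_id]
        refine (map_ι_fibre F (𝟙 (Φ.elementsMk X a))).symm.trans ?_
        rw [F.map_id, Category.id_comp]
      map_comp := fun {X Y Z} f g => Sigma.hom_ext _ _ fun a => by
        rw [Sigma.ι_desc, Sigma.ι_desc_assoc, Category.assoc, Sigma.ι_desc]
        refine (map_ι_fibre F (fibreHom f a ≫ fibreHom g (Φ.map f a))).symm.trans ?_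
        rw [F.map_comp, Category.assoc] }
  map {F G} α :=
    { app := fun X => Limits.Sigma.map fun a => α.app (Φ.elementsMk X a)
      naturality := fun X Y f => Sigma.hom_ext _ _ fun a => by simp }
  map_id F := by
    ext X : 2
    exact Sigma.hom_ext _ _ fun a => by simp
  map_comp α β := by
    ext X : 2
    exact Sigma.hom_ext _ _ fun a => by simp

theorem ι_elementsSum_obj_map (F : FunCat Φ.Elements k) {X Y : Γ} (f : X ⟶ Y) (a : Φ.obj X) :
    Sigma.ι (fibre F X) a ≫ ((elementsSum k Φ).obj F).map f =
      F.map (fibreHom f a) ≫ Sigma.ι (fibre F Y) (Φ.map f a) :=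
  Sigma.ι_desc _ _

theorem ι_elementsSum_map_app {F G : FunCat Φ.Elements k} (α : F ⟶ G) (X : Γ) (a : Φ.obj X) :
    Sigma.ι (fibre F X) a ≫ ((elementsSum k Φ).map α).app X =
      α.app (Φ.elementsMk X a) ≫ Sigma.ι (fibre G X) a :=
  ι_colimMap _ _

/-- Restriction of `h : elementsSum F ⟶ G` to the fibres. -/
def elementsSumRestrict {F : FunCat Φ.Elements k} {G : FunCat Γ k}
    (h : (elementsSum k Φ).obj F ⟶ G) : F ⟶ (pull (CategoryOfElements.π Φ)).obj G where
  app x := Sigma.ι (fibre F x.1) x.2 ≫ h.app x.1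
  naturality x y g := by
    refine (Category.assoc _ _ _).symm.trans
      ((congrArg (· ≫ h.app y.1) (map_ι_fibre F g)).trans ?_)
    refine Eq.trans ?_ ((congrArg (Sigma.ι (fibre F x.1) x.2 ≫ ·) (h.naturality g.1)).trans
      (Category.assoc _ _ _).symm)
    refine Eq.trans ?_ (Category.assoc _ _ _)
    exact congrArg (· ≫ h.app y.1) (ι_elementsSum_obj_map F g.1 x.2).symm

/-- The natural transformation out of the sum over the fibres given by `g` on each fibre. -/
def elementsSumDesc {F : FunCat Φ.Elements k} {G : FunCat Γ k}
    (g : ∀ X a, fibre F X a ⟶ G.obj X)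
    (hg : ∀ {X Y} (f : X ⟶ Y) a, F.map (fibreHom f a) ≫ g Y (Φ.map f a) = g X a ≫ G.map f) :
    (elementsSum k Φ).obj F ⟶ G where
  app X := Sigma.desc (g X)
  naturality X Y f := Sigma.hom_ext _ _ fun a => by
    refine (Category.assoc _ _ _).symm.trans
      ((congrArg (· ≫ _) (ι_elementsSum_obj_map F f a)).trans ?_)
    have ι_desc (Z : Γ) (c : Φ.obj Z) :
        Sigma.ι (fibre F Z) c ≫ Limits.Sigma.desc (g Z) = g Z c := Sigma.ι_desc _ _
    refine (Category.assoc _ _ _).trans ((whisker_eq _ (ι_desc Y (Φ.map f a))).trans ?_)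
    exact (hg f a).trans ((eq_whisker (ι_desc X a).symm (G.map f)).trans (Category.assoc _ _ _))

/-- The sum over the fibres is left adjoint to restriction to the category of elements. -/
def elementsSumAdj : elementsSum k Φ ⊣ pull (CategoryOfElements.π Φ) :=
  Adjunction.mkOfHomEquiv
    { homEquiv := fun F G =>
        { toFun := elementsSumRestrict
          invFun := fun g => elementsSumDesc (fun X a => g.app (Φ.elementsMk X a))
            fun f a => g.naturality (fibreHom f a)
          left_inv := fun h => by
            ext X : 2
            exact Sigma.hom_ext _ _ fun a => Sigma.ι_desc _ _
          right_inv := fun g => by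
            ext X : 2
            exact Sigma.ι_desc _ _ }
      homEquiv_naturality_left_symm := fun {F F' G} f g => by
        refine NatTrans.ext (funext fun X => Sigma.hom_ext _ _ fun a => ?_)
        refine (Sigma.ι_desc _ _).trans (Eq.trans ?_ (Category.assoc _ _ _))
        refine Eq.trans ?_ (eq_whisker (ι_elementsSum_map_app f X a).symm _)
        refine Eq.trans ?_ (Category.assoc _ _ _).symm
        refine whisker_eq (f.app (Φ.elementsMk X a)) (Eq.symm ?_)
        exact Sigma.ι_desc _ _
      homEquiv_naturality_right := fun f g =>
        NatTrans.ext (funext fun X => (Category.assoc _ _ _).symm) }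

theorem elementsSumAdj_homEquiv_app {F : FunCat Φ.Elements k} {G : FunCat Γ k}
    (h : (elementsSum k Φ).obj F ⟶ G) (x : Φ.Elements) :
    (elementsSumAdj.homEquiv F G h).app x = Sigma.ι (fibre F x.1) x.2 ≫ h.app x.1 := by
  simp only [elementsSumAdj, Adjunction.mkOfHomEquiv_homEquiv]
  rfl

instance : (elementsSum k Φ).Additive where
  map_add {F G f g} := by
    refine NatTrans.ext (funext fun X => Sigma.hom_ext _ _ fun a => ?_)
    refine (ι_elementsSum_map_app (f + g) X a).trans ?_
    refine Eq.trans ?_ (Preadditive.comp_add _ _ _ _ _ _).symm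
    refine (Preadditive.add_comp _ _ _ _ _ _).trans ?_
    exact congrArg₂ (· + ·) (ι_elementsSum_map_app f X a).symm
      (ι_elementsSum_map_app g X a).symm

instance : PreservesFiniteColimits (elementsSum k Φ) := by
  have := elementsSumAdj (Φ := Φ) (k := k).leftAdjoint_preservesColimits
  infer_instance

/-- The fibre of the category of elements. -/
def fibreInclusion (X : Γ) : Discrete (Φ.obj X) ⥤ Φ.Elements :=
  Discrete.functor fun a => Φ.elementsMk X a

/-- The value at `X` of the sum over the fibres is the colimit over the discrete fibre. -/
def elementsSumEvaluationIso (X : Γ) : pull (fibreInclusion X) ⋙ colim ≅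
    elementsSum k Φ ⋙ (evaluation Γ (ModuleCat.{u} k)).obj X :=
  NatIso.ofComponents (fun F => HasColimit.isoOfNatIso (Discrete.natIso fun a => Iso.refl _))
    fun {F G} f => colimit.hom_ext fun a => by
      have ι_iso (F : FunCat Φ.Elements k) : colimit.ι (fibreInclusion X ⋙ F) a ≫
          (HasColimit.isoOfNatIso (Discrete.natIso fun a => Iso.refl _) :
            colimit (fibreInclusion X ⋙ F) ≅ ∐ fibre F X).hom = Sigma.ι (fibre F X) a.as :=
        (HasColimit.isoOfNatIso_ι_hom _ _).trans (Category.id_comp _)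
      refine (Category.assoc _ _ _).symm.trans ((congrArg (· ≫ _) (ι_colimMap _ _)).trans ?_)
      refine (Category.assoc _ _ _).trans ((whisker_eq _ (ι_iso _)).trans ?_)
      refine Eq.trans ?_ ((eq_whisker (ι_iso _) _).symm.trans (Category.assoc _ _ _))
      exact (ι_elementsSum_map_app f X a.as).symm

instance : PreservesFiniteLimits (elementsSum k Φ) :=
  preservesFiniteLimits_of_evaluation _ fun X =>
    preservesFiniteLimits_of_natIso (elementsSumEvaluationIso X)

/-- The map from a direct sum of copies of `M` to `M ⊗ k[I]`. -/
def copiesToTensor (M : ModuleCat.{u} k) (I : Type) :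
    (∐ fun _ : I => M) ⟶ ModuleCat.of k (TensorProduct k M (I →₀ k)) :=
  Sigma.desc fun i => ModuleCat.ofHom ((TensorProduct.mk k M (I →₀ k)).flip (Finsupp.single i 1))

theorem ι_copiesToTensor_apply (M : ModuleCat.{u} k) {I : Type} (i : I) (x : M) :
    copiesToTensor M I (Sigma.ι (fun _ : I => M) i x) = x ⊗ₜ[k] Finsupp.single i (1 : k) :=
  congrArg (fun t => t.hom x) (Sigma.ι_desc (f := fun _ : I => M) (fun i =>
    ModuleCat.ofHom ((TensorProduct.mk k M (I →₀ k)).flip (Finsupp.single i 1))) i)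

instance isIso_copiesToTensor (M : ModuleCat.{u} k) (I : Type) : IsIso (copiesToTensor M I) := by
  let g : ModuleCat.of k (TensorProduct k M (I →₀ k)) ⟶ ∐ fun _ : I => M :=
    ModuleCat.ofHom (TensorProduct.lift (Finsupp.linearCombination k
      fun i : I => (Sigma.ι (fun _ : I => M) i).hom).flip)
  have hg (i : I) (x : M) : g.hom (x ⊗ₜ Finsupp.single i 1) = Sigma.ι (fun _ : I => M) i x := by
    simp [g]
  refine ⟨g, Sigma.hom_ext _ _ fun i => ModuleCat.hom_ext (LinearMap.ext fun x => ?_),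
    ModuleCat.hom_ext (TensorProduct.ext (LinearMap.ext fun x => Finsupp.lhom_ext' fun i =>
      LinearMap.ext_ring ?_))⟩
  · exact (congrArg g (ι_copiesToTensor_apply M i x)).trans (hg i x)
  · exact (congrArg (copiesToTensor M I).hom (hg i x)).trans (ι_copiesToTensor_apply M i x)

end Elements

namespace Lambda

theorem cast_lift_cast (q : ℕ) {n m : ℕ+} (f : LiftHom n m) (a : ℤ) :
    ((f (((a : ZMod (q * n)).cast : ℤ)) : ℤ) : ZMod (q * m)) = (f a : ZMod (q * m)) := by
  obtain ⟨c, hc⟩ := exists_cast_eq (q * n) a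
  rw [hc, lift_add_mul, Int.cast_add, Int.cast_mul, Int.cast_natCast, ZMod.natCast_self, mul_zero,
    add_zero]

/-- The functor of marked points, `[n] ↦ ℤ/qn`. -/
def points (q : ℕ) : Lambda q ⥤ Type where
  obj X := ZMod (q * X.card)
  map {X Y} := Quotient.lift (s := LiftHom.setoid q X.card Y.card)
    (fun f => TypeCat.ofHom fun x : ZMod (q * X.card) => (f (x.cast : ℤ) : ZMod (q * Y.card)))
    (fun f g ⟨c, h⟩ => by
      congr 1
      funext x
      have period_eq_zero : (((q : ℤ) * ((Y.card : ℕ) : ℤ) : ℤ) : ZMod (q * Y.card)) = 0 := by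
        exact_mod_cast ZMod.natCast_self (q * Y.card)
      rw [h, mul_assoc, Int.cast_add, Int.cast_mul, period_eq_zero, mul_zero, add_zero])
  map_id X := ConcreteCategory.hom_ext _ _ fun x => ZMod.intCast_zmod_cast x
  map_comp := by
    rintro X Y Z ⟨f⟩ ⟨g⟩
    exact ConcreteCategory.hom_ext _ _ fun x => (cast_lift_cast q g _).symm

theorem points_map_homMk {q : ℕ} {X Y : Lambda q} (f : LiftHom X.card Y.card) (a : ℤ) :
    (points q).map (homMk f) (a : ZMod (q * X.card)) = (f a : ZMod (q * Y.card)) :=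
  cast_lift_cast q f a

theorem periodicExt_nonneg_iff {S T : SimplexCategory} (φ : S ⟶ T) (b : ℤ) :
    0 ≤ periodicExt φ b ↔ 0 ≤ b := by
  obtain ⟨c, r, rfl⟩ := exists_rep S b
  rw [periodicExt_apply]
  have hr : ((r : ℕ) : ℤ) < S.len + 1 := by exact_mod_cast r.2
  have ht : ((φ.toOrderHom r : ℕ) : ℤ) < T.len + 1 := by exact_mod_cast (φ.toOrderHom r).2
  have nonneg_iff (t v : ℤ) (hv : 0 ≤ v) (hvt : v < t) : 0 ≤ c * t + v ↔ 0 ≤ c := by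
    constructor
    · intro h
      by_contra hc
      nlinarith
    · intro h
      nlinarith
  rw [nonneg_iff _ _ (by positivity) ht, nonneg_iff _ _ (by positivity) hr]

theorem dualFun_zero {S T : SimplexCategory} (φ : S ⟶ T) : dualFun φ 0 = 0 :=
  eq_of_forall_ge_iff fun b => by rw [dualFun_gc, periodicExt_nonneg_iff]

theorem dualHom_injective {S T : SimplexCategory} {φ ψ : S ⟶ T} (h : dualHom φ = dualHom ψ) :
    φ = ψ := by
  have periodicExt_eq (b : ℤ) : periodicExt φ b = periodicExt ψ b := by
    refine eq_of_forall_le_iff fun a => ?_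
    rw [← dualFun_gc, ← dualFun_gc]
    exact iff_of_eq (congrArg (fun t : LiftHom _ _ => t a ≤ b) h)
  refine SimplexCategory.Hom.ext _ _ (OrderHom.ext _ _ (funext fun r => Fin.ext ?_))
  have value_eq := periodicExt_eq (0 * (S.len + 1) + (r : ℕ))
  rw [periodicExt_apply, periodicExt_apply] at value_eq
  omega

theorem simplexCard_cast (S : SimplexCategory) : ((simplexCard S : ℕ) : ℤ) = S.len + 1 := by
  simp [simplexCard]

theorem exists_le_iff_le {S T : SimplexCategory}
    (f : LiftHom (simplexCard T) (simplexCard S)) (h0 : f 0 = 0) (r : Fin (S.len + 1)) :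
    ∃ a : Fin (T.len + 1), ∀ a' : ℤ, f a' ≤ (r : ℕ) ↔ a' ≤ (a : ℕ) := by
  have hr : ((r : ℕ) : ℤ) < S.len + 1 := by exact_mod_cast r.2
  have map_period : f (T.len + 1) = S.len + 1 := by
    have := f.map_add' 0
    rwa [h0, zero_add, zero_add, simplexCard_cast, simplexCard_cast] at this
  have bounded (a : ℤ) (ha : f a ≤ (r : ℕ)) : a ≤ T.len := by
    by_contra hlt
    have : f (T.len + 1) ≤ f a := f.monotone' (show (T.len + 1 : ℤ) ≤ a by omega)
    omega
  obtain ⟨a, ha, a_greatest⟩ := Int.exists_greatest_of_bdd (P := fun a => f a ≤ (r : ℕ))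
    ⟨_, bounded⟩ ⟨0, by rw [h0]; positivity⟩
  have a_nonneg : 0 ≤ a := a_greatest 0 (by rw [h0]; positivity)
  refine ⟨⟨a.toNat, by have := bounded a ha; omega⟩, fun a' => ?_⟩
  rw [show ((a.toNat : ℕ) : ℤ) = a by omega]
  exact ⟨a_greatest a', fun h => (f.monotone' h).trans ha⟩

theorem exists_dualHom_eq {S T : SimplexCategory} (f : LiftHom (simplexCard T) (simplexCard S))
    (h0 : f 0 = 0) : ∃ φ : S ⟶ T, dualHom φ = f := by
  choose g hg using exists_le_iff_le f h0
  have g_monotone : Monotone g := fun r r' h => by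
    have := (hg r' (g r : ℕ)).1 (((hg r (g r : ℕ)).2 le_rfl).trans (by exact_mod_cast h))
    exact_mod_cast this
  refine ⟨SimplexCategory.mkHom ⟨g, g_monotone⟩, LiftHom.ext (funext fun a => ?_)⟩
  refine eq_of_forall_ge_iff fun b => (dualFun_gc _ a b).trans ?_
  obtain ⟨c, r, rfl⟩ := exists_rep S b
  have translate := f.map_add_mul a (-c)
  rw [simplexCard_cast, simplexCard_cast] at translate
  rw [periodicExt_apply]
  calc a ≤ c * (T.len + 1) + (g r : ℕ) ↔ a + -c * (T.len + 1) ≤ (g r : ℕ) := by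
        constructor <;> intro h <;> linarith
    _ ↔ f (a + -c * (T.len + 1)) ≤ (r : ℕ) := (hg r _).symm
    _ ↔ f a ≤ c * (S.len + 1) + (r : ℕ) := by
        rw [translate]
        constructor <;> intro h <;> linarith

theorem points_map_homMk_zero {q : ℕ} {X Y : Lambda q} (f : LiftHom X.card Y.card) :
    (points q).map (homMk f) (0 : ZMod (q * X.card)) = (f 0 : ZMod (q * Y.card)) := by
  simpa only [Int.cast_zero] using points_map_homMk f 0

/-- The lift of the embedding `j` to the category of elements of the functor of marked points. -/
def jLift (q : ℕ) : SimplexCategoryᵒᵖ ⥤ (points q).Elements where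
  obj S := (points q).elementsMk ((j q).obj S) (0 : ZMod _)
  map {S T} f := ⟨(j q).map f,
    (points_map_homMk_zero (X := (j q).obj S) (Y := (j q).obj T) (dualHom f.unop)).trans
      ((congrArg (fun t : ℤ => (t : ZMod (q * ((j q).obj T).card))) (dualFun_zero f.unop)).trans
        Int.cast_zero)⟩
  map_id S := CategoryOfElements.ext _ _ _ ((j q).map_id S)
  map_comp f g := CategoryOfElements.ext _ _ _ ((j q).map_comp f g)

instance (q : ℕ) : (jLift q).Faithful where
  map_injective {S T f g} h := by
    obtain ⟨c, hc⟩ := Quotient.exact (congrArg Subtype.val h : (j q).map f = (j q).map g)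
    refine Quiver.Hom.unop_inj (dualHom_injective (LiftHom.ext (funext fun a => ?_)))
    have h0 : dualFun g.unop 0 = dualFun f.unop 0 + c * q * (simplexCard T.unop : ℕ) := hc 0
    rw [dualFun_zero, dualFun_zero] at h0
    have ha : dualFun g.unop a = dualFun f.unop a + c * q * (simplexCard T.unop : ℕ) := hc a
    change dualFun f.unop a = dualFun g.unop a
    linarith

/-- The composite of a lift with a power of `σ`. -/
def translate {n m : ℕ+} (f : LiftHom n m) (c : ℤ) : LiftHom n m where
  toFun a := f a + c * m
  monotone' _ _ h := add_le_add_left (f.monotone' h) _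
  map_add' a := by rw [show f (a + n) = f a + m from f.map_add' a]; ring

instance (q : ℕ) : (jLift q).Full where
  map_surjective {S T} := by
    rintro ⟨⟨f⟩, hf⟩
    have f_zero : ((f 0 : ℤ) : ZMod (q * (simplexCard T.unop : ℕ))) = 0 :=
      (points_map_homMk_zero (X := (j q).obj S) (Y := (j q).obj T) f).symm.trans hf
    obtain ⟨c, hc⟩ := (ZMod.intCast_zmod_eq_zero_iff_dvd _ _).1 f_zero
    obtain ⟨φ, hφ⟩ := exists_dualHom_eq (translate f (-c * q)) (by
      change f 0 + -c * q * (simplexCard T.unop : ℕ) = 0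
      rw [hc]
      push_cast
      ring)
    refine ⟨φ.op, CategoryOfElements.ext _ _ _ ?_⟩
    refine (congrArg (homMk (p := q) (X := (j q).obj S) (Y := (j q).obj T)) hφ).trans ?_
    refine Quotient.sound ⟨c, fun a => ?_⟩
    change f a = f a + -c * q * (simplexCard T.unop : ℕ) + c * q * (simplexCard T.unop : ℕ)
    ring

/-- The rotation of `[n]` by `a`. -/
def rotate (n : ℕ+) (a : ℤ) : LiftHom n n :=
  ⟨fun x => x + a, fun _ _ h => by simpa using h, fun x => by ring⟩

/-- The isomorphism of `Λ_q` given by the rotation by `a`. -/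
def rotateIso {q : ℕ} (X : Lambda q) (a : ℤ) : X ≅ X where
  hom := homMk (rotate X.card a)
  inv := homMk (rotate X.card (-a))
  hom_inv_id := congrArg (homMk (p := q)) (LiftHom.ext (funext fun x => by
    change x + a + -a = x; ring))
  inv_hom_id := congrArg (homMk (p := q)) (LiftHom.ext (funext fun x => by
    change x + -a + a = x; ring))

instance (q : ℕ) : (jLift q).EssSurj where
  mem_essImage := by
    rintro ⟨⟨⟨n, hn⟩⟩, a⟩
    obtain ⟨n, rfl⟩ := Nat.exists_eq_succ_of_ne_zero hn.ne'
    obtain ⟨b, rfl⟩ := ZMod.intCast_surjective a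
    let X : Lambda q := (j q).obj (Opposite.op (SimplexCategory.mk n))
    refine ⟨Opposite.op (SimplexCategory.mk n), ⟨CategoryOfElements.isoMk _ _ (rotateIso X b) ?_⟩⟩
    exact (points_map_homMk_zero (rotate X.card b)).trans
      (congrArg (fun t : ℤ => (t : ZMod (q * X.card))) (zero_add b))

instance (q : ℕ) : (jLift q).IsEquivalence where

end Lambda

section JShriek
open Lambda
variable {k : Type u} [Field k] {q : ℕ}

theorem pointFun_map_single {X Y : Lambda q} (f : X ⟶ Y) (x : ZMod (q * X.card)) :
    (pointFun k q).map f (Finsupp.single x 1 : ZMod (q * X.card) →₀ k) =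
      (Finsupp.single ((points q).map f x : ZMod (q * Y.card)) 1 : ZMod (q * Y.card) →₀ k) := by
  obtain ⟨f, rfl⟩ := Quotient.exists_rep f
  obtain ⟨a, rfl⟩ := ZMod.intCast_surjective x
  refine (pointMap_single q f a).trans ?_
  exact congrArg (fun t => Finsupp.single t (1 : k)) (points_map_homMk f a).symm

/-- The map `x ↦ x ⊗ v_a` over a marked point `a`. -/
def elementsVertex (A : FunCat (Lambda q) k) :
    (pull (CategoryOfElements.π (points q))).obj A ⟶
      (pull (CategoryOfElements.π (points q))).obj (A ⊗ pointFun k q) where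
  app x := ModuleCat.ofHom ((TensorProduct.mk k (A.obj x.1) (ZMod (q * x.1.card) →₀ k)).flip
    (Finsupp.single (show ZMod (q * x.1.card) from x.2) 1))
  naturality x y f := by
    refine ModuleCat.hom_ext (LinearMap.ext fun a => ?_)
    have map_single := pointFun_map_single (k := k) f.1 x.2
    rw [f.2] at map_single
    exact congrArg (fun t : ZMod (q * y.1.card) →₀ k => A.map f.1 a ⊗ₜ[k] t) map_single.symm

/-- The sum over the marked points of a restricted functor is a tensor product. -/
def elementsTensorHom (A : FunCat (Lambda q) k) :
    (elementsSum k (points q)).obj ((pull (CategoryOfElements.π (points q))).obj A) ⟶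
      A ⊗ pointFun k q :=
  (elementsSumAdj.homEquiv _ _).symm (elementsVertex A)

theorem elementsTensorHom_app (A : FunCat (Lambda q) k) (X : Lambda q) :
    (elementsTensorHom A).app X = copiesToTensor (A.obj X) (ZMod (q * X.card)) := by
  refine Sigma.hom_ext _ _ fun a => ?_
  have restrict_fibre := elementsSumAdj_homEquiv_app (elementsTensorHom A)
    ((points q).elementsMk X a)
  rw [elementsTensorHom, Equiv.apply_symm_apply] at restrict_fibre
  refine restrict_fibre.symm.trans (Eq.symm ?_)
  exact Sigma.ι_desc _ _

instance (A : FunCat (Lambda q) k) : IsIso (elementsTensorHom A) := by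
  have (X : Lambda q) : IsIso ((elementsTensorHom A).app X) :=
    (congrArg (fun t => IsIso t) (elementsTensorHom_app A X)).mpr (isIso_copiesToTensor _ _)
  exact NatIso.isIso_of_isIso_app _

variable (k q) in
/-- The left adjoint `j_!` of the restriction along `j`. -/
def jShriek : FunCat SimplexCategoryᵒᵖ k ⥤ FunCat (Lambda q) k :=
  pull (jLift q).inv ⋙ elementsSum k (points q)

instance : (jShriek k q).Additive := inferInstanceAs (_ ⋙ _).Additive
instance : PreservesFiniteLimits (jShriek k q) := comp_preservesFiniteLimits _ _
instance : PreservesFiniteColimits (jShriek k q) := comp_preservesFiniteColimits _ _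

/-- The adjunction between the restriction functors along the equivalence `jLift`. -/
def jLiftAdj : pull (k := k) (jLift q).inv ⊣ pull (k := k) (jLift q) :=
  (jLift q).asEquivalence.toAdjunction.whiskerLeft (ModuleCat.{u} k)

theorem isIso_jLiftAdj_counit_app (B : FunCat (points q).Elements k) :
    IsIso (jLiftAdj.counit.app B) := by
  have (x : (points q).Elements) : IsIso ((jLiftAdj.counit.app B).app x) :=
    inferInstanceAs (IsIso (B.map ((jLift q).asEquivalence.counitIso.hom.app x)))
  exact NatIso.isIso_of_isIso_app _

/-- The adjunction `j_! ⊣ j^*`. -/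
def jShriekAdj : jShriek k q ⊣ pull (j q) := jLiftAdj.comp elementsSumAdj

/-- The map `x ↦ x ⊗ v_0`. -/
def vertex (A : FunCat (Lambda q) k) :
    (pull (j q)).obj A ⟶ (pull (j q)).obj (A ⊗ pointFun k q) :=
  (pull (jLift q)).map (elementsVertex A)

/-- The isomorphism `j_! j^* A ≅ A ⊗ j_! k`. -/
def jShriekIso (A : FunCat (Lambda q) k) :
    (jShriek k q).obj ((pull (j q)).obj A) ≅ A ⊗ pointFun k q :=
  (elementsSum k (points q)).mapIso
    (@asIso _ _ _ _ _ (isIso_jLiftAdj_counit_app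
      ((pull (CategoryOfElements.π (points q))).obj A))) ≪≫
    asIso (elementsTensorHom A)

theorem jShriekAdj_unit_comp_jShriekIso (A : FunCat (Lambda q) k) :
    jShriekAdj.unit.app ((pull (j q)).obj A) ≫ (pull (j q)).map (jShriekIso A).hom = vertex A := by
  let B := (pull (CategoryOfElements.π (points q))).obj A
  have elements_transpose : elementsSumAdj.homEquiv _ _
      ((elementsSum k (points q)).map (jLiftAdj.counit.app B) ≫ elementsTensorHom A) =
      jLiftAdj.counit.app B ≫ elementsVertex A := by
    rw [Adjunction.homEquiv_naturality_left]
    exact whisker_eq _ (Equiv.apply_symm_apply _ _)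
  have lift_transpose :
      jLiftAdj.homEquiv _ _ (jLiftAdj.counit.app B ≫ elementsVertex A) = vertex A := by
    rw [Adjunction.homEquiv_naturality_right]
    refine (eq_whisker (?_ : _ = 𝟙 _) _).trans (Category.id_comp _)
    exact (jLiftAdj.homEquiv_unit _ _ _).trans (jLiftAdj.right_triangle_components B)
  refine Eq.trans ?_ ((congrArg (jLiftAdj.homEquiv _ _) elements_transpose).trans lift_transpose)
  refine (jShriekAdj.homEquiv_unit _ _ _).symm.trans ?_
  exact congrFun (congrArg DFunLike.coe (congrFun (congrFun
    (Adjunction.comp_homEquiv jLiftAdj (elementsSumAdj (k := k) (Φ := points q))) _) _)) _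

/-- The comparison map `Ext(A ⊗ j_! k, B) → Ext(j^* A, j^* B)`. -/
def extVertex {A B : FunCat (Lambda q) k} {n : ℕ} (y : Ext (A ⊗ pointFun k q) B n) :
    Ext ((pull (j q)).obj A) ((pull (j q)).obj B) n :=
  (Ext.mk₀ (vertex A)).comp (y.mapExactFunctor (pull (j q))) (zero_add n)

theorem extVertex_bijective (A B : FunCat (Lambda q) k) (n : ℕ) :
    Function.Bijective (extVertex (A := A) (B := B) (n := n)) := by
  have extVertex_eq : extVertex (A := A) (B := B) (n := n) = extAdjEquiv jShriekAdj _ B n ∘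
      fun y => (Ext.mk₀ (jShriekIso A).hom).comp y (zero_add n) := by
    funext y
    dsimp only [extVertex, extAdjEquiv, Equiv.coe_fn_mk, Function.comp]
    rw [Ext.mapExactFunctor_comp, Ext.mapExactFunctor_mk₀, Ext.mk₀_comp_mk₀_assoc,
      jShriekAdj_unit_comp_jShriekIso]
  rw [extVertex_eq]
  refine (extAdjEquiv jShriekAdj _ B n).bijective.comp (Function.bijective_iff_has_inverse.2
    ⟨fun y => (Ext.mk₀ (jShriekIso A).inv).comp y (zero_add n), fun y => ?_, fun y => ?_⟩)
  · simp
  · simp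

end JShriek

section Vanishing
open Lambda

section General
universe v w
variable {C : Type w} [Category.{v} C] [Abelian C] [HasExt.{v} C]

theorem mk₀_hom_comp_mk₀_inv_comp {X Y Z : C} (e : X ≅ Y) {n : ℕ} (x : Ext X Z n) :
    (Ext.mk₀ e.hom).comp ((Ext.mk₀ e.inv).comp x (zero_add n)) (zero_add n) = x := by
  simp

theorem eq_zero_of_mk₀_hom_comp_eq_zero {X Y Z : C} (e : X ≅ Y) {n : ℕ} {y : Ext Y Z n}
    (h : (Ext.mk₀ e.hom).comp y (zero_add n) = 0) : y = 0 := by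
  rw [← mk₀_hom_comp_mk₀_inv_comp e.symm y]
  exact (congrArg (fun t => Ext.comp _ t _) h).trans (Ext.comp_zero _ _ _ _ _)

theorem ext_eq_zero_of_iso {X Y Z : C} (e : X ≅ Y) {n : ℕ} (h : ∀ y : Ext Y Z n, y = 0)
    (x : Ext X Z n) : x = 0 :=
  eq_zero_of_mk₀_hom_comp_eq_zero e.symm (h _)

theorem ext_eq_zero_of_shortExact {S : ShortComplex C} (hS : S.ShortExact)
    {Z : C} {n : ℕ} (y : Ext S.X₃ Z n)
    (hy : (Ext.mk₀ S.g).comp y (zero_add n) = 0)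
    (h : ∀ m, 1 + m = n → ∀ z : Ext S.X₁ Z m, z = 0) : y = 0 := by
  cases n with
  | zero =>
    obtain ⟨f, rfl⟩ := (Ext.mk₀_bijective _ _).2 y
    rw [Ext.mk₀_comp_mk₀, Ext.mk₀_eq_zero_iff] at hy
    have := hS.epi_g
    rw [(cancel_epi S.g).1 (hy.trans comp_zero.symm), Ext.mk₀_zero]
  | succ n =>
    obtain ⟨x, hx⟩ := Ext.contravariant_sequence_exact₃ hS Z y hy (add_comm 1 n)
    rw [← hx, h n (add_comm 1 n) x, Ext.comp_zero]

end General

variable {k : Type u} [Field k] {q : ℕ}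

theorem ext_tensor_pointFun_eq_zero {W : FunCat (Lambda q) k} {N : FunCat SimplexCategoryᵒᵖ k}
    (e : (pull (j q)).obj W ≅ fnFun k ⊗ N) (A : FunCat (Lambda q) k) {n : ℕ}
    (y : Ext ((A ⊗ W) ⊗ pointFun k q) (constFun (Lambda q) k) n) : y = 0 := by
  refine (extVertex_bijective _ _ _).1 (Eq.trans ?_ (?_ : extVertex 0 = 0).symm)
  · let e' : (pull (j q)).obj (A ⊗ W) ≅ fnFun k ⊗ (N ⊗ (pull (j q)).obj A) :=
      (β_ ((pull (j q)).obj A) ((pull (j q)).obj W)) ≪≫ whiskerRightIso e _ ≪≫ α_ _ _ _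
    exact ext_eq_zero_of_iso e' (fun z => ext_fnFun_tensor_eq_zero _ z) _
  · dsimp only [extVertex]
    exact (congrArg (fun t => Ext.comp _ t _) ((pull (j q)).mapExtAddHom _ _ n).map_zero).trans
      (Ext.comp_zero _ _ _ _ _)

theorem ext_tensor_eq_zero [NeZero q] {W : FunCat (Lambda q) k} {N : FunCat SimplexCategoryᵒᵖ k}
    (e : (pull (j q)).obj W ≅ fnFun k ⊗ N) (A : FunCat (Lambda q) k) {n : ℕ}
    (y : Ext (A ⊗ W) (constFun (Lambda q) k) n) : y = 0 := by
  induction n using Nat.strong_induction_on generalizing A with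
  | _ n ih =>
  have right_exact := (rightSeq_shortExact k q).map_of_exact (tensorLeft (A ⊗ W))
  have left_exact := (leftSeq_shortExact k q).map_of_exact (tensorLeft (A ⊗ W))
  refine ext_eq_zero_of_iso (unitorIso (A ⊗ W)).symm (fun y => ?_) y
  refine ext_eq_zero_of_shortExact right_exact y (ext_tensor_pointFun_eq_zero e A _)
    fun m hm z => ?_
  let e' : (A ⊗ W) ⊗ edgeFun k q ≅ (A ⊗ edgeFun k q) ⊗ W :=
    α_ _ _ _ ≪≫ whiskerLeftIso A (β_ W (edgeFun k q)) ≪≫ (α_ _ _ _).symm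
  refine ext_eq_zero_of_shortExact left_exact z
    (ext_eq_zero_of_iso e' (fun t => ih m (by omega) _ t) _) fun l hlm w => ?_
  exact ext_eq_zero_of_iso (unitorIso (A ⊗ W)) (fun t => ih l (by omega) _ t) w

end Vanishing

section EdgeFun
open Lambda
variable (k : Type u) [Field k] (q : ℕ)

/-- The map `g ⊗ c ↦ ∑ g(r) e_{cs + r}`. -/
def fnToEdge (s : ℕ) :
    TensorProduct k (Fin (s + 1) → k) (ZMod q →₀ k) →ₗ[k] (ZMod (q * (s + 1)) →₀ k) :=
  TensorProduct.lift (LinearMap.flip (Finsupp.linearCombination k fun c : ZMod q =>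
    Fintype.linearCombination k fun r : Fin (s + 1) =>
      (Finsupp.single (((c.cast : ℤ) * (s + 1) + (r : ℕ) : ℤ) : ZMod (q * (s + 1))) (1 : k))))

variable {k q}

theorem fnToEdge_tmul (s : ℕ) (g : Fin (s + 1) → k) (c : ZMod q) :
    fnToEdge k q s (g ⊗ₜ Finsupp.single c 1) = ∑ r, g r • Finsupp.single
      (((c.cast : ℤ) * (s + 1) + (r : ℕ) : ℤ) : ZMod (q * (s + 1))) (1 : k) := by
  simp [fnToEdge, Fintype.linearCombination_apply]

theorem fnToEdge_single_tmul (s : ℕ) (r : Fin (s + 1)) (c : ℤ) :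
    fnToEdge k q s ((Pi.single r 1 : Fin (s + 1) → k) ⊗ₜ Finsupp.single (c : ZMod q) 1) =
      Finsupp.single ((c * (s + 1) + (r : ℕ) : ℤ) : ZMod (q * (s + 1))) 1 := by
  rw [fnToEdge_tmul, Finset.sum_eq_single r]
  · obtain ⟨d, hd⟩ := exists_cast_eq q c
    rw [Pi.single_eq_same, one_smul, hd]
    congr 1
    rw [ZMod.intCast_eq_intCast_iff_dvd_sub]
    exact ⟨-d, by push_cast; ring⟩
  · intro r' _ hr'
    rw [Pi.single_eq_of_ne hr', zero_smul]
  · simp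

theorem fnToEdge_surjective (s : ℕ) : Function.Surjective (fnToEdge k q s) := by
  rw [← LinearMap.range_eq_top, eq_top_iff]
  intro f _
  induction f using Finsupp.induction_linear with
  | zero => exact zero_mem _
  | add f g hf hg => exact add_mem (hf trivial) (hg trivial)
  | single y b =>
    obtain ⟨a, rfl⟩ := ZMod.intCast_surjective y
    obtain ⟨c, r, rfl⟩ := exists_rep (SimplexCategory.mk s) a
    rw [← Finsupp.smul_single_one]
    exact Submodule.smul_mem _ _ ⟨_, fnToEdge_single_tmul s r c⟩

theorem fnToEdge_bijective [NeZero q] (s : ℕ) : Function.Bijective (fnToEdge k q s) := by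
  refine ⟨(LinearMap.injective_iff_surjective_of_finrank_eq_finrank ?_).2
    (fnToEdge_surjective s), fnToEdge_surjective s⟩
  have : NeZero (q * (s + 1)) := ⟨mul_ne_zero (NeZero.ne q) (by omega)⟩
  rw [Module.finrank_tensorProduct, Module.finrank_fintype_fun_eq_card, Module.finrank_finsupp_self,
    Module.finrank_finsupp_self, Fintype.card_fin, ZMod.card, ZMod.card, mul_comm]

theorem mem_Ico_dualFun_iff {S T : SimplexCategory} (φ : S ⟶ T) (b y : ℤ) :
    y ∈ Finset.Ico (dualFun φ b) (dualFun φ (b + 1)) ↔ periodicExt φ y = b := by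
  rw [Finset.mem_Ico, ← not_le, dualFun_gc, dualFun_gc]
  omega

theorem periodicExt_eq_iff {S T : SimplexCategory} (φ : S ⟶ T) (c : ℤ) (r : Fin (T.len + 1))
    (y : ℤ) : periodicExt φ y = c * (T.len + 1) + (r : ℕ) ↔
      ∃ r' : Fin (S.len + 1), φ.toOrderHom r' = r ∧ c * (S.len + 1) + (r' : ℕ) = y := by
  constructor
  · intro hy
    obtain ⟨c', r', rfl⟩ := exists_rep S y
    rw [periodicExt_apply] at hy
    have hr' : ((φ.toOrderHom r' : ℕ) : ℤ) < T.len + 1 := by exact_mod_cast (φ.toOrderHom r').2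
    have hr : ((r : ℕ) : ℤ) < T.len + 1 := by exact_mod_cast r.2
    have hc : c' = c := by
      rcases lt_trichotomy c' c with h | h | h
      · nlinarith
      · exact h
      · nlinarith
    subst hc
    exact ⟨r', Fin.ext (by omega), rfl⟩
  · rintro ⟨r', rfl, rfl⟩
    exact periodicExt_apply φ c r'

theorem edgeMap_dualHom {S T : SimplexCategory} (φ : S ⟶ T) (c : ℤ) (r : Fin (T.len + 1)) :
    edgeMap (k := k) q (dualHom φ)
      (Finsupp.single ((c * (T.len + 1) + (r : ℕ) : ℤ) : ZMod (q * simplexCard T)) 1) =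
    ∑ r' with φ.toOrderHom r' = r,
      Finsupp.single ((c * (S.len + 1) + (r' : ℕ) : ℤ) : ZMod (q * simplexCard S)) 1 := by
  rw [edgeMap_single, path]
  symm
  refine Finset.sum_bij (fun r' _ => c * (S.len + 1) + (r' : ℕ)) ?_ ?_ ?_ fun r' _ => rfl
  · exact fun r' hr' => (mem_Ico_dualFun_iff _ _ _).2 ((periodicExt_eq_iff φ c r _).2
      ⟨r', (Finset.mem_filter.1 hr').2, rfl⟩)
  · exact fun a _ b _ h => Fin.ext (by omega)
  · intro b hb
    obtain ⟨r', hr', rfl⟩ := (periodicExt_eq_iff φ c r b).1 ((mem_Ico_dualFun_iff _ _ _).1 hb)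
    exact ⟨r', Finset.mem_filter.2 ⟨Finset.mem_univ _, hr'⟩, rfl⟩

theorem edgeMap_dualHom_sum {S T : SimplexCategory} (φ : S ⟶ T) (c : ℤ)
    (g : Fin (T.len + 1) → k) :
    edgeMap (k := k) q (dualHom φ) (∑ r, g r •
      Finsupp.single ((c * (T.len + 1) + (r : ℕ) : ℤ) : ZMod (q * simplexCard T)) 1) =
    ∑ r, g (φ.toOrderHom r) •
      Finsupp.single ((c * (S.len + 1) + (r : ℕ) : ℤ) : ZMod (q * simplexCard S)) 1 := by
  rw [map_sum, ← Finset.sum_fiberwise (g := φ.toOrderHom)]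
  refine Finset.sum_congr rfl fun r _ => ?_
  rw [map_smul, edgeMap_dualHom, Finset.smul_sum]
  refine Finset.sum_congr rfl fun r' hr' => ?_
  rw [(Finset.mem_filter.1 hr').2]

variable (k q) in
/-- The natural map from the functions with values in `k[ℤ/q]` to the edges. -/
def fnToEdgeHom : fnFun k ⊗ (Functor.const _).obj (ModuleCat.of k (ZMod q →₀ k)) ⟶
    (pull (j q)).obj (edgeFun k q) where
  app S := ModuleCat.ofHom (fnToEdge k q S.unop.len)
  naturality T S φ := by
    refine ModuleCat.hom_ext (TensorProduct.ext (LinearMap.ext fun g : Fin (T.unop.len + 1) → k =>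
      Finsupp.lhom_ext' fun c => LinearMap.ext_ring ?_))
    refine (fnToEdge_tmul S.unop.len (fun r => g (φ.unop.toOrderHom r)) c).trans ?_
    refine Eq.trans ?_ (congrArg (edgeMap q (dualHom φ.unop)) (fnToEdge_tmul T.unop.len g c)).symm
    exact (edgeMap_dualHom_sum φ.unop c.cast g).symm

instance [NeZero q] : IsIso (fnToEdgeHom k q) := by
  have (S : SimplexCategoryᵒᵖ) : IsIso ((fnToEdgeHom k q).app S) :=
    (ConcreteCategory.isIso_iff_bijective _).2 (fnToEdge_bijective S.unop.len)
  exact NatIso.isIso_of_isIso_app _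

theorem ext_tensor_edgeFun_eq_zero [NeZero q] (A : FunCat (Lambda q) k) {n : ℕ}
    (y : Ext (A ⊗ edgeFun k q) (constFun (Lambda q) k) n) : y = 0 :=
  ext_tensor_eq_zero (asIso (fnToEdgeHom k q)).symm A y

theorem ext_tensor_pull_edgeFun_eq_zero [NeZero q] (A : FunCat (Lambda q) k) {n : ℕ}
    (y : Ext (A ⊗ (pull (proj q)).obj (edgeFun k 1)) (constFun (Lambda q) k) n) : y = 0 :=
  ext_tensor_eq_zero (W := (pull (proj q)).obj (edgeFun k 1)) (asIso (fnToEdgeHom k 1)).symm A y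

end EdgeFun

/-! ### The comparison along `π` -/

section Reduction
open Lambda
variable {k : Type u} [Field k]

/-- The map of chains induced by the reduction `ℤ/N → ℤ/M`. -/
def reduce (k : Type u) [Field k] {N M : ℕ} (h : M ∣ N) : (ZMod N →₀ k) →ₗ[k] (ZMod M →₀ k) :=
  Finsupp.lmapDomain k k (ZMod.castHom h (ZMod M))

theorem reduce_single {N M : ℕ} (h : M ∣ N) (a : ℤ) :
    reduce k h (Finsupp.single (a : ZMod N) 1) = Finsupp.single (a : ZMod M) 1 := by
  rw [reduce, Finsupp.lmapDomain_apply, Finsupp.mapDomain_single, map_intCast]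

theorem reduce_path {N M : ℕ} (h : M ∣ N) (a b : ℤ) :
    reduce k h (path k N a b) = path k M a b := by
  simp_rw [path, map_sum, reduce_single]

theorem path_mul (N c : ℕ) : path k N 0 (c * N : ℕ) = (c : k) • path k N 0 N := by
  induction c with
  | zero => simp [path]
  | succ c ih =>
    rw [← path_add N (b := (c * N : ℕ)) (by positivity) (by push_cast; nlinarith), ih]
    have last_period := path_period (k := k) N (c * N : ℕ)
    rw [show (((c + 1) * N : ℕ) : ℤ) = (c * N : ℕ) + N by push_cast; ring, last_period,
      Nat.cast_add_one, add_smul, one_smul]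

theorem one_mul_dvd (p n : ℕ) : 1 * n ∣ p * n := by rw [one_mul]; exact dvd_mul_left _ _

theorem augm_reduce {N M : ℕ} (h : M ∣ N) (a : ℤ) :
    augm k M (reduce k h (Finsupp.single (a : ZMod N) 1)) =
      augm k N (Finsupp.single (a : ZMod N) 1) := by
  rw [reduce_single, augm_single, augm_single]

theorem bdry_reduce {N M : ℕ} (h : M ∣ N) (a : ℤ) :
    bdry k M (reduce k h (Finsupp.single (a : ZMod N) 1)) =
      reduce k h (bdry k N (Finsupp.single (a : ZMod N) 1)) := by
  rw [reduce_single, ← path_succ, ← path_succ, bdry_path _ (by omega), bdry_path _ (by omega),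
    map_sub, reduce_single, reduce_single]

theorem reduce_fund (p n : ℕ) (hp : (p : k) = 0) :
    reduce k (one_mul_dvd p n) (fund k (p * n) 1) = 0 := by
  have wound_path : path k (1 * n) 0 (p * (1 * n) : ℕ) = 0 := by
    rw [path_mul, hp, zero_smul]
  rw [fund_apply, one_smul, reduce_path, ← wound_path]
  simp only [one_mul, Nat.cast_mul]

theorem mk₀_comp_extClass_eq_zero {C : Type*} [Category* C] [Abelian C] [HasExt C]
    {S₁ S₂ : ShortComplex C} (h₁ : S₁.ShortExact) (h₂ : S₂.ShortExact) (f : S₁ ⟶ S₂)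
    (hf : f.τ₁ = 0) : (Ext.mk₀ f.τ₃).comp h₂.extClass (zero_add 1) = 0 := by
  rw [← ShortComplex.ShortExact.extClass_naturality h₁ h₂ f, hf, Ext.mk₀_zero, Ext.comp_zero]

variable (k) (p : ℕ)

/-- The map on marked points given by the reductions `ℤ/pn → ℤ/n`. -/
def pointReduce : pointFun k p ⟶ (pull (proj p)).obj (pointFun k 1) where
  app X := ModuleCat.ofHom (reduce k (one_mul_dvd p X.card))
  naturality := by
    rintro X Y ⟨f⟩
    refine ModuleCat.hom_ext (finsupp_ext _ fun a => ?_)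
    change reduce k _ (pointMap p f _) = pointMap 1 f (reduce k _ _)
    rw [pointMap_single, reduce_single, reduce_single]
    exact (pointMap_single 1 f a).symm

/-- The map on edges given by the reductions `ℤ/pn → ℤ/n`. -/
def edgeReduce : edgeFun k p ⟶ (pull (proj p)).obj (edgeFun k 1) where
  app X := ModuleCat.ofHom (reduce k (one_mul_dvd p X.card))
  naturality := by
    rintro X Y ⟨f⟩
    refine ModuleCat.hom_ext (finsupp_ext _ fun a => ?_)
    change reduce k _ (edgeMap p f _) = edgeMap 1 f (reduce k _ _)
    rw [edgeMap_single, reduce_single, reduce_path]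
    exact (edgeMap_single 1 f a).symm

theorem pointReduce_augmentation :
    pointReduce k p ≫ (pull (proj p)).map (augmentation k 1) = augmentation k p := by
  refine NatTrans.ext (funext fun X => ModuleCat.hom_ext (finsupp_ext _ fun a => ?_))
  exact augm_reduce (k := k) (one_mul_dvd p X.card) a

theorem edgeReduce_boundaryMap :
    edgeReduce k p ≫ (pull (proj p)).map (boundaryMap k 1) = boundaryMap k p ≫ pointReduce k p := by
  refine NatTrans.ext (funext fun X => ModuleCat.hom_ext (finsupp_ext _ fun a => ?_))
  exact bdry_reduce (one_mul_dvd p X.card) a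

variable {p} in
theorem fundamentalCycle_edgeReduce (hp : (p : k) = 0) :
    fundamentalCycle k p ≫ edgeReduce k p = 0 :=
  NatTrans.ext (funext fun X => ModuleCat.hom_ext (LinearMap.ext_ring (reduce_fund p X.card hp)))

/-- The map on cycles induced by `pointReduce`. -/
def cycleReduce : kernel (augmentation k p) ⟶ (pull (proj p)).obj (kernel (augmentation k 1)) :=
  have := ((rightSeq_shortExact k 1).map_of_exact (pull (proj p))).mono_f
  ((rightSeq_shortExact k 1).map_of_exact (pull (proj p))).exact.lift
    (kernel.ι (augmentation k p) ≫ pointReduce k p) (by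
      refine (Category.assoc _ _ _).trans ?_
      exact (whisker_eq _ (pointReduce_augmentation k p)).trans (kernel.condition _))

theorem cycleReduce_ι : cycleReduce k p ≫ (pull (proj p)).map (kernel.ι (augmentation k 1)) =
    kernel.ι (augmentation k p) ≫ pointReduce k p :=
  have := ((rightSeq_shortExact k 1).map_of_exact (pull (proj p))).mono_f
  ((rightSeq_shortExact k 1).map_of_exact (pull (proj p))).exact.lift_f _ _

/-- The map on the sequences `0 ⟶ Z ⟶ j_! k ⟶ k ⟶ 0` induced by `pointReduce`. -/
def rightSeqReduce : rightSeq k p ⟶ (rightSeq k 1).map (pull (proj p)) where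
  τ₁ := cycleReduce k p
  τ₂ := pointReduce k p
  τ₃ := 𝟙 (constFun (Lambda p) k)
  comm₁₂ := cycleReduce_ι k p
  comm₂₃ := (pointReduce_augmentation k p).trans (Category.comp_id _).symm

/-- The map on the sequences `0 ⟶ k ⟶ j_* k ⟶ Z ⟶ 0` induced by `edgeReduce`. The circle with `pn`
marked points winds `p` times around the one with `n` marked points, so it is `p = 0` on the left
term. -/
def leftSeqReduce [NeZero p] (hp : (p : k) = 0) :
    leftSeq k p ⟶ (leftSeq k 1).map (pull (proj p)) where
  τ₁ := 0
  τ₂ := edgeReduce k p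
  τ₃ := cycleReduce k p
  comm₁₂ := zero_comp.trans (fundamentalCycle_edgeReduce k hp).symm
  comm₂₃ := by
    have := ((rightSeq_shortExact k 1).map_of_exact (pull (proj p))).mono_f
    refine (cancel_mono ((rightSeq k 1).map (pull (proj p))).f).1 ?_
    have g_ι (q : ℕ) [NeZero q] : (leftSeq k q).g ≫ kernel.ι (augmentation k q) =
        boundaryMap k q := kernel.lift_ι _ _ _
    have pull_g_ι :=
      ((pull (proj p)).map_comp _ _).symm.trans (congrArg (pull (proj p)).map (g_ι 1))
    refine (Category.assoc _ _ _).trans ((whisker_eq _ pull_g_ι).trans ?_)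
    refine (edgeReduce_boundaryMap k p).trans ?_
    refine Eq.trans ?_ (Category.assoc _ _ _).symm
    refine Eq.trans ?_ (whisker_eq _ (cycleReduce_ι k p)).symm
    exact (eq_whisker (g_ι p) _).symm.trans (Category.assoc _ _ _)

variable {k p}

theorem extVertex_pull (E : FunCat (Lambda 1) k) {n : ℕ}
    (z : Ext (E ⊗ pointFun k 1) (constFun (Lambda 1) k) n) :
    extVertex (A := (pull (proj p)).obj E) (B := constFun (Lambda p) k)
      ((Ext.mk₀ ((tensorLeft ((pull (proj p)).obj E)).map (pointReduce k p))).comp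
        (z.mapExactFunctor (pull (proj p))) (zero_add n)) = extVertex z := by
  dsimp only [extVertex]
  refine (congrArg (fun t => (Ext.mk₀ (vertex _)).comp t (zero_add n))
    (Ext.mapExactFunctor_comp (pull (j p)) _ _ _)).trans ?_
  rw [Ext.mapExactFunctor_mk₀]
  refine (Ext.mk₀_comp_mk₀_assoc _ _ _).trans ?_
  refine congrArg₂ (fun f t => (Ext.mk₀ f).comp t (zero_add n)) ?_
    (mapExactFunctor_functorComp (pull (proj p)) (pull (j p)) z).symm
  refine NatTrans.ext (funext fun S => ModuleCat.hom_ext (LinearMap.ext fun x => ?_))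
  have reduce_origin := reduce_single (k := k) (one_mul_dvd p (simplexCard S.unop)) 0
  rw [Int.cast_zero, Int.cast_zero] at reduce_origin
  exact congrArg (fun t : ZMod (1 * (simplexCard S.unop : ℕ)) →₀ k =>
    TensorProduct.tmul k (M := E.obj ((j 1).obj S)) x t) reduce_origin

theorem exists_pointReduce_comp_pull_eq (E : FunCat (Lambda 1) k) {n : ℕ}
    (y : Ext ((pull (proj p)).obj E ⊗ pointFun k p) (constFun (Lambda p) k) n) :
    ∃ z : Ext (E ⊗ pointFun k 1) (constFun (Lambda 1) k) n,
      (Ext.mk₀ ((tensorLeft ((pull (proj p)).obj E)).map (pointReduce k p))).comp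
        (z.mapExactFunctor (pull (proj p))) (zero_add n) = y := by
  obtain ⟨z, hz⟩ := (extVertex_bijective E (constFun (Lambda 1) k) n).2
    (extVertex (A := (pull (proj p)).obj E) y)
  exact ⟨z, (extVertex_bijective _ _ _).1 ((extVertex_pull (p := p) E z).trans hz)⟩

theorem cycleReduce_comp_eq_zero [NeZero p] (hp : (p : k) = 0) (A : FunCat (Lambda p) k) {n : ℕ}
    (w : Ext (A ⊗ (pull (proj p)).obj (kernel (augmentation k 1))) (constFun (Lambda p) k) n) :
    (Ext.mk₀ ((tensorLeft A).map (cycleReduce k p))).comp w (zero_add n) = 0 := by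
  have exact_pull :=
    ((leftSeq_shortExact k 1).map_of_exact (pull (proj p))).map_of_exact (tensorLeft A)
  have restrict_eq_zero :
      (Ext.mk₀ (((leftSeq k 1).map (pull (proj p))).map (tensorLeft A)).g).comp w
        (zero_add n) = 0 :=
    ext_tensor_pull_edgeFun_eq_zero A _
  cases n with
  | zero =>
    have : w = 0 :=
      ext_eq_zero_of_shortExact exact_pull w restrict_eq_zero fun m hm => by omega
    rw [this, Ext.comp_zero]
  | succ n =>
    obtain ⟨v, rfl⟩ :=
      Ext.contravariant_sequence_exact₃ exact_pull _ w restrict_eq_zero (add_comm 1 n)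
    have comp_class := mk₀_comp_extClass_eq_zero
      ((leftSeq_shortExact k p).map_of_exact (tensorLeft A)) exact_pull
      ((tensorLeft A).mapShortComplex.map (leftSeqReduce k p hp)) ((tensorLeft A).map_zero _ _)
    refine (Ext.comp_assoc _ _ _ (zero_add 1) (add_comm 1 n) (by omega)).symm.trans ?_
    exact (congrArg (fun t => Ext.comp t v (add_comm 1 n)) comp_class).trans
      (Ext.zero_comp _ _ _ _ _)

theorem kernel_ι_comp_eq_zero [NeZero p] (hp : (p : k) = 0) (E : FunCat (Lambda 1) k) {n : ℕ}
    (y : Ext ((pull (proj p)).obj E ⊗ pointFun k p) (constFun (Lambda p) k) n) :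
    (Ext.mk₀ ((tensorLeft ((pull (proj p)).obj E)).map (kernel.ι (augmentation k p)))).comp y
      (zero_add n) = 0 := by
  obtain ⟨z, rfl⟩ := exists_pointReduce_comp_pull_eq E y
  let A := (pull (proj p)).obj E
  have cycleReduce_natural :
      (tensorLeft A).map (kernel.ι (augmentation k p)) ≫ (tensorLeft A).map (pointReduce k p) =
      (tensorLeft A).map (cycleReduce k p) ≫
        (tensorLeft A).map ((pull (proj p)).map (kernel.ι (augmentation k 1))) := by
    rw [← Functor.map_comp, ← Functor.map_comp, cycleReduce_ι]
  refine (Ext.mk₀_comp_mk₀_assoc _ _ _).trans ?_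
  refine (congrArg (fun t => Ext.comp (Ext.mk₀ t) (z.mapExactFunctor (pull (proj p)))
    (zero_add n)) cycleReduce_natural).trans ?_
  refine (Ext.mk₀_comp_mk₀_assoc _ _ _).symm.trans ?_
  exact cycleReduce_comp_eq_zero hp A _

end Reduction

section Restriction
open Lambda
variable {k : Type u} [Field k] {q : ℕ}

theorem ext_pointFun_eq_zero {n : ℕ} (y : Ext (pointFun k q) (constFun (Lambda q) k) (n + 1)) :
    y = 0 := by
  refine ext_eq_zero_of_iso (λ_ (pointFun k q)).symm (fun z => ?_) y
  refine (extVertex_bijective (constFun (Lambda q) k) _ _).1 ?_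
  exact (ext_pull_cons_eq_zero (constFun MinSimplexᵒᵖ k) _).trans
    (ext_pull_cons_eq_zero (constFun MinSimplexᵒᵖ k) _).symm

theorem ext_edgeFun_eq_zero [NeZero q] {n : ℕ} (y : Ext (edgeFun k q) (constFun (Lambda q) k) n) :
    y = 0 :=
  ext_eq_zero_of_iso (λ_ (edgeFun k q)).symm (fun z => ext_tensor_edgeFun_eq_zero (𝟙_ _) z) y

variable (k q) in
/-- The class of `0 ⟶ Z ⟶ j_! k ⟶ k ⟶ 0`. -/
def rightClass : Ext (constFun (Lambda q) k) (kernel (augmentation k q)) 1 :=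
  (rightSeq_shortExact k q).extClass

variable (k q) in
/-- The class of `0 ⟶ k ⟶ j_* k ⟶ Z ⟶ 0`. -/
def leftClass [NeZero q] : Ext (kernel (augmentation k q)) (constFun (Lambda q) k) 1 :=
  (leftSeq_shortExact k q).extClass

theorem exists_rightClass_comp_leftClass_comp_eq [NeZero q] (x : Coh (Lambda q) k 2) :
    ∃ c : Ext (constFun (Lambda q) k) (constFun (Lambda q) k) 0,
      (rightClass k q).comp ((leftClass k q).comp c (add_zero 1)) rfl = x := by
  obtain ⟨w, rfl⟩ := Ext.contravariant_sequence_exact₃ (rightSeq_shortExact k q) _ x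
    (ext_pointFun_eq_zero _) (rfl : 1 + 1 = 2)
  obtain ⟨c, rfl⟩ := Ext.contravariant_sequence_exact₃ (leftSeq_shortExact k q) _ w
    (ext_edgeFun_eq_zero _) (add_zero 1)
  exact ⟨c, rfl⟩

theorem pull_rightClass_comp_leftClass_eq_zero {p : ℕ} [NeZero p] (hp : (p : k) = 0) :
    ((rightClass k 1).mapExactFunctor (pull (proj p))).comp
      ((leftClass k 1).mapExactFunctor (pull (proj p))) rfl = 0 := by
  have right_factor : (rightClass k 1).mapExactFunctor (pull (proj p)) =
      (rightClass k p).comp (Ext.mk₀ (cycleReduce k p)) (add_zero 1) :=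
    (Ext.mapExactFunctor_extClass _ _).trans ((Ext.mk₀_id_comp _).symm.trans
      (ShortComplex.ShortExact.extClass_naturality (rightSeq_shortExact k p)
        ((rightSeq_shortExact k 1).map_of_exact (pull (proj p))) (rightSeqReduce k p)).symm)
  have pull_leftClass : (leftClass k 1).mapExactFunctor (pull (proj p)) =
      ((leftSeq_shortExact k 1).map_of_exact (pull (proj p))).extClass :=
    Ext.mapExactFunctor_extClass _ _
  have left_vanishes : (Ext.mk₀ (cycleReduce k p)).comp
      ((leftClass k 1).mapExactFunctor (pull (proj p))) (zero_add 1) = 0 := by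
    rw [pull_leftClass]
    exact mk₀_comp_extClass_eq_zero (leftSeq_shortExact k p)
      ((leftSeq_shortExact k 1).map_of_exact (pull (proj p))) (leftSeqReduce k p hp) rfl
  rw [right_factor]
  refine (Ext.comp_assoc_of_second_deg_zero _ _ _ _).trans ?_
  exact (congrArg (fun t => Ext.comp _ t _) left_vanishes).trans (Ext.comp_zero _ _ _ _ _)

theorem cohPull_proj_eq_zero {p : ℕ} [NeZero p] (hp : (p : k) = 0) (x : Coh (Lambda 1) k 2) :
    cohPull k (proj p) 2 x = 0 := by
  obtain ⟨c, rfl⟩ := exists_rightClass_comp_leftClass_comp_eq x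
  change Ext.mapExactFunctor (pull (proj p)) _ = 0
  rw [Ext.mapExactFunctor_comp, Ext.mapExactFunctor_comp]
  refine (Ext.comp_assoc_of_third_deg_zero _ _ _ _).symm.trans ?_
  exact (congrArg (fun t => Ext.comp t _ _) (pull_rightClass_comp_leftClass_eq_zero hp)).trans
    (Ext.zero_comp _ _ _ _ _)

end Restriction

/-! ### The Gysin sequence -/

section Gysin
open Lambda
variable {k : Type u} [Field k] {p : ℕ}

/-- The map `A ⊗ j_! k ⟶ A` given by the augmentation of `j_! k`. -/
def tensorAug (A : FunCat (Lambda p) k) : A ⊗ pointFun k p ⟶ A :=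
  (tensorLeft A).map (augmentation k p) ≫ (unitorIso A).hom

theorem tensorAug_comp_unitorIso_inv (A : FunCat (Lambda p) k) :
    tensorAug A ≫ (unitorIso A).inv = (tensorLeft A).map (augmentation k p) := by
  simp [tensorAug]

theorem mk₀_tensorAug_comp (A : FunCat (Lambda p) k) {B : FunCat (Lambda p) k} {n : ℕ}
    (y : Ext A B n) :
    (Ext.mk₀ (tensorAug A)).comp y (zero_add n) =
      (Ext.mk₀ ((tensorLeft A).map (augmentation k p))).comp
        ((Ext.mk₀ (unitorIso A).hom).comp y (zero_add n)) (zero_add n) :=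
  (Ext.mk₀_comp_mk₀_assoc _ _ _).symm

theorem tensor_rightSeq_shortExact (A : FunCat (Lambda p) k) :
    ((rightSeq k p).map (tensorLeft A)).ShortExact :=
  (rightSeq_shortExact k p).map_of_exact (tensorLeft A)

/-- The connecting class in `Ext^1(A ⊗ k, A ⊗ Z)` of the sequence `0 ⟶ Z ⟶ j_! k ⟶ k ⟶ 0`
tensored with `A`. -/
def rightExt (A : FunCat (Lambda p) k) :
    Ext ((tensorLeft A).obj (constFun (Lambda p) k))
      ((tensorLeft A).obj (kernel (augmentation k p))) 1 :=
  (tensor_rightSeq_shortExact A).extClass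

variable [NeZero p]

theorem tensor_leftSeq_shortExact (A : FunCat (Lambda p) k) :
    ((leftSeq k p).map (tensorLeft A)).ShortExact :=
  (leftSeq_shortExact k p).map_of_exact (tensorLeft A)

/-- The connecting class in `Ext^1(A ⊗ Z, A ⊗ k)` of the sequence `0 ⟶ k ⟶ j_* k ⟶ Z ⟶ 0`
tensored with `A`. -/
def leftExt (A : FunCat (Lambda p) k) :
    Ext ((tensorLeft A).obj (kernel (augmentation k p)))
      ((tensorLeft A).obj (constFun (Lambda p) k)) 1 :=
  (tensor_leftSeq_shortExact A).extClass

/-- The class `A ⊗ u ∈ Ext^2(A, A)`. -/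
def periodicityExt (A : FunCat (Lambda p) k) : Ext A A 2 := tensorClass A (periodicityClass k p)

theorem periodicityExt_eq (A : FunCat (Lambda p) k) :
    periodicityExt A = (Ext.mk₀ (unitorIso A).inv).comp ((rightExt A).comp
      ((leftExt A).comp (Ext.mk₀ (unitorIso A).hom) (add_zero 1)) rfl) (zero_add 2) := by
  have tensor_class :
      (periodicityClass k p).mapExactFunctor (tensorLeft A) = (rightExt A).comp (leftExt A) rfl :=
    (Ext.mapExactFunctor_comp (tensorLeft A) (rightClass k p) (leftClass k p) rfl).trans
      (congrArg₂ (fun s t => Ext.comp s t rfl) (Ext.mapExactFunctor_extClass _ _)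
        (Ext.mapExactFunctor_extClass _ _))
  dsimp only [periodicityExt, tensorClass]
  rw [tensor_class]
  exact congrArg (fun t => Ext.comp _ t _) (Ext.comp_assoc_of_third_deg_zero _ _ _ _)

theorem periodicityExt_comp (A : FunCat (Lambda p) k) {B : FunCat (Lambda p) k} {n m : ℕ}
    (y : Ext A B n) (hm : 2 + n = m) :
    (periodicityExt A).comp y hm = (Ext.mk₀ (unitorIso A).inv).comp
      ((rightExt A).comp ((leftExt A).comp ((Ext.mk₀ (unitorIso A).hom).comp y (zero_add n))
        (rfl : 1 + n = 1 + n)) (by omega)) (zero_add m) := by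
  rw [periodicityExt_eq, Ext.comp_assoc _ _ _ (zero_add 2) hm (by omega),
    Ext.comp_assoc _ _ _ rfl (rfl : 1 + n = 1 + n) (by omega),
    Ext.comp_assoc _ _ _ (add_zero 1) (zero_add n) (by omega)]

theorem mk₀_tensorAug_comp_periodicityExt (A : FunCat (Lambda p) k) :
    (Ext.mk₀ (tensorAug A)).comp (periodicityExt A) rfl = 0 := by
  rw [periodicityExt_eq]
  refine (Ext.mk₀_comp_mk₀_assoc _ _ _).trans ?_
  rw [tensorAug_comp_unitorIso_inv]
  exact (tensor_rightSeq_shortExact A).comp_extClass_assoc _ _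

theorem eq_zero_of_leftExt_comp_eq_zero (A : FunCat (Lambda p) k) {n m : ℕ}
    (y : Ext ((tensorLeft A).obj (constFun (Lambda p) k)) (constFun (Lambda p) k) n)
    (hm : 1 + n = m) (h : (leftExt A).comp y hm = 0) : y = 0 := by
  obtain ⟨w, rfl⟩ := Ext.contravariant_sequence_exact₁ (tensor_leftSeq_shortExact A) _ y hm h
  exact (congrArg (fun t => Ext.comp _ t _) (ext_tensor_edgeFun_eq_zero A w)).trans
    (Ext.comp_zero _ _ _ _ _)

theorem exists_leftExt_comp_eq (A : FunCat (Lambda p) k) {n m : ℕ}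
    (w : Ext ((tensorLeft A).obj (kernel (augmentation k p))) (constFun (Lambda p) k) m)
    (hm : 1 + n = m) : ∃ y, (leftExt A).comp y hm = w :=
  Ext.contravariant_sequence_exact₃ (tensor_leftSeq_shortExact A) _ w
    (ext_tensor_edgeFun_eq_zero A _) hm

theorem exists_periodicityExt_comp_eq (A : FunCat (Lambda p) k) {n m : ℕ}
    (y : Ext A (constFun (Lambda p) k) m) (hm : 2 + n = m)
    (h : (Ext.mk₀ (tensorAug A)).comp y (zero_add m) = 0) :
    ∃ z : Ext A (constFun (Lambda p) k) n, (periodicityExt A).comp z hm = y := by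
  rw [mk₀_tensorAug_comp] at h
  have hm' : 1 + (1 + n) = m := by omega
  obtain ⟨w, hw⟩ := Ext.contravariant_sequence_exact₃ (tensor_rightSeq_shortExact A) _ _ h hm'
  obtain ⟨v, rfl⟩ := exists_leftExt_comp_eq A w rfl
  have rightExt_leftExt_comp : (rightExt A).comp ((leftExt A).comp v rfl) hm' =
    (Ext.mk₀ (unitorIso A).hom).comp y (zero_add m) := hw
  refine ⟨(Ext.mk₀ (unitorIso A).inv).comp v (zero_add n), ?_⟩
  rw [periodicityExt_comp, mk₀_hom_comp_mk₀_inv_comp, rightExt_leftExt_comp]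
  exact mk₀_hom_comp_mk₀_inv_comp (unitorIso A).symm y

theorem eq_zero_of_mk₀_tensorAug_comp_eq_zero (A : FunCat (Lambda p) k) {m : ℕ} (hm : m < 2)
    (y : Ext A (constFun (Lambda p) k) m)
    (h : (Ext.mk₀ (tensorAug A)).comp y (zero_add m) = 0) : y = 0 := by
  rw [mk₀_tensorAug_comp] at h
  refine eq_zero_of_mk₀_hom_comp_eq_zero (unitorIso A) ?_
  refine ext_eq_zero_of_shortExact (tensor_rightSeq_shortExact A) _ h fun l hl w => ?_
  exact ext_eq_zero_of_shortExact (tensor_leftSeq_shortExact A) w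
    (ext_tensor_edgeFun_eq_zero A _) fun l' hl' => by omega

theorem eq_zero_of_periodicityExt_comp_eq_zero (hp : (p : k) = 0) (E : FunCat (Lambda 1) k)
    {n m : ℕ} (y : Ext ((pull (proj p)).obj E) (constFun (Lambda p) k) n) (hm : 2 + n = m)
    (h : (periodicityExt ((pull (proj p)).obj E)).comp y hm = 0) : y = 0 := by
  rw [periodicityExt_comp] at h
  have rightExt_comp_eq_zero := eq_zero_of_mk₀_hom_comp_eq_zero (unitorIso _).symm h
  obtain ⟨w, hw⟩ := Ext.contravariant_sequence_exact₁ (tensor_rightSeq_shortExact _) _ _ _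
    rightExt_comp_eq_zero
  exact eq_zero_of_mk₀_hom_comp_eq_zero (unitorIso _)
    (eq_zero_of_leftExt_comp_eq_zero _ _ rfl (hw.symm.trans (kernel_ι_comp_eq_zero hp E w)))

theorem exists_mk₀_tensorAug_comp_eq (hp : (p : k) = 0) (E : FunCat (Lambda 1) k) {n : ℕ}
    (z : Ext ((pull (proj p)).obj E ⊗ pointFun k p) (constFun (Lambda p) k) n) :
    ∃ y : Ext ((pull (proj p)).obj E) (constFun (Lambda p) k) n,
      (Ext.mk₀ (tensorAug ((pull (proj p)).obj E))).comp y (zero_add n) = z := by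
  obtain ⟨w, hw⟩ := Ext.contravariant_sequence_exact₂
    (tensor_rightSeq_shortExact ((pull (proj p)).obj E)) _ z (kernel_ι_comp_eq_zero hp E z)
  refine ⟨(Ext.mk₀ (unitorIso _).inv).comp w (zero_add n), ?_⟩
  rw [mk₀_tensorAug_comp]
  exact (congrArg (fun t => Ext.comp _ t _) (mk₀_hom_comp_mk₀_inv_comp (unitorIso _) w)).trans hw

end Gysin

section GysinHomology
open Lambda
variable {k : Type u} [Field k] {p : ℕ}

theorem subsingleton_homologyOf {Γ : Type} [SmallCategory Γ] (E : FunCat Γ k) {n : ℤ}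
    (hn : n < 0) : Subsingleton (homologyOf E n) :=
  subsingleton_chains_homology E (by omega)

/-- The map `H_n(A ⊗ j_! k) ⟶ HC_n(A)` of the Gysin sequence. -/
def augHomology (A : FunCat (Lambda p) k) (n : ℤ) : homologyOf (A ⊗ pointFun k p) n ⟶ HC A n :=
  extAct (Ext.mk₀ (tensorAug A)) (-n) (-n) (by simp)

variable [NeZero p]

theorem augHomology_surjective_of_lt_two (A : FunCat (Lambda p) k) {n : ℤ} (hn : n < 2) :
    Function.Surjective (augHomology A n) := by
  rcases lt_or_ge n 0 with hn' | hn'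
  · have := subsingleton_homologyOf A hn'
    exact fun y => ⟨0, Subsingleton.elim (α := homologyOf _ _) _ _⟩
  · exact extAct_surjective (N' := n.toNat) (N := n.toNat) _ _ (by omega) (by omega) (by omega)
      fun y hy => eq_zero_of_mk₀_tensorAug_comp_eq_zero A (by omega) y hy

theorem augHomology_exact (A : FunCat (Lambda p) k) (n : ℤ) :
    Function.Exact (augHomology A n) (periodicity A n) := by
  rcases lt_or_ge n 2 with hn | hn
  · have := subsingleton_homologyOf A (n := n - 2) (by omega)
    exact fun y => ⟨fun _ => augHomology_surjective_of_lt_two A hn y,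
      fun _ => Subsingleton.elim (α := homologyOf A (n - 2)) _ _⟩
  · exact extAct_exact (N'' := (n - 2).toNat) (N' := n.toNat) (N := n.toNat)
      (Ext.mk₀ (tensorAug A)) (periodicityExt A) _ _ (by omega) (by omega) (by omega) (by omega)
      (by omega) (mk₀_tensorAug_comp_periodicityExt A)
      fun y hy => exists_periodicityExt_comp_eq A y _ hy

theorem periodicity_surjective (hp : (p : k) = 0) (E : FunCat (Lambda 1) k) (n : ℤ) :
    Function.Surjective (periodicity ((pull (proj p)).obj E) n) := by
  rcases lt_or_ge n 2 with hn | hn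
  · have := subsingleton_homologyOf ((pull (proj p)).obj E) (n := n - 2) (by omega)
    exact fun y => ⟨0, Subsingleton.elim (α := homologyOf _ _) _ _⟩
  · exact extAct_surjective (N' := (n - 2).toNat) (N := n.toNat)
      (periodicityExt ((pull (proj p)).obj E)) _ (by omega) (by omega) (by omega)
      fun y hy => eq_zero_of_periodicityExt_comp_eq_zero hp E y _ hy

theorem augHomology_injective (hp : (p : k) = 0) (E : FunCat (Lambda 1) k) (n : ℤ) :
    Function.Injective (augHomology ((pull (proj p)).obj E) n) := by
  rcases lt_or_ge n 0 with hn | hn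
  · have := subsingleton_homologyOf ((pull (proj p)).obj E ⊗ pointFun k p) hn
    exact Function.injective_of_subsingleton _
  · exact extAct_injective (N' := n.toNat) (N := n.toNat) _ _ (by omega) (by omega) (by omega)
      fun y => exists_mk₀_tensorAug_comp_eq hp E y

end GysinHomology

section LeftDerived
variable {C D : Type*} [Category* C] [Category* D] [HasZeroObject C] [HasZeroObject D]
  {ι ι' : Type*} {c : ComplexShape ι} {c' : ComplexShape ι'} [Preadditive C] [Preadditive D]

theorem nonempty_mapExtendIso (F : C ⥤ D) [F.Additive] (e : c.Embedding c') [e.IsRelIff]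
    (K : HomologicalComplex C c) :
    Nonempty ((F.mapHomologicalComplex c').obj (K.extend e) ≅
      ((F.mapHomologicalComplex c).obj K).extend e) := by
  let φ : ((F.mapHomologicalComplex c').obj (K.extend e)).restriction e ⟶
      (F.mapHomologicalComplex c).obj K :=
    { f := fun i => F.map (K.extendXIso e rfl).hom
      comm' := fun i j _ => by
        have extend_d : (K.extend e).d (e.f i) (e.f j) ≫ (K.extendXIso e rfl).hom =
            (K.extendXIso e rfl).hom ≫ K.d i j := by
          simp [K.extend_d_eq e (rfl : e.f i = _) (rfl : e.f j = _)]
        exact (F.map_comp _ _).symm.trans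
          ((congrArg F.map extend_d.symm).trans (F.map_comp _ _)) }
  have map_isZero {i' : ι'} (hi' : ∀ i, e.f i ≠ i') : IsZero (F.obj ((K.extend e).X i')) :=
    F.map_isZero (K.isZero_extend_X e i' hi')
  have hφ : e.HasLift φ := fun j hj i' hij =>
    (map_isZero fun i hi => hj.2 i (hi ▸ hij)).eq_of_src _ _
  let ψ := e.liftExtend φ hφ
  have (i' : ι') : IsIso (ψ.f i') := by
    by_cases hi : ∃ i, e.f i = i'
    · obtain ⟨i, hi⟩ := hi
      refine (e.isIso_liftExtend_f_iff φ hφ hi).2 ?_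
      exact (inferInstance : IsIso (F.map (K.extendXIso e rfl).hom))
    · push Not at hi
      have extend_isZero := ((F.mapHomologicalComplex c).obj K).isZero_extend_X e i' hi
      exact ⟨0, (map_isZero hi).eq_of_src _ _, extend_isZero.eq_of_src _ _⟩
  have : IsIso ψ := HomologicalComplex.Hom.isIso_of_components _
  exact ⟨asIso ψ⟩

variable {Γ Γ' : Type} [SmallCategory Γ] [SmallCategory Γ'] {k : Type u} [Field k]

theorem nonempty_homologyOf_iso_leftDerived (E : FunCat Γ k) (n : ℕ) :
    Nonempty (homologyOf E n ≅ (colim.leftDerived n).obj E) := by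
  obtain ⟨e⟩ := nonempty_mapExtendIso (colim (J := Γ) (C := ModuleCat.{u} k))
    ComplexShape.embeddingDownNat (projectiveResolution E).complex
  exact ⟨(HomologicalComplex.homologyFunctor _ _ (-(n : ℤ))).mapIso e ≪≫
    HomologicalComplex.extendHomologyIso _ _ (j := n) rfl ≪≫
    ((projectiveResolution E).isoLeftDerivedObj colim n).symm⟩

theorem nonempty_homologyOf_iso_of_leftDerived {E : FunCat Γ k} {E' : FunCat Γ' k}
    (e : ∀ n : ℕ, (colim.leftDerived n).obj E ≅ (colim.leftDerived n).obj E') (n : ℤ) :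
    Nonempty (homologyOf E n ≅ homologyOf E' n) := by
  rcases lt_or_ge n 0 with hn | hn
  · have source_isZero := ModuleCat.isZero_iff_subsingleton.2 (subsingleton_homologyOf E hn)
    have target_isZero := ModuleCat.isZero_iff_subsingleton.2 (subsingleton_homologyOf E' hn)
    exact ⟨source_isZero.iso target_isZero⟩
  · lift n to ℕ using hn
    obtain ⟨e₁⟩ := nonempty_homologyOf_iso_leftDerived E n
    obtain ⟨e₂⟩ := nonempty_homologyOf_iso_leftDerived E' n
    exact ⟨e₁ ≪≫ e n ≪≫ e₂.symm⟩

theorem nonempty_homologyOf_iso_of_iso {E E' : FunCat Γ k} (e : E ≅ E') (n : ℤ) :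
    Nonempty (homologyOf E n ≅ homologyOf E' n) :=
  nonempty_homologyOf_iso_of_leftDerived (fun n => (colim.leftDerived n).mapIso e) n

theorem nonempty_homologyOf_iso_of_adj (F : Γ' ⥤ Γ) (L : FunCat Γ' k ⥤ FunCat Γ k) [L.Additive]
    [PreservesFiniteLimits L] [PreservesFiniteColimits L] (adj : L ⊣ pull F) (X : FunCat Γ' k)
    (n : ℤ) : Nonempty (homologyOf (L.obj X) n ≅ homologyOf X n) := by
  have : L.PreservesProjectiveObjects := ⟨fun hP => adj.map_projective _ hP⟩
  let colim_iso : L ⋙ colim ≅ colim := (adj.comp colimConstAdj).leftAdjointUniq colimConstAdj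
  exact nonempty_homologyOf_iso_of_leftDerived (fun n =>
    (L.mapProjectiveResolution (projectiveResolution X)).isoLeftDerivedObj colim n ≪≫
      (HomologicalComplex.homologyFunctor _ _ n).mapIso
        ((NatIso.mapHomologicalComplex colim_iso _).app (projectiveResolution X).complex) ≪≫
      ((projectiveResolution X).isoLeftDerivedObj colim n).symm) n

theorem nonempty_homologyOf_tensor_pointFun_iso {q : ℕ} (A : FunCat (Lambda q) k) (n : ℤ) :
    Nonempty (homologyOf (A ⊗ pointFun k q) n ≅ HH A n) := by
  obtain ⟨e⟩ := nonempty_homologyOf_iso_of_adj (Lambda.j q) (jShriek k q) jShriekAdj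
    ((pull (Lambda.j q)).obj A) n
  obtain ⟨e'⟩ := nonempty_homologyOf_iso_of_iso (jShriekIso A) n
  exact ⟨e'.symm ≪≫ e⟩

end LeftDerived

/-! ### Homology of the derived inverse limit -/

section HomotopyFibre
open HomologicalComplex CochainComplex
variable {k : Type u} [Field k] {X Y : CochainComplex (ModuleCat.{u} k) ℤ}

theorem iso_hom_injective {M N : ModuleCat.{u} k} (e : M ≅ N) : Function.Injective e.hom :=
  (ModuleCat.mono_iff_injective e.hom).1 inferInstance

theorem iso_hom_surjective {M N : ModuleCat.{u} k} (e : M ≅ N) : Function.Surjective e.hom :=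
  (ModuleCat.epi_iff_surjective e.hom).1 inferInstance

/-- The isomorphism `H^a(K[n]) ≅ H^b(K)` for `n + a = b`. -/
def homologyShiftIso (K : CochainComplex (ModuleCat.{u} k) ℤ) (n a b : ℤ) (h : n + a = b) :
    (K⟦n⟧).homology a ≅ K.homology b :=
  (CochainComplex.ShiftSequence.shiftIso (ModuleCat.{u} k) n a b h).app K

theorem homologyShiftIso_naturality (f : X ⟶ Y) (n a b : ℤ) (h : n + a = b) :
    homologyMap (f⟦n⟧') a ≫ (homologyShiftIso Y n a b h).hom =
      (homologyShiftIso X n a b h).hom ≫ homologyMap f b :=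
  (CochainComplex.ShiftSequence.shiftIso (ModuleCat.{u} k) n a b h).hom.naturality f

variable (φ : X ⟶ Y)

/-- The connecting map of the long exact homology sequence of a mapping cone. -/
def coneδ (b a : ℤ) (h : b + 1 = a) : (mappingCone φ).homology b ⟶ X.homology a :=
  homologyδOfTriangle (mappingCone.triangle φ) b a h

theorem exact_coneδ_homologyMap (b a : ℤ) (h : b + 1 = a) :
    Function.Exact (coneδ φ b a h) (homologyMap φ a) := by
  let _ := HasDerivedCategory.standard (ModuleCat.{u} k)
  exact (ShortComplex.ShortExact.moduleCat_exact_iff_function_exact _).1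
    (homologyMap_exact₁_of_distTriang _
      (DerivedCategory.mappingCone_triangle_distinguished φ) b a h)

theorem exact_homologyMap_inr (b : ℤ) :
    Function.Exact (homologyMap φ b) (homologyMap (mappingCone.inr φ) b) := by
  let _ := HasDerivedCategory.standard (ModuleCat.{u} k)
  exact (ShortComplex.ShortExact.moduleCat_exact_iff_function_exact _).1
    (homologyMap_exact₂_of_distTriang _ (DerivedCategory.mappingCone_triangle_distinguished φ) b)

theorem exact_inr_coneδ (b a : ℤ) (h : b + 1 = a) :
    Function.Exact (homologyMap (mappingCone.inr φ) b) (coneδ φ b a h) := by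
  let _ := HasDerivedCategory.standard (ModuleCat.{u} k)
  exact (ShortComplex.ShortExact.moduleCat_exact_iff_function_exact _).1
    (homologyMap_exact₃_of_distTriang _
      (DerivedCategory.mappingCone_triangle_distinguished φ) b a h)

theorem coneδ_injective (b a : ℤ) (h : b + 1 = a)
    (hφ : Function.Surjective (homologyMap φ b)) : Function.Injective (coneδ φ b a h) := by
  rw [injective_iff_map_eq_zero]
  intro y hy
  obtain ⟨z, rfl⟩ := (exact_inr_coneδ φ b a h y).1 hy
  exact (exact_homologyMap_inr φ b z).2 (hφ z)

/-- The projection of the homotopy fibre of `φ` to the source of `φ`. -/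
def fibreProj : (mappingCone φ)⟦(-1 : ℤ)⟧ ⟶ X :=
  ((mappingCone.triangle φ).mor₃)⟦(-1 : ℤ)⟧' ≫ (shiftShiftNeg X (1 : ℤ)).hom

theorem homologyMap_fibreProj (a b : ℤ) (h : b + 1 = a) :
    homologyMap (fibreProj φ) a =
      (homologyShiftIso (mappingCone φ) (-1) a b (by linarith)).hom ≫ coneδ φ b a h :=
  ((homologyFunctor (ModuleCat.{u} k) (ComplexShape.up ℤ)
    0).shiftIso_hom_app_comp_shiftMap_of_add_eq_zero (mappingCone.triangle φ).mor₃ (-1)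
      (by norm_num) b a (by linarith)).symm

theorem fibreProj_exact (a : ℤ) :
    Function.Exact (homologyMap (fibreProj φ) a) (homologyMap φ a) := by
  rw [homologyMap_fibreProj φ a (a - 1) (by ring)]
  exact (iso_hom_surjective _).comp_exact_iff_exact.2
    (exact_coneδ_homologyMap φ (a - 1) a (by ring))

theorem fibreProj_injective (a b : ℤ) (h : b + 1 = a)
    (hφ : Function.Surjective (homologyMap φ b)) :
    Function.Injective (homologyMap (fibreProj φ) a) := by
  rw [homologyMap_fibreProj φ a b h]
  exact (coneδ_injective φ b a h hφ).comp (iso_hom_injective _)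

end HomotopyFibre

section ProductHomology
open HomologicalComplex
variable {k : Type u} [Field k]

theorem exact_iCycles_d (L : CochainComplex (ModuleCat.{u} k) ℤ) {b c : ℤ} (h : b + 1 = c) :
    Function.Exact (L.iCycles b) (L.d b c) :=
  (ShortComplex.ShortExact.moduleCat_exact_iff_function_exact
    (ShortComplex.mk _ _ (L.iCycles_d b c))).1
    (ShortComplex.exact_of_f_is_kernel _ (L.cyclesIsKernel b c (by simp [h])))

theorem exact_toCycles_homologyπ (L : CochainComplex (ModuleCat.{u} k) ℤ) {a b : ℤ}
    (h : a + 1 = b) : Function.Exact (L.toCycles a b) (L.homologyπ b) :=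
  (ShortComplex.ShortExact.moduleCat_exact_iff_function_exact
    (ShortComplex.mk _ _ (L.toCycles_comp_homologyπ a b))).1
    (ShortComplex.exact_of_g_is_cokernel _ (L.homologyIsCokernel a b (by simp [← h])))

theorem iCycles_injective (L : CochainComplex (ModuleCat.{u} k) ℤ) (b : ℤ) :
    Function.Injective (L.iCycles b) :=
  (ModuleCat.mono_iff_injective _).1 inferInstance

theorem homologyπ_surjective (L : CochainComplex (ModuleCat.{u} k) ℤ) (b : ℤ) :
    Function.Surjective (L.homologyπ b) :=
  (ModuleCat.epi_iff_surjective _).1 inferInstance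

theorem homologyπ_eq_zero_iff (L : CochainComplex (ModuleCat.{u} k) ℤ) {a b : ℤ} (h : a + 1 = b)
    (z : L.cycles b) : L.homologyπ b z = 0 ↔ ∃ y : L.X a, L.d a b y = L.iCycles b z := by
  refine (exact_toCycles_homologyπ L h z).trans (exists_congr fun y => ?_)
  rw [← (iCycles_injective L b).eq_iff]
  exact Eq.congr_left (ConcreteCategory.congr_hom (L.toCycles_i a b) y)

theorem homologyMap_homologyπ_apply {L M : CochainComplex (ModuleCat.{u} k) ℤ} (f : L ⟶ M) (b : ℤ)
    (z : L.cycles b) : homologyMap f b (L.homologyπ b z) = M.homologyπ b (cyclesMap f b z) :=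
  ConcreteCategory.congr_hom (homologyπ_naturality f b) z

theorem iCycles_cyclesMap_apply {L M : CochainComplex (ModuleCat.{u} k) ℤ} (f : L ⟶ M) (b : ℤ)
    (z : L.cycles b) : M.iCycles b (cyclesMap f b z) = f.f b (L.iCycles b z) :=
  ConcreteCategory.congr_hom (cyclesMap_i f b) z

theorem d_hom_f_apply {L M : CochainComplex (ModuleCat.{u} k) ℤ} (f : L ⟶ M) (b c : ℤ)
    (x : L.X b) : M.d b c (f.f b x) = f.f c (L.d b c x) :=
  ConcreteCategory.congr_hom (f.comm b c) x

variable {ι : Type} (K : ι → CochainComplex (ModuleCat.{u} k) ℤ)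

theorem pi_f_bijective (b : ℤ) :
    Function.Bijective fun (x : (∏ᶜ K : CochainComplex (ModuleCat.{u} k) ℤ).X b) i =>
      (Pi.π K i).f b x := by
  let evalIsLimit : IsLimit (Fan.mk ((∏ᶜ K).X b) fun i => (Pi.π K i).f b) :=
    isLimitFanMkObjOfIsLimit (eval (ModuleCat.{u} k) (ComplexShape.up ℤ) b) K (Pi.π K)
      (productIsProduct K)
  let e := evalIsLimit.conePointUniqueUpToIso (ModuleCat.productConeIsLimit fun i => (K i).X b)
  have e_apply : ⇑e.hom = fun x i => (Pi.π K i).f b x := funext₂ fun x i =>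
    ConcreteCategory.congr_hom (evalIsLimit.conePointUniqueUpToIso_hom_comp
      (ModuleCat.productConeIsLimit fun i => (K i).X b) ⟨i⟩) x
  exact e_apply ▸ ⟨iso_hom_injective e, iso_hom_surjective e⟩

theorem pi_f_ext {b : ℤ} {x y : (∏ᶜ K : CochainComplex (ModuleCat.{u} k) ℤ).X b}
    (h : ∀ i, (Pi.π K i).f b x = (Pi.π K i).f b y) : x = y :=
  (pi_f_bijective K b).1 (funext h)

theorem homologyMap_pi_surjective (b : ℤ) :
    Function.Surjective fun (x : (∏ᶜ K : CochainComplex (ModuleCat.{u} k) ℤ).homology b) i =>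
      homologyMap (Pi.π K i) b x := by
  intro v
  choose c hc using fun i => homologyπ_surjective (K i) b (v i)
  obtain ⟨x, hx⟩ := (pi_f_bijective K b).2 fun i => (K i).iCycles b (c i)
  replace hx (i : ι) : (Pi.π K i).f b x = (K i).iCycles b (c i) := congrFun hx i
  have d_x : (∏ᶜ K : CochainComplex (ModuleCat.{u} k) ℤ).d b (b + 1) x = 0 :=
    pi_f_ext K fun i => by
      rw [← d_hom_f_apply, hx, (exact_iCycles_d (K i) rfl).apply_apply_eq_zero, map_zero]
  obtain ⟨z, hz⟩ := (exact_iCycles_d (∏ᶜ K) rfl x).1 d_x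
  have component_z (i : ι) : cyclesMap (Pi.π K i) b z = c i :=
    iCycles_injective _ b (by rw [iCycles_cyclesMap_apply, hz, hx])
  refine ⟨(∏ᶜ K : CochainComplex (ModuleCat.{u} k) ℤ).homologyπ b z, funext fun i => ?_⟩
  exact (homologyMap_homologyπ_apply (Pi.π K i) b z).trans (by rw [component_z, hc])

theorem homology_pi_eq_zero {b : ℤ} (x : (∏ᶜ K : CochainComplex (ModuleCat.{u} k) ℤ).homology b)
    (hx : ∀ i, homologyMap (Pi.π K i) b x = 0) : x = 0 := by
  obtain ⟨z, rfl⟩ := homologyπ_surjective _ b x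
  have component_boundary (i : ι) : ∃ y : (K i).X (b - 1), (K i).d (b - 1) b y =
      (Pi.π K i).f b ((∏ᶜ K : CochainComplex (ModuleCat.{u} k) ℤ).iCycles b z) := by
    rw [← iCycles_cyclesMap_apply, ← homologyπ_eq_zero_iff _ (sub_add_cancel b 1),
      ← homologyMap_homologyπ_apply, hx]
  choose y hy using component_boundary
  obtain ⟨w, hw⟩ := (pi_f_bijective K (b - 1)).2 y
  rw [homologyπ_eq_zero_iff _ (sub_add_cancel b 1)]
  refine ⟨w, pi_f_ext K fun i => ?_⟩
  rw [← d_hom_f_apply, ← hy]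
  exact congrArg _ (congrFun hw i)

end ProductHomology

section TelescopeHomology
open HomologicalComplex CochainComplex
variable {k : Type u} [Field k] {K : CochainComplex (ModuleCat.{u} k) ℤ}

/-- The action of a degree `2` endomorphism on homology. -/
def towerAct (U : K ⟶ K⟦(2 : ℤ)⟧) (b b' : ℤ) (h : 2 + b = b') : K.homology b ⟶ K.homology b' :=
  homologyMap U b ≫ (homologyShiftIso K 2 b b' h).hom

variable (K) in
/-- The `i`-th component of a homology class of the product `∏_{i ≥ 0} K[-2i]`. -/
def towerProdEval (i : ℕ) (a b : ℤ) (h : -2 * (i : ℤ) + a = b) :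
    (towerProd K).homology a ⟶ K.homology b :=
  homologyMap (Pi.π (fun i : ℕ => K⟦(-2 * (i : ℤ))⟧) i) a ≫
    (homologyShiftIso K (-2 * (i : ℤ)) a b h).hom

/-- The `i`-th component of a homology class of the derived inverse limit. -/
def telescopeEval (U : K ⟶ K⟦(2 : ℤ)⟧) (i : ℕ) (a b : ℤ) (h : -2 * (i : ℤ) + a = b) :
    (telescope U).homology a ⟶ K.homology b :=
  homologyMap (telescopeProj U i) a ≫ (homologyShiftIso K (-2 * (i : ℤ)) a b h).hom

theorem exists_towerProdEval_eq (a : ℤ) (b : ℕ → ℤ) (hb : ∀ i : ℕ, -2 * (i : ℤ) + a = b i)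
    (v : ∀ i, K.homology (b i)) :
    ∃ x : (towerProd K).homology a, ∀ i, towerProdEval K i a (b i) (hb i) x = v i := by
  choose w hw using fun i : ℕ => iso_hom_surjective (homologyShiftIso K _ a (b i) (hb i)) (v i)
  obtain ⟨x, hx⟩ := homologyMap_pi_surjective (fun i : ℕ => K⟦(-2 * (i : ℤ))⟧) a w
  exact ⟨x, fun i => (congrArg (homologyShiftIso K _ a (b i) (hb i)).hom
    (congrFun hx i)).trans (hw i)⟩

theorem eq_zero_of_towerProdEval_eq_zero (a : ℤ) (b : ℕ → ℤ)
    (hb : ∀ i : ℕ, -2 * (i : ℤ) + a = b i) (x : (towerProd K).homology a)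
    (hx : ∀ i, towerProdEval K i a (b i) (hb i) x = 0) : x = 0 :=
  homology_pi_eq_zero (fun i : ℕ => K⟦(-2 * (i : ℤ))⟧) x fun i =>
    iso_hom_injective (homologyShiftIso K _ a (b i) (hb i))
      ((hx i).trans (map_zero (homologyShiftIso K _ a (b i) (hb i)).hom.hom).symm)

variable (U : K ⟶ K⟦(2 : ℤ)⟧)

theorem homologyMap_towerMap (i : ℕ) (a b c : ℤ) (hc : -2 * ((i + 1 : ℕ) : ℤ) + a = c)
    (hcb : 2 + c = b) (hb : -2 * (i : ℤ) + a = b) :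
    homologyMap (towerMap U i) a ≫ (homologyShiftIso K (-2 * (i : ℤ)) a b hb).hom =
      (homologyShiftIso K (-2 * ((i + 1 : ℕ) : ℤ)) a c hc).hom ≫ towerAct U c b hcb := by
  have shift_add := Functor.shiftIso_hom_app_comp
    (homologyFunctor (ModuleCat.{u} k) (ComplexShape.up ℤ) 0) (-2 * ((i + 1 : ℕ) : ℤ)) 2
    (-2 * (i : ℤ)) (by push_cast; ring) a c b hc hcb K
  refine (eq_whisker (homologyMap_comp (U⟦(-2 * ((i + 1 : ℕ) : ℤ))⟧') _ a) _).trans ?_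
  refine (Category.assoc _ _ _).trans ((whisker_eq _ shift_add.symm).trans ?_)
  refine (Category.assoc _ _ _).symm.trans
    ((eq_whisker (homologyShiftIso_naturality U _ a c hc) _).trans ?_)
  exact Category.assoc _ _ _

theorem idSubShift_comp_π (i : ℕ) :
    idSubShift U ≫ Pi.π (fun i : ℕ => K⟦(-2 * (i : ℤ))⟧) i =
      Pi.π (fun i : ℕ => K⟦(-2 * (i : ℤ))⟧) i -
        Pi.π (fun i : ℕ => K⟦(-2 * (i : ℤ))⟧) (i + 1) ≫ towerMap U i :=
  (Preadditive.sub_comp _ _ _).trans (congrArg₂ (· - ·) (Category.id_comp _) (Pi.lift_π _ _))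

theorem towerProdEval_idSubShift (i : ℕ) (a b c : ℤ) (hc : -2 * ((i + 1 : ℕ) : ℤ) + a = c)
    (hcb : 2 + c = b) (hb : -2 * (i : ℤ) + a = b) (x : (towerProd K).homology a) :
    towerProdEval K i a b hb (homologyMap (idSubShift U) a x) =
      towerProdEval K i a b hb x - towerAct U c b hcb (towerProdEval K (i + 1) a c hc x) := by
  have map_eq : homologyMap (idSubShift U) a ≫ towerProdEval K i a b hb =
      towerProdEval K i a b hb - towerProdEval K (i + 1) a c hc ≫ towerAct U c b hcb := by
    refine (Category.assoc _ _ _).symm.trans ?_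
    refine (eq_whisker ((homologyMap_comp _ _ a).symm.trans
      ((congrArg (homologyMap · a) (idSubShift_comp_π U i)).trans (homologyMap_sub _ _ a)))
      _).trans ?_
    refine (Preadditive.sub_comp _ _ _).trans (congrArg₂ (· - ·) rfl ?_)
    refine (eq_whisker (homologyMap_comp _ _ a) _).trans ((Category.assoc _ _ _).trans ?_)
    exact (whisker_eq _ (homologyMap_towerMap U i a b c hc hcb hb)).trans
      (Category.assoc _ _ _).symm
  exact ConcreteCategory.congr_hom map_eq x

theorem telescopeEval_apply (i : ℕ) (a b : ℤ) (h : -2 * (i : ℤ) + a = b)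
    (x : (telescope U).homology a) :
    telescopeEval U i a b h x =
      towerProdEval K i a b h (homologyMap (fibreProj (idSubShift U)) a x) := by
  have proj_eq : telescopeProj U i = fibreProj (idSubShift U) ≫ Pi.π _ i :=
    (Category.assoc _ _ _).symm
  have eval_eq : telescopeEval U i a b h =
      homologyMap (fibreProj (idSubShift U)) a ≫ towerProdEval K i a b h :=
    (eq_whisker ((congrArg (homologyMap · a) proj_eq).trans (homologyMap_comp _ _ a)) _).trans
      (Category.assoc _ _ _)
  exact ConcreteCategory.congr_hom eval_eq x

theorem towerAct_telescopeEval (i : ℕ) (a b c : ℤ) (hc : -2 * ((i + 1 : ℕ) : ℤ) + a = c)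
    (hcb : 2 + c = b) (hb : -2 * (i : ℤ) + a = b) (x : (telescope U).homology a) :
    towerAct U c b hcb (telescopeEval U (i + 1) a c hc x) = telescopeEval U i a b hb x := by
  rw [telescopeEval_apply, telescopeEval_apply, eq_comm, ← sub_eq_zero,
    ← towerProdEval_idSubShift]
  exact (congrArg (towerProdEval K i a b hb)
    ((fibreProj_exact (idSubShift U) a).apply_apply_eq_zero x)).trans (map_zero _)

theorem exists_telescopeEval_eq (a : ℤ) (b : ℕ → ℤ) (hb : ∀ i : ℕ, -2 * (i : ℤ) + a = b i)
    (hb_succ : ∀ i, 2 + b (i + 1) = b i) (v : ∀ i, K.homology (b i))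
    (hv : ∀ i, towerAct U _ _ (hb_succ i) (v (i + 1)) = v i) :
    ∃ x : (telescope U).homology a, ∀ i, telescopeEval U i a (b i) (hb i) x = v i := by
  obtain ⟨w, hw⟩ := exists_towerProdEval_eq a b hb v
  have idSubShift_w : homologyMap (idSubShift U) a w = 0 :=
    eq_zero_of_towerProdEval_eq_zero a b hb _ fun i => by
      rw [towerProdEval_idSubShift U i a (b i) (b (i + 1)) (hb (i + 1)) (hb_succ i) (hb i), hw, hw,
        hv, sub_self]
  obtain ⟨x, rfl⟩ := (fibreProj_exact (idSubShift U) a w).1 idSubShift_w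
  exact ⟨x, fun i => (telescopeEval_apply U i a (b i) (hb i) x).trans (hw i)⟩

variable (hU : ∀ b b' h, Function.Surjective (towerAct U b b' h))
include hU

-- The components of a preimage are chosen one after the other, so that there is no `lim¹`.
theorem homologyMap_idSubShift_surjective (a : ℤ) :
    Function.Surjective (homologyMap (idSubShift U) a) := by
  intro y
  let b (i : ℕ) : ℤ := -2 * (i : ℤ) + a
  have hb (i : ℕ) : 2 + b (i + 1) = b i := by simp only [b]; push_cast; ring
  choose s hs using fun i => hU (b (i + 1)) (b i) (hb i)
  let v (i : ℕ) : K.homology (b i) :=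
    Nat.rec (motive := fun i => K.homology (b i)) 0
      (fun i x => s i (x - towerProdEval K i a (b i) rfl y)) i
  have act_v (i : ℕ) : towerAct U _ _ (hb i) (v (i + 1)) =
      v i - towerProdEval K i a (b i) rfl y := hs i _
  obtain ⟨x, hx⟩ := exists_towerProdEval_eq a b (fun _ => rfl) v
  refine ⟨x, sub_eq_zero.1 (eq_zero_of_towerProdEval_eq_zero a b (fun _ => rfl) _ fun i => ?_)⟩
  rw [map_sub, towerProdEval_idSubShift U i a (b i) (b (i + 1)) rfl (hb i) rfl, hx, hx, act_v,
    sub_sub_cancel, sub_self]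

theorem eq_zero_of_telescopeEval_eq_zero (a : ℤ) (b : ℕ → ℤ)
    (hb : ∀ i : ℕ, -2 * (i : ℤ) + a = b i) (x : (telescope U).homology a)
    (hx : ∀ i, telescopeEval U i a (b i) (hb i) x = 0) : x = 0 := by
  refine fibreProj_injective (idSubShift U) a (a - 1) (by ring)
    (homologyMap_idSubShift_surjective U hU _) ?_
  refine (eq_zero_of_towerProdEval_eq_zero a b hb _ fun i => ?_).trans (map_zero _).symm
  rw [← telescopeEval_apply, hx]

end TelescopeHomology

/-! ### Coefficients in `u` -/

section LaurentCoefficients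
variable {k : Type u} [Field k] {M H : ℤ → ModuleCat.{u} k}

theorem finite_polyInv_index (n : ℤ) :
    {s : {s : ℤ × ℕ // s.1 + 2 * (s.2 : ℤ) = n} | 0 ≤ s.1.1}.Finite := by
  refine Set.Finite.of_injOn (f := Subtype.val) (t := Set.Icc (0 : ℤ) n ×ˢ Set.Iic n.toNat) ?_
    Subtype.val_injective.injOn ((Set.finite_Icc 0 n).prod (Set.finite_Iic n.toNat))
  rintro ⟨⟨i, l⟩, h⟩ (hi : 0 ≤ i)
  simp only at h
  simp only [Set.mem_prod, Set.mem_Icc, Set.mem_Iic]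
  omega

/-- If `H` vanishes in negative degrees, then an element of degree `n` of `H[u⁻¹]` is an arbitrary
family of coefficients. -/
def polyInvEquiv (hH : ∀ n < 0, Subsingleton (H n)) (n : ℤ) :
    PolyInv H n ≃ₗ[k] ∀ s : {s : ℤ × ℕ // s.1 + 2 * (s.2 : ℤ) = n}, H s.1.1 :=
  LinearEquiv.ofBijective
    (LinearMap.pi fun s => DirectSum.component k _ (fun s => H s.1.1) s) <| by
    classical
    refine ⟨fun x y h => DFinsupp.ext fun s => congrFun h s, fun a => ?_⟩
    let β (s : {s : ℤ × ℕ // s.1 + 2 * (s.2 : ℤ) = n}) : Type u := H s.1.1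
    let _ (s) : AddCommMonoid (β s) := inferInstanceAs (AddCommMonoid (H s.1.1))
    let support := (finite_polyInv_index n).toFinset
    refine ⟨DirectSum.mk β support fun s => a s, funext fun s => ?_⟩
    by_cases hs : s ∈ support
    · exact DirectSum.mk_apply_of_mem (β := β) (f := fun s => a s) hs
    · have := hH s.1.1 (by simpa [support] using hs)
      exact Subsingleton.elim _ _

/-- A graded space `M`, vanishing in negative degrees, with a surjective operator `u` of degree
`-2`, and a graded space `H` identified with the kernel of `u`, with a retraction of `M` onto it. -/
structure DivisibleTower (M H : ℤ → ModuleCat.{u} k) where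
  /-- The operator `u`. -/
  act : ∀ n n' : ℤ, n' + 2 = n → (M n →ₗ[k] M n')
  incl : ∀ n, H n →ₗ[k] M n
  retract : ∀ n, M n →ₗ[k] H n
  retract_incl : ∀ n y, retract n (incl n y) = y
  exact : ∀ n n' h, Function.Exact (incl n) (act n n' h)
  surjective : ∀ n n' h, Function.Surjective (act n n' h)
  subsingleton : ∀ n < 0, Subsingleton (M n)

namespace DivisibleTower
variable (T : DivisibleTower M H)

include T in
theorem subsingleton_coefficients (n : ℤ) (hn : n < 0) : Subsingleton (H n) :=
  have := T.subsingleton n hn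
  (Function.LeftInverse.injective (T.retract_incl n)).subsingleton

/-- The coefficient at `u^{-l}` of an element `x` of `M n`: the retraction of `u^l x`. -/
def coefficient : ∀ (l : ℕ) (n i : ℤ), i + 2 * (l : ℤ) = n → (M n →ₗ[k] H i)
  | 0, n, i, h => (show i = n by simpa using h) ▸ T.retract i
  | l + 1, n, i, h => (coefficient l (n - 2) i (by push_cast at h; linarith)).comp
      (T.act n (n - 2) (by ring))

theorem coefficient_zero (n : ℤ) (h : n + 2 * ((0 : ℕ) : ℤ) = n) :
    T.coefficient 0 n n h = T.retract n := rfl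

theorem coefficient_act (l : ℕ) (n n' i : ℤ) (hn : n' + 2 = n) (h : i + 2 * (l : ℤ) = n')
    (h' : i + 2 * ((l + 1 : ℕ) : ℤ) = n) (x : M n) :
    T.coefficient l n' i h (T.act n n' hn x) = T.coefficient (l + 1) n i h' x := by
  obtain rfl : n' = n - 2 := by linarith
  rfl

theorem eq_zero_of_coefficient_eq_zero (n : ℤ) (x : M n)
    (hx : ∀ l i h, T.coefficient l n i h x = 0) : x = 0 := by
  obtain ⟨N, hN⟩ : ∃ N : ℕ, n < N := ⟨(n + 1).toNat, by omega⟩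
  induction N generalizing n with
  | zero =>
    have := T.subsingleton n (by simpa using hN)
    exact Subsingleton.elim _ _
  | succ N ih =>
    have act_x : T.act n (n - 2) (by ring) x = 0 :=
      ih (n - 2) _ (fun l i h => by
        rw [T.coefficient_act l n (n - 2) i (by ring) h (by push_cast; linarith), hx])
        (by push_cast at hN; linarith)
    obtain ⟨y, rfl⟩ := (T.exact n (n - 2) (by ring) x).1 act_x
    have y_eq_zero := hx 0 n (by simp)
    rw [coefficient_zero, T.retract_incl] at y_eq_zero
    rw [y_eq_zero, map_zero]

theorem exists_coefficient_eq (n : ℤ) (a : ∀ (l : ℕ) (i : ℤ), i + 2 * (l : ℤ) = n → H i) :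
    ∃ x : M n, ∀ l i h, T.coefficient l n i h x = a l i h := by
  obtain ⟨N, hN⟩ : ∃ N : ℕ, n < N := ⟨(n + 1).toNat, by omega⟩
  induction N generalizing n with
  | zero =>
    refine ⟨0, fun l i h => ?_⟩
    have := T.subsingleton_coefficients i (by push_cast at hN; omega)
    exact Subsingleton.elim _ _
  | succ N ih =>
    obtain ⟨ux, hux⟩ := ih (n - 2) (fun l i h => a (l + 1) i (by push_cast; linarith))
      (by push_cast at hN; linarith)
    obtain ⟨x, rfl⟩ := T.surjective n (n - 2) (by ring) ux
    refine ⟨x + T.incl n (a 0 n (by simp) - T.retract n x), fun l i h => ?_⟩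
    cases l with
    | zero =>
      obtain rfl : i = n := by simpa using h
      rw [coefficient_zero, map_add, T.retract_incl, add_sub_cancel]
    | succ l =>
      rw [← T.coefficient_act l n (n - 2) i (by ring) (by push_cast at h; linarith), map_add,
        (T.exact n _ _).apply_apply_eq_zero, map_add, map_zero, hux]
      exact add_zero _

/-- An element of `M n` as the family of its coefficients. -/
def coefficientEquiv (n : ℤ) :
    M n ≃ₗ[k] ∀ s : {s : ℤ × ℕ // s.1 + 2 * (s.2 : ℤ) = n}, H s.1.1 :=
  LinearEquiv.ofBijective (LinearMap.pi fun s => T.coefficient s.1.2 n s.1.1 s.2) <| by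
    constructor
    · rw [injective_iff_map_eq_zero]
      exact fun x hx => T.eq_zero_of_coefficient_eq_zero n x fun l i h => congrFun hx ⟨(i, l), h⟩
    · intro a
      obtain ⟨x, hx⟩ := T.exists_coefficient_eq n fun l i h => a ⟨(i, l), h⟩
      exact ⟨x, funext fun s => hx _ _ s.2⟩

/-- The isomorphism `M ≅ H[u⁻¹]`. -/
def equivPolyInv (n : ℤ) : M n ≃ₗ[k] PolyInv H n :=
  (T.coefficientEquiv n).trans (polyInvEquiv T.subsingleton_coefficients n).symm

theorem equivPolyInv_apply (n : ℤ) (x : M n) (i : ℤ) (l : ℕ) (h : i + 2 * (l : ℤ) = n) :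
    T.equivPolyInv n x ⟨(i, l), h⟩ = T.coefficient l n i h x :=
  congrFun ((polyInvEquiv T.subsingleton_coefficients n).apply_symm_apply
    (T.coefficientEquiv n x)) ⟨(i, l), h⟩

/-- The space `P` as the inverse limit of the tower in degree `n`: the space of all families of
`x_m ∈ M (n + 2m)` with `u x_{m+1} = x_m`. -/
structure Limit (P : ModuleCat.{u} k) (n : ℤ) where
  eval : ∀ (m : ℕ) (n' : ℤ), n + 2 * (m : ℤ) = n' → (P →ₗ[k] M n')
  act_eval : ∀ m n' n'' h h' h'' y, T.act n'' n' h'' (eval (m + 1) n'' h' y) = eval m n' h y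
  eq_zero_of_eval_eq_zero : ∀ y, (∀ m, eval m _ rfl y = 0) → y = 0
  exists_eval_eq : ∀ v : ∀ m : ℕ, M (n + 2 * (m : ℤ)),
    (∀ m, T.act _ _ (by push_cast; ring) (v (m + 1)) = v m) → ∃ y, ∀ m, eval m _ rfl y = v m

namespace Limit
variable {T} {P : ModuleCat.{u} k} {n : ℤ} (L : T.Limit P n)

theorem coefficient_eval_add (m l t : ℕ) (i : ℤ) (h : i + 2 * (l : ℤ) = n + 2 * (m : ℤ))
    (h' : i + 2 * ((l + t : ℕ) : ℤ) = n + 2 * ((m + t : ℕ) : ℤ)) (y : P) :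
    T.coefficient (l + t) _ i h' (L.eval (m + t) _ rfl y) =
      T.coefficient l _ i h (L.eval m _ rfl y) := by
  induction t with
  | zero => rfl
  | succ t ih =>
    rw [← ih (by push_cast; linarith), ← L.act_eval (m + t) _ _ rfl rfl (by push_cast; ring),
      T.coefficient_act]
    rfl

theorem coefficient_eval_congr {m m' l l' : ℕ} (i : ℤ) (h : i + 2 * (l : ℤ) = n + 2 * (m : ℤ))
    (h' : i + 2 * (l' : ℤ) = n + 2 * (m' : ℤ)) (y : P) :
    T.coefficient l _ i h (L.eval m _ rfl y) = T.coefficient l' _ i h' (L.eval m' _ rfl y) := by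
  wlog hl : l ≤ l' generalizing l l' m m'
  · exact (this h' h (le_of_not_ge hl)).symm
  obtain ⟨t, rfl⟩ := Nat.exists_eq_add_of_le hl
  obtain rfl : m' = m + t := by push_cast at h'; omega
  exact (L.coefficient_eval_add m l t i h h' y).symm

/-- The Laurent series of an element of the limit. Its coefficient at `u ^ j` is the coefficient of
any component `x_m` with `m ≥ j` at `u ^ (j - m)`; the definition takes `m = max j 0`. -/
def toLaurent : P →ₗ[k] Laurent H n :=
  LinearMap.codRestrict (Laurent H n)
    (LinearMap.pi fun s => (T.coefficient (-s.1.2).toNat _ s.1.1 (by have := s.2; omega)).comp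
      (L.eval s.1.2.toNat _ rfl))
    fun y => ⟨-|n|, fun s hs => by
      have := T.subsingleton_coefficients s.1.1
        (by have := s.2; have := neg_abs_le n; have := le_abs_self n; omega)
      exact Subsingleton.elim _ _⟩

theorem toLaurent_apply (y : P) (m l : ℕ) (i : ℤ) (h : i + 2 * (l : ℤ) = n + 2 * (m : ℤ))
    (h' : i - 2 * ((m : ℤ) - l) = n) :
    (L.toLaurent y).1 ⟨(i, (m : ℤ) - l), h'⟩ = T.coefficient l _ i h (L.eval m _ rfl y) :=
  L.coefficient_eval_congr i (by simp only; omega) h y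

theorem toLaurent_injective : Function.Injective L.toLaurent := by
  rw [injective_iff_map_eq_zero]
  intro y hy
  refine L.eq_zero_of_eval_eq_zero y fun m =>
    T.eq_zero_of_coefficient_eq_zero _ _ fun l i h => ?_
  rw [← L.toLaurent_apply y m l i h (by linarith), hy]
  rfl

theorem toLaurent_surjective : Function.Surjective L.toLaurent := by
  intro a
  have a_congr {i j j' : ℤ} (e : j = j') (h : i - 2 * j = n) (h' : i - 2 * j' = n) :
      a.1 ⟨(i, j), h⟩ = a.1 ⟨(i, j'), h'⟩ := by subst e; rfl
  choose v hv using fun m : ℕ => T.exists_coefficient_eq (n + 2 * (m : ℤ)) fun l i h =>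
    a.1 ⟨(i, (m : ℤ) - l), by linarith⟩
  have act_v (m : ℕ) : T.act _ _ (by push_cast; ring) (v (m + 1)) = v m := by
    refine sub_eq_zero.1 (T.eq_zero_of_coefficient_eq_zero _ _ fun l i h => ?_)
    rw [map_sub, T.coefficient_act l _ _ i _ h (by push_cast; linarith), hv, hv, sub_eq_zero]
    exact a_congr (by push_cast; ring) _ _
  obtain ⟨y, hy⟩ := L.exists_eval_eq v act_v
  refine ⟨y, Subtype.ext (funext fun ⟨⟨i, j⟩, h⟩ => ?_)⟩
  have j_eq : j = (j.toNat : ℤ) - ((-j).toNat : ℕ) := by omega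
  refine (congrArg (T.coefficient _ _ i _) (hy j.toNat)).trans ?_
  exact (hv _ _ _ _).trans (a_congr j_eq.symm _ _)

/-- The isomorphism `P ≅ H((u))`. -/
def equivLaurent : P ≃ₗ[k] Laurent H n :=
  LinearEquiv.ofBijective L.toLaurent ⟨L.toLaurent_injective, L.toLaurent_surjective⟩

end Limit
end DivisibleTower

end LaurentCoefficients

section CyclicTower
variable {k : Type u} [Field k]

theorem exists_retraction {V W : ModuleCat.{u} k} (f : V ⟶ W) (hf : Function.Injective f) :
    ∃ r : W →ₗ[k] V, ∀ x, r (f x) = x := by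
  obtain ⟨r, hr⟩ := f.hom.exists_leftInverse_of_injective (LinearMap.ker_eq_bot.2 hf)
  exact ⟨r, fun x => LinearMap.congr_fun hr x⟩

/-- The map `HH_n(A) ⟶ HC_n(A)` of the Gysin sequence, through `H_n(A ⊗ j_! k) ≅ HH_n(A)`. -/
def hochschildToCyclic {q : ℕ} (A : FunCat (Lambda q) k) (n : ℤ) : HH A n ⟶ HC A n :=
  (nonempty_homologyOf_tensor_pointFun_iso A n).some.inv ≫ augHomology A n

theorem hochschildToCyclic_exact {q : ℕ} [NeZero q] (A : FunCat (Lambda q) k) (n : ℤ) :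
    Function.Exact (hochschildToCyclic A n) (periodicity A n) :=
  (iso_hom_surjective
    (nonempty_homologyOf_tensor_pointFun_iso A n).some.symm).comp_exact_iff_exact.2
      (augHomology_exact A n)

variable {q : ℕ} [NeZero q] (hq : (q : k) = 0)

include hq in
theorem hochschildToCyclic_injective (E : FunCat (Lambda 1) k) (n : ℤ) :
    Function.Injective (hochschildToCyclic (Lambda.proj q ⋙ E) n) :=
  (augHomology_injective hq E n).comp
    (iso_hom_injective (nonempty_homologyOf_tensor_pointFun_iso (Lambda.proj q ⋙ E) n).some.symm)

/-- The cyclic homology of the pull-back of a cyclic vector space to `Λ_q`, with the periodicity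
map. -/
def cyclicTower (E : FunCat (Lambda 1) k) :
    DivisibleTower (HC (Lambda.proj q ⋙ E)) (HH E) :=
  let A : FunCat (Lambda q) k := Lambda.proj q ⋙ E
  { act := fun n n' h =>
      (towerAct (capMap A (periodicityClass k q)) (-n) (-n') (by linarith)).hom
    incl := fun n => (hochschildToCyclic A n).hom
    retract := fun n =>
      (exists_retraction (hochschildToCyclic A n) (hochschildToCyclic_injective hq E n)).choose
    retract_incl := fun n =>
      (exists_retraction (hochschildToCyclic A n) (hochschildToCyclic_injective hq E n)).choose_spec
    exact := fun n n' h => by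
      obtain rfl : n' = n - 2 := by linarith
      exact hochschildToCyclic_exact A n
    surjective := fun n n' h => by
      obtain rfl : n' = n - 2 := by linarith
      exact periodicity_surjective hq E n
    subsingleton := fun n hn => subsingleton_homologyOf A hn }

theorem cyclicTower_act (E : FunCat (Lambda 1) k) (n : ℤ) (x : HC (Lambda.proj q ⋙ E) n) :
    (cyclicTower hq E).act n (n - 2) (by ring) x = periodicity (Lambda.proj q ⋙ E) n x := rfl

/-- Periodic cyclic homology as the inverse limit of cyclic homology along the periodicity map. -/
def cyclicLimit (E : FunCat (Lambda 1) k) (n : ℤ) :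
    (cyclicTower hq E).Limit (HP (Lambda.proj q ⋙ E) n) n where
  eval m n' h := (telescopeEval (capMap (Lambda.proj q ⋙ E) (periodicityClass k q)) m (-n) (-n')
    (by linarith)).hom
  act_eval m n' n'' h h' h'' y := towerAct_telescopeEval _ m (-n) (-n') (-n'') _ _ _ y
  eq_zero_of_eval_eq_zero y hy := eq_zero_of_telescopeEval_eq_zero _ (fun b b' h => by
      obtain ⟨c, rfl⟩ : ∃ c, b = -c := ⟨-b, by ring⟩
      obtain ⟨c', rfl⟩ : ∃ c', b' = -c' := ⟨-b', by ring⟩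
      exact (cyclicTower hq E).surjective c c' (by linarith))
    (-n) (fun m => -(n + 2 * (m : ℤ))) (fun m => by ring) y hy
  exists_eval_eq v hv := exists_telescopeEval_eq _ (-n) (fun m => -(n + 2 * (m : ℤ)))
    (fun m => by ring) (fun m => by push_cast; ring) v hv

theorem cyclicLimit_eval (E : FunCat (Lambda 1) k) (n : ℤ) (m : ℕ)
    (y : HP (Lambda.proj q ⋙ E) n) :
    (cyclicLimit hq E n).eval m _ rfl y = HPtoHC (Lambda.proj q ⋙ E) n m y := rfl

end CyclicTower

end CyclicHomology

end

theorem lemma1p10_general {k : Type u} [Field k] (q : ℕ) [NeZero q] (hq : (q : k) = 0) :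
    (∀ E : Lambda 1 ⥤ ModuleCat.{u} k,
      ∃ (eC : ∀ n : ℤ, HC (Lambda.proj q ⋙ E) n ≃ₗ[k] PolyInv (HH E) n)
        (eP : ∀ n : ℤ, HP (Lambda.proj q ⋙ E) n ≃ₗ[k] Laurent (HH E) n),
        (∀ (n : ℤ) (x : HC (Lambda.proj q ⋙ E) n) (i : ℤ) (l : ℕ)
          (h : i + 2 * (l : ℤ) = n - 2),
          eC (n - 2) (periodicity (Lambda.proj q ⋙ E) n x) ⟨(i, l), h⟩ =
            eC n x ⟨(i, l + 1), by push_cast; linarith⟩) ∧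
        (∀ (n : ℤ) (y : HP (Lambda.proj q ⋙ E) n) (m : ℕ) (i : ℤ) (l : ℕ)
          (h : i + 2 * (l : ℤ) = n + 2 * m),
          eC (n + 2 * m) (HPtoHC (Lambda.proj q ⋙ E) n m y) ⟨(i, l), h⟩ =
            (eP n y).1 ⟨(i, (m : ℤ) - l), by linarith⟩)) ∧
    (∀ x : Coh (Lambda 1) k 2, cohPull k (Lambda.proj q) 2 x = 0) := by
  refine ⟨fun E => ⟨(cyclicTower hq E).equivPolyInv, fun n => (cyclicLimit hq E n).equivLaurent,
    fun n x i l h => ?_, fun n y m i l h => ?_⟩, cohPull_proj_eq_zero hq⟩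
  · rw [DivisibleTower.equivPolyInv_apply, DivisibleTower.equivPolyInv_apply,
      ← cyclicTower_act hq]
    exact (cyclicTower hq E).coefficient_act l n (n - 2) i _ h _ x
  · rw [DivisibleTower.equivPolyInv_apply, ← cyclicLimit_eval hq]
    exact ((cyclicLimit hq E n).toLaurent_apply y m l i h _).symm

theorem lemma1p10 {k : Type u} [Field k] (p : ℕ) [Fact p.Prime] [CharP k p] :
    (∀ E : Lambda 1 ⥤ ModuleCat.{u} k,
      ∃ (eC : ∀ n : ℤ, HC (Lambda.proj p ⋙ E) n ≃ₗ[k] PolyInv (HH E) n)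
        (eP : ∀ n : ℤ, HP (Lambda.proj p ⋙ E) n ≃ₗ[k] Laurent (HH E) n),
        (∀ (n : ℤ) (x : HC (Lambda.proj p ⋙ E) n) (i : ℤ) (l : ℕ)
          (h : i + 2 * (l : ℤ) = n - 2),
          eC (n - 2) (periodicity (Lambda.proj p ⋙ E) n x) ⟨(i, l), h⟩ =
            eC n x ⟨(i, l + 1), by push_cast; linarith⟩) ∧
        (∀ (n : ℤ) (y : HP (Lambda.proj p ⋙ E) n) (m : ℕ) (i : ℤ) (l : ℕ)
          (h : i + 2 * (l : ℤ) = n + 2 * m),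
          eC (n + 2 * m) (HPtoHC (Lambda.proj p ⋙ E) n m y) ⟨(i, l), h⟩ =
            (eP n y).1 ⟨(i, (m : ℤ) - l), by linarith⟩)) ∧
    (∀ x : Coh (Lambda 1) k 2, cohPull k (Lambda.proj p) 2 x = 0) :=
  lemma1p10_general p (CharP.cast_eq_zero k p)
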